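/- There is an absolute constant $C>0$ with the following property. Let $n,d$ be non-negative integers, let $\xi_1,\dots,\xi_n$ be independent centered random vectors in $\mathbb{R}^d$ with finite fourth moments, $\mathbb{E}|\xi_i|^4<\infty$, and set $W=\sum_{i=1}^n\xi_i$. Let $\Sigma$ be an invertible $d\times d$ covariance matrix (that is, $\Sigma$ is symmetric, positive semidefinite and invertible; it need not be equal to $\operatorname{Var}(W)$) and let $Z\sim N(0,\Sigma)$ be a centered Gaussian vector in $\mathbb{R}^d$ with covariance matrix $\Sigma$. Then $$\sup_{A\in\mathcal{B}}\bigl|\mathbb{P}(W\in A)-\mathbb{P}(Z\in A)\bigr|\le C\,\Psi\bigl(\delta_{\mathcal{B}}(W,\Sigma)\bigr),$$ where $\mathcal{B}$ is the set of all Euclidean balls in $\mathbb{R}^d$ (open or closed, with arbitrary center), $\Psi(x)=x\,(|\log x|\vee 1)$ for $x>0$, $\Psi(0)=0$, and $$\delta_{\mathcal{B}}(W,\Sigma)=\|\Sigma^{-1}\|_{op}\Bigl\{\|\Sigma-\operatorname{Var}(W)\|_{H.S.}+\Bigl(\sum_{i=1}^n\mathbb{E}\bigl[|\xi_i|^4\bigr]\Bigr)^{1/2}\Bigr\}.$$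 Here $|\cdot|$ is the Euclidean norm, $\|\cdot\|_{op}$ the operator norm and $\|\cdot\|_{H.S.}$ the Hilbert--Schmidt norm of a matrix, and $\operatorname{Var}(W)$ is the covariance matrix of $W$. The constant $C$ depends on neither $n$, $d$, $\Sigma$ nor the distributions of the $\xi_i$. -/

import Mathlib

open MeasureTheory ProbabilityTheory

noncomputable section

section Norms

open scoped Matrix.Norms.L2Operator in
/-- The operator norm of a real matrix with respect to the Euclidean norms. -/
def matOpNorm {d : ℕ} (M : Matrix (Fin d) (Fin d) ℝ) : ℝ := ‖M‖

open scoped Matrix.Norms.Frobenius in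
/-- The Hilbert-Schmidt (Frobenius) norm of a real matrix. -/
def matHSNorm {d : ℕ} (M : Matrix (Fin d) (Fin d) ℝ) : ℝ := ‖M‖

theorem matOpNorm_eq_norm_toEuclideanCLM {d : ℕ} (M : Matrix (Fin d) (Fin d) ℝ) :
    matOpNorm M = ‖Matrix.toEuclideanCLM (n := Fin d) (𝕜 := ℝ) M‖ := rfl

theorem matHSNorm_eq_sqrt {d : ℕ} (M : Matrix (Fin d) (Fin d) ℝ) :
    matHSNorm M = Real.sqrt (∑ j, ∑ k, M j k ^ 2) := by
  rw [matHSNorm, Matrix.frobenius_norm_def, Real.sqrt_eq_rpow]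
  simp [sq_abs]

end Norms

/-- The covariance matrix `Var(X)` of a random vector `X` in `ℝ^d`: its `(j, k)` entry is
`Cov(X_j, X_k)`. -/
def varMatrix {Ω : Type*} [MeasurableSpace Ω] (P : Measure Ω) {d : ℕ}
    (X : Ω → EuclideanSpace ℝ (Fin d)) : Matrix (Fin d) (Fin d) ℝ :=
  Matrix.of fun j k => cov[fun ω => X ω j, fun ω => X ω k; P]

/-- The function `Ψ(x) = x (|log x| ∨ 1)`. (With `Real.log 0 = 0` one gets `Ψ(0) = 0`.) -/
def psiLog (x : ℝ) : ℝ := x * max |Real.log x| 1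

/-- The set of all Euclidean balls in `ℝ^d`, open or closed, with any center. -/
def euclideanBalls (d : ℕ) : Set (Set (EuclideanSpace ℝ (Fin d))) :=
  {A | ∃ (x : EuclideanSpace ℝ (Fin d)) (r : ℝ), 0 ≤ r ∧
    (A = Metric.ball x r ∨ A = Metric.closedBall x r)}

/-- `δ_B(W, Σ) = ‖Σ⁻¹‖_op {‖Σ - Var(W)‖_HS + (∑ᵢ E|ξᵢ|⁴)^{1/2}}` for `W = ∑ᵢ ξᵢ`. -/
def deltaBall {Ω : Type*} [MeasurableSpace Ω] (P : Measure Ω) {n d : ℕ}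
    (ξ : Fin n → Ω → EuclideanSpace ℝ (Fin d)) (S : Matrix (Fin d) (Fin d) ℝ) : ℝ :=
  matOpNorm (S⁻¹) *
    (matHSNorm (S - varMatrix P (fun ω => ∑ i, ξ i ω)) +
      Real.sqrt (∑ i, ∫ ω, ‖ξ i ω‖ ^ 4 ∂P))

end

/-!
# Gaussian approximation of sums of independent vectors on Euclidean balls

Let `W` be a sum of independent centered vectors `ξ_k` and `Z ∼ N(0, S)`. Scaling by `‖S⁻¹‖^{1/2}`
reduces the claim to `S ≥ 1` (`posSemidef_smul_sub_one`), where the error quantity is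
`δ = ‖S - Var W‖ + (∑ E|ξ_k|⁴)^{1/2}` with the Hilbert-Schmidt norm. The proof compares `W` with `Z`
on a smoothed indicator `h(x) = g(|x - a|²)` of a ball, where `g` falls from one to zero while
`|x - a|` crosses a shell `ρ < |x - a| ≤ ρ + ε`.

Two dimension-free facts about Gaussian measures are needed, both consequences of Stein's identity
`stdGaussian_integral_inner_mul`. Shells of thickness `ε` have measure at most a constant times `ε`
(`stdGaussian_shell_le`): the identity is applied to the radial field `Φ(|z - a|²) (z - a)`, with `Φ`
a smooth step divided by `|z - a|`, and the remaining drift has bounded mean by Chebyshev's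
inequality. The Gaussian average of the pairing of a matrix `A` with the Hessian of `h` at scale `s`
is of order `‖A‖ / s²`, because the quadratic form attached to `A` has standard deviation of order
`‖A‖` (`abs_integral_hessian_le`); for `ρ ≥ ε √d` it is also of order `‖A‖ / ε²`
(`abs_sum_mul_radHess_le`). Balls of radius less than `ε √d` have Gaussian measure of order `ε`
(`stdGaussian_smallBall_le`) and can be neglected.

The expectation of `h(cos θ W + sin θ Z)` is differentiated in `θ`. The Gaussian part is integrated by
parts. For the part of `ξ_k`, an exchangeable pair formed with an independent copy of `ξ_k` and the
trapezoidal rule give the pairing of the Hessian with `½ (ξ_k ξ_kᵀ + E ξ_k ξ_kᵀ)`, with a remainder of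
fourth order and no third-order term (`abs_integral_rad1_sub_le`). The matrices sum up to `Var W`
with an error of order `δ` in Hilbert-Schmidt norm
(`IndepSummands.integral_matHSNorm_sub_sumHalf_le`). The remainder involves a fourth derivative of
`h`, of order `ε⁻² (ε² + sin² θ)⁻¹` after averaging, times the probability `τ` that the leave-one-out
sum `W - ξ_k` lies in a shell. Integrating over `θ` yields the error `(δ + τ δ² / ε²) log (1 + ε⁻²)`
(`abs_integral_rad0_sub_le`).

Finally `τ` is bounded by induction on the number of summands: the leave-one-out sum satisfies the
claimed bound with `2δ` in place of `δ` (`IndepSummands.error_erase_le`), so `τ` is of order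
`ε + C Ψ(δ)`. With `ε` a large multiple of `δ |log δ|` the bound for `W` closes with the same
constant `C` (`abs_measureReal_sum_mem_closedBall_sub_le`).
-/

open scoped RealInnerProductSpace

/-! ### Gaussian integration by parts -/

section PolyGrowth

variable {E F : Type*} [NormedAddCommGroup E] [NormedAddCommGroup F]

/-- Continuous real functions of at most polynomial growth: the class of functions that is closed
under the algebraic operations below and integrable against every Gaussian measure. -/
structure PolyGrowth (f : E → ℝ) : Prop where
  continuous : Continuous f
  bound : ∃ (C : ℝ) (k : ℕ), 0 ≤ C ∧ ∀ x, |f x| ≤ C * (1 + ‖x‖) ^ k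

theorem PolyGrowth.of_bound {f : E → ℝ} (hf : Continuous f) (C : ℝ) (h : ∀ x, |f x| ≤ C) :
    PolyGrowth f :=
  ⟨hf, C, 0, (abs_nonneg _).trans (h 0), by simpa using h⟩

theorem PolyGrowth.const (c : ℝ) : PolyGrowth (fun _ : E => c) :=
  .of_bound continuous_const |c| fun _ => le_rfl

theorem PolyGrowth.mul {f g : E → ℝ} (hf : PolyGrowth f) (hg : PolyGrowth g) :
    PolyGrowth (fun x => f x * g x) := by
  obtain ⟨hfc, C, k, hC, h⟩ := hf
  obtain ⟨hgc, D, l, hD, h'⟩ := hg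
  refine ⟨hfc.mul hgc, C * D, k + l, by positivity, fun x => ?_⟩
  rw [abs_mul]
  calc |f x| * |g x| ≤ (C * (1 + ‖x‖) ^ k) * (D * (1 + ‖x‖) ^ l) := by
        gcongr
        · exact h x
        · exact h' x
    _ = _ := by ring

theorem PolyGrowth.add {f g : E → ℝ} (hf : PolyGrowth f) (hg : PolyGrowth g) :
    PolyGrowth (fun x => f x + g x) := by
  obtain ⟨hfc, C, k, hC, h⟩ := hf
  obtain ⟨hgc, D, l, hD, h'⟩ := hg
  refine ⟨hfc.add hgc, C + D, k + l, by positivity, fun x => (abs_add_le _ _).trans ?_⟩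
  have h1 : (1 + ‖x‖) ^ k ≤ (1 + ‖x‖) ^ (k + l) :=
    pow_le_pow_right₀ (by linarith [norm_nonneg x]) (by omega)
  have h2 : (1 + ‖x‖) ^ l ≤ (1 + ‖x‖) ^ (k + l) :=
    pow_le_pow_right₀ (by linarith [norm_nonneg x]) (by omega)
  have := h x
  have := h' x
  nlinarith [mul_le_mul_of_nonneg_left h1 hC, mul_le_mul_of_nonneg_left h2 hD]

theorem PolyGrowth.const_mul {f : E → ℝ} (hf : PolyGrowth f) (c : ℝ) :
    PolyGrowth (fun x => c * f x) := (PolyGrowth.const c).mul hf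

theorem PolyGrowth.neg {f : E → ℝ} (hf : PolyGrowth f) : PolyGrowth (fun x => - f x) := by
  simpa using hf.const_mul (-1)

theorem PolyGrowth.sub {f g : E → ℝ} (hf : PolyGrowth f) (hg : PolyGrowth g) :
    PolyGrowth (fun x => f x - g x) := by
  simpa [sub_eq_add_neg] using hf.add hg.neg

theorem PolyGrowth.sum {ι : Type*} {s : Finset ι} {f : ι → E → ℝ}
    (hf : ∀ i ∈ s, PolyGrowth (f i)) : PolyGrowth (fun x => ∑ i ∈ s, f i x) := by
  classical
  induction s using Finset.induction_on with
  | empty => simpa using PolyGrowth.const (E := E) 0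
  | insert a s ha ih =>
    simp only [Finset.sum_insert ha]
    exact (hf a (by simp)).add (ih fun i hi => hf i (by simp [hi]))

theorem PolyGrowth.norm_sq_sub (a : E) : PolyGrowth (fun x : E => ‖x - a‖ ^ 2) := by
  refine ⟨by fun_prop, (1 + ‖a‖) ^ 2, 2, by positivity, fun x => ?_⟩
  rw [abs_of_nonneg (by positivity), ← mul_pow]
  have := norm_sub_le x a
  gcongr
  nlinarith [norm_nonneg x, norm_nonneg a]

theorem PolyGrowth.pow {f : E → ℝ} (hf : PolyGrowth f) (n : ℕ) : PolyGrowth (fun x => f x ^ n) := by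
  induction n with
  | zero => simpa using PolyGrowth.const (E := E) 1
  | succ n ih => simpa only [pow_succ] using ih.mul hf

theorem PolyGrowth.abs {f : E → ℝ} (hf : PolyGrowth f) : PolyGrowth (fun x => |f x|) := by
  obtain ⟨hfc, C, k, hC, h⟩ := hf
  exact ⟨hfc.abs, C, k, hC, by simpa using h⟩

/-- Composition with a continuous map of at most linear growth. -/
theorem PolyGrowth.comp {f : E → ℝ} (hf : PolyGrowth f) {T : F → E} (hT : Continuous T) (K : ℝ)
    (hK : ∀ x, ‖T x‖ ≤ K * (1 + ‖x‖)) : PolyGrowth (fun x => f (T x)) := by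
  obtain ⟨hfc, C, k, hC, h⟩ := hf
  refine ⟨hfc.comp hT, C * (1 + K) ^ k, k, ?_, fun x => (h _).trans ?_⟩
  · have := (norm_nonneg _).trans (hK 0)
    have : 0 ≤ K := by simpa using this
    positivity
  · rw [mul_assoc, ← mul_pow]
    have := hK x
    gcongr
    nlinarith [norm_nonneg x]

variable [InnerProductSpace ℝ E] [NormedSpace ℝ F]

theorem PolyGrowth.inner_right (u : E) : PolyGrowth (fun x : E => ⟪x, u⟫) := by
  refine ⟨by fun_prop, ‖u‖, 1, norm_nonneg _, fun x => ?_⟩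
  have := abs_real_inner_le_norm x u
  nlinarith [norm_nonneg x, norm_nonneg u]

theorem PolyGrowth.comp_affine {f : E → ℝ} (hf : PolyGrowth f) (T : F →L[ℝ] E) (a : E) :
    PolyGrowth (fun x => f (a + T x)) := by
  refine hf.comp (by fun_prop) (‖a‖ + ‖T‖) fun x => (norm_add_le _ _).trans ?_
  have := T.le_opNorm x
  nlinarith [norm_nonneg x, norm_nonneg a, norm_nonneg T]

theorem PolyGrowth.integrable [MeasurableSpace E] [BorelSpace E] [FiniteDimensional ℝ E]
    {f : E → ℝ} (hf : PolyGrowth f) (μ : Measure E) [IsGaussian μ] : Integrable f μ := by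
  obtain ⟨hfc, C, k, hC, h⟩ := hf
  have hid : MemLp (fun x : E => x) k μ := IsGaussian.memLp_id μ k (by simp)
  have hc : MemLp (fun _ : E => (1 : ℝ)) k μ := memLp_const 1
  have h1 : MemLp (fun x : E => 1 + ‖x‖) k μ := hc.add hid.norm
  refine (h1.integrable_norm_pow'.const_mul C).mono' hfc.aestronglyMeasurable
    (.of_forall fun x => ?_)
  rw [Real.norm_eq_abs, Real.norm_eq_abs, abs_of_nonneg (by positivity : (0 : ℝ) ≤ 1 + ‖x‖)]
  exact h x

end PolyGrowth

theorem hasDerivAt_gaussianPDFReal (x : ℝ) :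
    HasDerivAt (gaussianPDFReal 0 1) (-(x * gaussianPDFReal 0 1 x)) x := by
  have h : HasDerivAt (fun x : ℝ => -(x - 0) ^ 2 / (2 * ((1 : NNReal) : ℝ))) (-x) x := by
    have := ((hasDerivAt_pow 2 x).neg).div_const 2
    refine (this.congr_deriv (by simp; ring)).congr_of_eventuallyEq (.of_forall fun y => ?_)
    simp
  have h2 := (h.exp.const_mul (Real.sqrt (2 * Real.pi * ((1 : NNReal) : ℝ)))⁻¹)
  rw [gaussianPDFReal_def]
  exact h2.congr_deriv (by ring)

/-- Stein's identity for the standard normal law on the line. -/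
theorem gaussianReal_integral_id_mul {f f' : ℝ → ℝ} (hf : PolyGrowth f) (hf' : PolyGrowth f')
    (h : ∀ x, HasDerivAt f (f' x) x) :
    ∫ x, x * f x ∂gaussianReal 0 1 = ∫ x, f' x ∂gaussianReal 0 1 := by
  have key : ∀ {φ : ℝ → ℝ}, PolyGrowth φ →
      Integrable (fun x => φ x * gaussianPDFReal 0 1 x) := by
    intro φ hφ
    have h1 := hφ.integrable (gaussianReal 0 1)
    rw [gaussianReal_of_var_ne_zero 0 one_ne_zero, integrable_withDensity_iff_integrable_smul₀'
      (measurable_gaussianPDF 0 1).aemeasurable (.of_forall fun x => gaussianPDF_lt_top)] at h1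
    refine h1.congr (.of_forall fun x => ?_)
    simp [toReal_gaussianPDF, mul_comm]
  have hid : PolyGrowth (fun x : ℝ => x) := by
    simpa using PolyGrowth.inner_right (1 : ℝ)
  have := integral_mul_deriv_eq_deriv_mul_of_integrable (u := f) (u' := f')
    (v := gaussianPDFReal 0 1) (v' := fun x => -(x * gaussianPDFReal 0 1 x))
    (fun x _ => h x) (fun x _ => hasDerivAt_gaussianPDFReal x)
    (by
      refine (key (hf.mul hid)).neg.congr (.of_forall fun x => ?_)
      simp only [Pi.neg_apply, Pi.mul_apply]; ring)
    (key hf') (key hf)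
  rw [integral_gaussianReal_eq_integral_smul one_ne_zero,
    integral_gaussianReal_eq_integral_smul one_ne_zero]
  simp only [smul_eq_mul]
  rw [← neg_inj, ← integral_neg]
  calc _ = ∫ x, f x * -(x * gaussianPDFReal 0 1 x) := by
        congr 1; ext x; ring
    _ = _ := by
        rw [this]; congr 2; ext x; ring

section StdGaussian

variable {E : Type*} [NormedAddCommGroup E] [InnerProductSpace ℝ E] [FiniteDimensional ℝ E]
  [MeasurableSpace E] [BorelSpace E]

/-- The component of a standard Gaussian vector along a unit vector `u` is a standard normal
variable, independent of the component orthogonal to `u`. -/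
theorem stdGaussian_eq_map_prod {u : E} (hu : ‖u‖ = 1) :
    stdGaussian E = ((gaussianReal 0 1).prod (stdGaussian E)).map
      (fun p : ℝ × E => p.1 • u + (p.2 - ⟪p.2, u⟫ • u)) := by
  have hm : Measurable (fun p : ℝ × E => p.1 • u + (p.2 - ⟪p.2, u⟫ • u)) := by fun_prop
  have : IsProbabilityMeasure (((gaussianReal 0 1).prod (stdGaussian E)).map
      (fun p : ℝ × E => p.1 • u + (p.2 - ⟪p.2, u⟫ • u))) :=
    Measure.isProbabilityMeasure_map hm.aemeasurable
  apply Measure.ext_of_charFun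
  ext t
  rw [charFun_stdGaussian, charFun_apply, integral_map hm.aemeasurable (by fun_prop)]
  have h1 : ∀ p : ℝ × E, Complex.exp (⟪p.1 • u + (p.2 - ⟪p.2, u⟫ • u), t⟫ * Complex.I) =
      Complex.exp (⟪u, t⟫ * p.1 * Complex.I) *
        Complex.exp (⟪p.2, t - ⟪u, t⟫ • u⟫ * Complex.I) := by
    intro p
    rw [← Complex.exp_add, ← add_mul]
    congr 2
    simp only [inner_add_left, inner_sub_left, inner_sub_right, real_inner_smul_left,
      real_inner_smul_right]
    push_cast
    ring
  simp_rw [h1]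
  rw [integral_prod_mul (fun s : ℝ => Complex.exp (⟪u, t⟫ * s * Complex.I))
    (fun z : E => Complex.exp (⟪z, t - ⟪u, t⟫ • u⟫ * Complex.I)),
    ← charFun_apply_real, ← charFun_apply, charFun_gaussianReal, charFun_stdGaussian,
    ← Complex.exp_add]
  congr 1
  have h2 : ‖t - ⟪u, t⟫ • u‖ ^ 2 = ‖t‖ ^ 2 - ⟪u, t⟫ ^ 2 := by
    rw [norm_sub_sq_real, norm_smul, real_inner_smul_right, hu, real_inner_comm]
    simp only [mul_one, Real.norm_eq_abs, sq_abs]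
    ring
  have h3 : ((‖t - ⟪u, t⟫ • u‖ : ℂ)) ^ 2 = (‖t‖ : ℂ) ^ 2 - (⟪u, t⟫ : ℂ) ^ 2 := by
    exact_mod_cast h2
  rw [h3]
  simp
  ring

/-- Stein's identity for the standard Gaussian measure, in the direction `u`. -/
theorem stdGaussian_integral_inner_mul {u : E} {f f' : E → ℝ} (hf : PolyGrowth f)
    (hf' : PolyGrowth f') (h : ∀ z, HasDerivAt (fun t : ℝ => f (z + t • u)) (f' z) 0) :
    ∫ z, ⟪z, u⟫ * f z ∂stdGaussian E = ∫ z, f' z ∂stdGaussian E := by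
  wlog hu : ‖u‖ = 1 generalizing u f'
  · rcases eq_or_ne u 0 with rfl | hu0
    · have : ∀ z, f' z = 0 := fun z => (h z).unique (by simpa using hasDerivAt_const _ _)
      simp [this]
    have hn : ‖u‖ ≠ 0 := by simpa using hu0
    have := this (u := ‖u‖⁻¹ • u) (f' := fun z => ‖u‖⁻¹ * f' z) (hf'.const_mul _) (fun z => by
      have h1 : HasDerivAt (fun t : ℝ => t * ‖u‖⁻¹) ‖u‖⁻¹ 0 := by
        simpa using (hasDerivAt_id (0 : ℝ)).mul_const ‖u‖⁻¹
      have h2 := HasDerivAt.comp (0 : ℝ) (h₂ := fun t : ℝ => f (z + t • u)) (h := fun t => t * ‖u‖⁻¹)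
        (by simpa using h z) h1
      rw [mul_comm]
      simpa [Function.comp_def, smul_smul] using h2) (by
      rw [norm_smul, norm_inv, norm_norm, inv_mul_cancel₀ hn])
    simp only [real_inner_smul_right, mul_assoc] at this
    rw [integral_const_mul, integral_const_mul] at this
    exact mul_left_cancel₀ (inv_ne_zero hn) this
  set T : ℝ × E → E := fun p => p.1 • u + (p.2 - ⟪p.2, u⟫ • u) with hT
  have hTm : Measurable T := by fun_prop
  have hmap := stdGaussian_eq_map_prod hu
  have key : ∀ {φ : E → ℝ}, PolyGrowth φ → ∫ z, φ z ∂stdGaussian E =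
      ∫ w, ∫ t, φ (T (t, w)) ∂gaussianReal 0 1 ∂stdGaussian E := by
    intro φ hφ
    have hi := hφ.integrable (stdGaussian E)
    rw [hmap] at hi
    have hi' := (integrable_map_measure hi.aestronglyMeasurable hTm.aemeasurable).1 hi
    conv_lhs => rw [hmap]
    rw [integral_map hTm.aemeasurable hi.aestronglyMeasurable]
    exact integral_prod_symm _ hi'
  have hpu := PolyGrowth.inner_right u
  rw [key (hpu.mul hf), key hf']
  congr 1
  ext w
  have hin : ∀ t : ℝ, ⟪T (t, w), u⟫ = t := by
    intro t
    simp only [hT, inner_add_left, inner_sub_left, real_inner_smul_left, real_inner_self_eq_norm_sq,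
      hu]
    ring
  simp only [hin]
  have aff : ∀ {φ : E → ℝ}, PolyGrowth φ → PolyGrowth (fun t : ℝ => φ (T (t, w))) := by
    intro φ hφ
    have := hφ.comp_affine ((ContinuousLinearMap.id ℝ ℝ).smulRight u) (w - ⟪w, u⟫ • u)
    simpa [hT, add_comm] using this
  refine gaussianReal_integral_id_mul (aff hf) (aff hf') fun t => ?_
  have h1 := h (T (t, w))
  have h2 : HasDerivAt (fun x : ℝ => x - t) 1 t := by simpa using (hasDerivAt_id t).sub_const t
  have h3 := HasDerivAt.comp t (h₂ := fun x : ℝ => f (T (t, w) + x • u)) (h := fun x => x - t)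
    (by simpa using h1) h2
  rw [mul_one] at h3
  refine h3.congr_of_eventuallyEq (.of_forall fun x => ?_)
  simp only [hT, Function.comp_apply]
  congr 1
  module

end StdGaussian

/-! ### Second-order integration by parts and quadratic forms -/

section SecondOrder

variable {E : Type*} [NormedAddCommGroup E] [InnerProductSpace ℝ E] [FiniteDimensional ℝ E]
  [MeasurableSpace E] [BorelSpace E]

/-- Two integrations by parts, in the directions `u` and `v`. -/
theorem stdGaussian_integral_second {u v : E} {f f₁ f₂ : E → ℝ} (hf : PolyGrowth f)
    (hf₁ : PolyGrowth f₁) (hf₂ : PolyGrowth f₂)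
    (h₁ : ∀ z, HasDerivAt (fun t : ℝ => f (z + t • u)) (f₁ z) 0)
    (h₂ : ∀ z, HasDerivAt (fun t : ℝ => f₁ (z + t • v)) (f₂ z) 0) :
    ∫ z, f₂ z ∂stdGaussian E = ∫ z, f z * (⟪z, u⟫ * ⟪z, v⟫ - ⟪u, v⟫) ∂stdGaussian E := by
  have hu := PolyGrowth.inner_right u
  have hv := PolyGrowth.inner_right v
  have e1 := stdGaussian_integral_inner_mul hf₁ hf₂ h₂
  have e2 := stdGaussian_integral_inner_mul (u := u) (hv.mul hf)
    (f' := fun z => ⟪u, v⟫ * f z + ⟪z, v⟫ * f₁ z) ((hf.const_mul _).add (hv.mul hf₁)) (by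
      intro z
      have h3 : HasDerivAt (fun t : ℝ => ⟪z + t • u, v⟫) ⟪u, v⟫ 0 := by
        simp only [inner_add_left, real_inner_smul_left]
        simpa using ((hasDerivAt_id (0 : ℝ)).mul_const ⟪u, v⟫).const_add ⟪z, v⟫
      exact (h3.mul (h₁ z)).congr_deriv (by simp))
  rw [integral_add ((hf.const_mul _).integrable _) ((hv.mul hf₁).integrable _),
    integral_const_mul, e1] at e2
  have e3 : ∫ z, f z * (⟪z, u⟫ * ⟪z, v⟫ - ⟪u, v⟫) ∂stdGaussian E =
      ∫ z, (⟪z, u⟫ * (⟪z, v⟫ * f z) - ⟪u, v⟫ * f z) ∂stdGaussian E := by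
    congr 1; ext z; ring
  rw [e3, integral_sub ((hu.mul (hv.mul hf)).integrable _) ((hf.const_mul _).integrable _), e2,
    integral_const_mul]
  ring

theorem stdGaussian_integral_inner_mul_inner (u v : E) :
    ∫ z, ⟪z, u⟫ * ⟪z, v⟫ ∂stdGaussian E = ⟪u, v⟫ := by
  have := stdGaussian_integral_inner_mul (u := u) (PolyGrowth.inner_right v)
    (f' := fun _ => ⟪u, v⟫) (.const _) (fun z => by
        simp only [inner_add_left, real_inner_smul_left]
        simpa using ((hasDerivAt_id (0 : ℝ)).mul_const ⟪u, v⟫).const_add ⟪z, v⟫)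
  simpa using this

/-- Jensen's inequality `E |f| ≤ (E f²)^{1/2}`, in the form of an implication. -/
theorem integral_abs_le_of_integral_sq_le {Ω : Type*} [MeasurableSpace Ω] {P : Measure Ω}
    [IsProbabilityMeasure P] {f : Ω → ℝ} (hf : MemLp f 2 P) {K : ℝ} (hK : 0 ≤ K)
    (h : ∫ x, f x ^ 2 ∂P ≤ K ^ 2) : ∫ x, |f x| ∂P ≤ K := by
  have h1 : MemLp (fun x => |f x|) 2 P := hf.abs
  have h2 := variance_nonneg (fun x => |f x|) P
  rw [variance_eq_sub h1] at h2
  simp only [Pi.pow_apply, sq_abs] at h2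
  exact abs_le_of_sq_le_sq' (by linarith) hK |>.2

end SecondOrder

section Quadratic

variable {d : ℕ}

local notation "V" => EuclideanSpace ℝ (Fin d)

theorem matHSNorm_sq (A : Matrix (Fin d) (Fin d) ℝ) : matHSNorm A ^ 2 = ∑ i, ∑ j, A i j ^ 2 := by
  rw [matHSNorm_eq_sqrt, Real.sq_sqrt (by positivity)]

theorem matHSNorm_nonneg (A : Matrix (Fin d) (Fin d) ℝ) : 0 ≤ matHSNorm A := by
  rw [matHSNorm_eq_sqrt]; positivity

open scoped Matrix.Norms.Frobenius in
theorem matHSNorm_add_le (A B : Matrix (Fin d) (Fin d) ℝ) :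
    matHSNorm (A + B) ≤ matHSNorm A + matHSNorm B := norm_add_le A B

open scoped Matrix.Norms.Frobenius in
theorem matHSNorm_smul (c : ℝ) (A : Matrix (Fin d) (Fin d) ℝ) :
    matHSNorm (c • A) = |c| * matHSNorm A := norm_smul c A

theorem sum_mul_le_matHSNorm (A B : Matrix (Fin d) (Fin d) ℝ) :
    |∑ i, ∑ j, A i j * B i j| ≤ matHSNorm A * matHSNorm B := by
  refine abs_le_of_sq_le_sq ?_ (mul_nonneg (matHSNorm_nonneg A) (matHSNorm_nonneg B))
  rw [mul_pow, matHSNorm_sq, matHSNorm_sq]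
  simp only [← Finset.sum_product', Finset.univ_product_univ]
  exact Finset.sum_mul_sq_le_sq_mul_sq _ _ _

theorem inner_single_one (z : V) (i : Fin d) : ⟪z, EuclideanSpace.single i (1 : ℝ)⟫ = z i := by
  simp [EuclideanSpace.inner_single_right]

theorem inner_single_single (i j : Fin d) :
    ⟪EuclideanSpace.single i (1 : ℝ), EuclideanSpace.single j (1 : ℝ)⟫ =
      (1 : Matrix (Fin d) (Fin d) ℝ) i j := by
  simp [EuclideanSpace.inner_single_right, Matrix.one_apply, eq_comm]

/-- The quadratic form `⟨A z, z⟩ - tr A`, which is centered under the standard Gaussian measure. -/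
def centeredQuad (A : Matrix (Fin d) (Fin d) ℝ) (z : V) : ℝ :=
  ∑ i, ∑ j, A i j * (z i * z j - (1 : Matrix (Fin d) (Fin d) ℝ) i j)

theorem PolyGrowth.apply (i : Fin d) : PolyGrowth (fun z : V => z i) := by
  simpa only [inner_single_one] using
    PolyGrowth.inner_right (EuclideanSpace.single i (1 : ℝ))

theorem PolyGrowth.centeredQuad (A : Matrix (Fin d) (Fin d) ℝ) :
    PolyGrowth (fun z : V => centeredQuad A z) :=
  .sum fun i _ => .sum fun j _ =>
    (((PolyGrowth.apply i).mul (PolyGrowth.apply j)).sub (.const _)).const_mul _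

theorem integral_sum_sum {Ω ι κ : Type*} [Fintype ι] [Fintype κ] [MeasurableSpace Ω]
    {μ : Measure Ω} (g : ι → κ → Ω → ℝ) (hg : ∀ i j, Integrable (g i j) μ) :
    ∫ z, ∑ i, ∑ j, g i j z ∂μ = ∑ i, ∑ j, ∫ z, g i j z ∂μ := by
  rw [integral_finsetSum _ fun i _ => integrable_finsetSum _ fun j _ => hg i j]
  exact Finset.sum_congr rfl fun i _ => integral_finsetSum _ fun j _ => hg i j

/-- Pairing a matrix with the Hessian of `f` is, under the Gaussian integral, the same as
multiplying `f` by the corresponding centered quadratic form. -/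
theorem stdGaussian_integral_hessian (A : Matrix (Fin d) (Fin d) ℝ) {f : V → ℝ}
    {f₁ : Fin d → V → ℝ} {f₂ : Fin d → Fin d → V → ℝ} (hf : PolyGrowth f)
    (hf₁ : ∀ i, PolyGrowth (f₁ i)) (hf₂ : ∀ i j, PolyGrowth (f₂ i j))
    (h₁ : ∀ i z, HasDerivAt (fun t : ℝ => f (z + t • EuclideanSpace.single i (1 : ℝ))) (f₁ i z) 0)
    (h₂ : ∀ i j z, HasDerivAt (fun t : ℝ => f₁ i (z + t • EuclideanSpace.single j (1 : ℝ)))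
      (f₂ i j z) 0) :
    ∫ z, ∑ i, ∑ j, A i j * f₂ i j z ∂stdGaussian V =
      ∫ z, f z * centeredQuad A z ∂stdGaussian V := by
  have key : ∀ i j, ∫ z, f₂ i j z ∂stdGaussian V =
      ∫ z, f z * (z i * z j - (1 : Matrix (Fin d) (Fin d) ℝ) i j) ∂stdGaussian V := by
    intro i j
    have := stdGaussian_integral_second hf (hf₁ i) (hf₂ i j) (h₁ i) (h₂ i j)
    rw [inner_single_single] at this
    simpa only [inner_single_one] using this
  have hq : ∀ i j, PolyGrowth (fun z : V =>
      f z * (z i * z j - (1 : Matrix (Fin d) (Fin d) ℝ) i j)) := fun i j =>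
    hf.mul (((PolyGrowth.apply i).mul (PolyGrowth.apply j)).sub (.const _))
  have e : ∀ z : V, f z * centeredQuad A z = ∑ i, ∑ j, A i j *
      (f z * (z i * z j - (1 : Matrix (Fin d) (Fin d) ℝ) i j)) := by
    intro z
    simp only [centeredQuad, Finset.mul_sum]
    exact Finset.sum_congr rfl fun i _ => Finset.sum_congr rfl fun j _ => by ring
  simp_rw [e]
  rw [integral_sum_sum (fun i j z => A i j * f₂ i j z) fun i j => ((hf₂ i j).const_mul _).integrable _,
    integral_sum_sum (fun i j z => A i j * (f z * (z i * z j - (1 : Matrix (Fin d) (Fin d) ℝ) i j)))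
      fun i j => ((hq i j).const_mul _).integrable _]
  refine Finset.sum_congr rfl fun i _ => Finset.sum_congr rfl fun j _ => ?_
  rw [integral_const_mul, integral_const_mul, key]

/-- The variance of a Gaussian quadratic form: the Hessian of `centeredQuad A` is the constant matrix
`A + Aᵀ`, so the integration by parts applies with `f` the quadratic form itself. -/
theorem integral_centeredQuad_sq_le (A : Matrix (Fin d) (Fin d) ℝ) :
    ∫ z, centeredQuad A z ^ 2 ∂stdGaussian V ≤ 2 * matHSNorm A ^ 2 := by
  have hz : ∀ (z v : V) (k : Fin d), HasDerivAt (fun t : ℝ => (z + t • v) k) (v k) 0 := by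
    intro z v k
    simpa using ((hasDerivAt_id (0 : ℝ)).mul_const (v k)).const_add (z k)
  have key := stdGaussian_integral_hessian A (PolyGrowth.centeredQuad A)
    (f₁ := fun i z => ∑ k, ∑ l, A k l * (EuclideanSpace.single i (1 : ℝ) k * z l +
      z k * EuclideanSpace.single i (1 : ℝ) l))
    (f₂ := fun i j _ => ∑ k, ∑ l, A k l *
      (EuclideanSpace.single i (1 : ℝ) k * EuclideanSpace.single j (1 : ℝ) l +
      EuclideanSpace.single j (1 : ℝ) k * EuclideanSpace.single i (1 : ℝ) l))
    (fun i => .sum fun k _ => .sum fun l _ => (((PolyGrowth.apply l).const_mul _).add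
      ((PolyGrowth.apply k).mul (.const _))).const_mul _)
    (fun i j => .const _)
    (fun i z => by
      refine HasDerivAt.fun_sum fun k _ => HasDerivAt.fun_sum fun l _ => ?_
      have := (((hz z (EuclideanSpace.single i (1 : ℝ)) k).mul
        (hz z (EuclideanSpace.single i (1 : ℝ)) l)).sub_const
          ((1 : Matrix (Fin d) (Fin d) ℝ) k l)).const_mul (A k l)
      simpa using this)
    (fun i j z => by
      refine HasDerivAt.fun_sum fun k _ => HasDerivAt.fun_sum fun l _ => ?_
      have := (((hz z (EuclideanSpace.single j (1 : ℝ)) l).const_mul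
        (EuclideanSpace.single i (1 : ℝ) k)).add
        ((hz z (EuclideanSpace.single j (1 : ℝ)) k).mul_const
          (EuclideanSpace.single i (1 : ℝ) l))).const_mul (A k l)
      exact this)
  have e : ∀ i j, ∑ k, ∑ l, A k l *
      (EuclideanSpace.single i (1 : ℝ) k * EuclideanSpace.single j (1 : ℝ) l +
      EuclideanSpace.single j (1 : ℝ) k * EuclideanSpace.single i (1 : ℝ) l) = A i j + A j i := by
    intro i j
    simp [mul_add, Finset.sum_add_distrib]
  simp only [e, integral_const, probReal_univ, one_smul, ← pow_two] at key
  rw [← key, matHSNorm_sq]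
  have sw : ∑ i, ∑ j, A j i ^ 2 = ∑ i, ∑ j, A i j ^ 2 := Finset.sum_comm
  calc ∑ i, ∑ j, A i j * (A i j + A j i)
      ≤ ∑ i, ∑ j, (3 / 2 * A i j ^ 2 + 1 / 2 * A j i ^ 2) := by
        refine Finset.sum_le_sum fun i _ => Finset.sum_le_sum fun j _ => ?_
        nlinarith [sq_nonneg (A i j - A j i)]
    _ = 2 * ∑ i, ∑ j, A i j ^ 2 := by
        simp only [Finset.sum_add_distrib, ← Finset.mul_sum]
        rw [sw]; ring

theorem memLp_centeredQuad (A : Matrix (Fin d) (Fin d) ℝ) :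
    MemLp (fun z : V => centeredQuad A z) 2 (stdGaussian V) := by
  have h := PolyGrowth.centeredQuad A
  rw [memLp_two_iff_integrable_sq h.continuous.aestronglyMeasurable]
  exact (h.pow 2).integrable _

theorem integral_abs_centeredQuad_le (A : Matrix (Fin d) (Fin d) ℝ) :
    ∫ z, |centeredQuad A z| ∂stdGaussian V ≤ 2 * matHSNorm A := by
  refine integral_abs_le_of_integral_sq_le (memLp_centeredQuad A)
    (mul_nonneg two_pos.le (matHSNorm_nonneg A)) ?_
  refine (integral_centeredQuad_sq_le A).trans ?_
  nlinarith [sq_nonneg (matHSNorm A)]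

/-- The dimension-free bound on Hessians of Gaussian averages: the pairing with `A` costs only the
Hilbert-Schmidt norm of `A`. -/
theorem abs_integral_hessian_le (A : Matrix (Fin d) (Fin d) ℝ) {f : V → ℝ}
    {f₁ : Fin d → V → ℝ} {f₂ : Fin d → Fin d → V → ℝ} (hf : PolyGrowth f)
    (hf₁ : ∀ i, PolyGrowth (f₁ i)) (hf₂ : ∀ i j, PolyGrowth (f₂ i j))
    (h₁ : ∀ i z, HasDerivAt (fun t : ℝ => f (z + t • EuclideanSpace.single i (1 : ℝ))) (f₁ i z) 0)
    (h₂ : ∀ i j z, HasDerivAt (fun t : ℝ => f₁ i (z + t • EuclideanSpace.single j (1 : ℝ)))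
      (f₂ i j z) 0) (hb : ∀ z, |f z| ≤ 1) :
    |∫ z, ∑ i, ∑ j, A i j * f₂ i j z ∂stdGaussian V| ≤ 2 * matHSNorm A := by
  rw [stdGaussian_integral_hessian A hf hf₁ hf₂ h₁ h₂]
  refine abs_integral_le_integral_abs.trans ((integral_mono_of_nonneg
    (.of_forall fun z => abs_nonneg _) ((PolyGrowth.centeredQuad A).abs.integrable _)
    (.of_forall fun z => ?_)).trans (integral_abs_centeredQuad_le A))
  simp only [abs_mul]
  exact mul_le_of_le_one_left (abs_nonneg _) (hb z)

end Quadratic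

/-! ### Anti-concentration of Gaussian measures on spherical shells -/

section Shell

variable {d : ℕ}

local notation "V" => EuclideanSpace ℝ (Fin d)

theorem hasDerivAt_norm_sq_line {F : Type*} [NormedAddCommGroup F] [InnerProductSpace ℝ F]
    (y u : F) (t : ℝ) :
    HasDerivAt (fun t : ℝ => ‖y + t • u‖ ^ 2) (2 * ⟪y + t • u, u⟫) t := by
  have h1 : HasDerivAt (fun t : ℝ => y + t • u) u t := by
    simpa using ((hasDerivAt_id t).smul_const u).const_add y
  exact h1.norm_sq

theorem centeredQuad_one (z : V) : centeredQuad 1 z = ‖z‖ ^ 2 - d := by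
  rw [EuclideanSpace.real_norm_sq_eq]
  simp [centeredQuad, Matrix.one_apply, mul_sub, Finset.sum_sub_distrib, pow_two]

theorem matHSNorm_one_sq : matHSNorm (1 : Matrix (Fin d) (Fin d) ℝ) ^ 2 = d := by
  rw [matHSNorm_sq]
  simp [Matrix.one_apply]

theorem integral_norm_sq_sub_dim_sq_le :
    ∫ z : V, (‖z‖ ^ 2 - d) ^ 2 ∂stdGaussian V ≤ 2 * d := by
  have := integral_centeredQuad_sq_le (1 : Matrix (Fin d) (Fin d) ℝ)
  simpa only [centeredQuad_one, matHSNorm_one_sq] using this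

theorem integral_inner_sq_stdGaussian (a : V) :
    ∫ z : V, ⟪z, a⟫ ^ 2 ∂stdGaussian V = ‖a‖ ^ 2 := by
  simpa only [pow_two, real_inner_self_eq_norm_mul_norm] using
    stdGaussian_integral_inner_mul_inner a a

/-- Integration by parts for the radial vector field `z ↦ Φ(|z - a|²) (z - a)`. -/
theorem stdGaussian_integral_radial (a : V) {Φ Φ' : ℝ → ℝ}
    (hΦ : PolyGrowth fun z : V => Φ (‖z - a‖ ^ 2)) (hΦ' : PolyGrowth fun z : V => Φ' (‖z - a‖ ^ 2))
    (h : ∀ t, 0 ≤ t → HasDerivAt Φ (Φ' t) t) :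
    ∫ z : V, ⟪z, z - a⟫ * Φ (‖z - a‖ ^ 2) ∂stdGaussian V =
      ∫ z : V, (2 * ‖z - a‖ ^ 2 * Φ' (‖z - a‖ ^ 2) + d * Φ (‖z - a‖ ^ 2)) ∂stdGaussian V := by
  have hc : ∀ i, PolyGrowth fun z : V => z i - a i := fun i =>
    (PolyGrowth.apply i).sub (.const _)
  have h1 : ∀ i : Fin d, ∫ z : V, z i * ((z i - a i) * Φ (‖z - a‖ ^ 2)) ∂stdGaussian V =
      ∫ z : V, (Φ (‖z - a‖ ^ 2) + (z i - a i) * (Φ' (‖z - a‖ ^ 2) * (2 * (z i - a i))))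
        ∂stdGaussian V := by
    intro i
    have := stdGaussian_integral_inner_mul (u := EuclideanSpace.single i (1 : ℝ))
      ((hc i).mul hΦ)
      (f' := fun z => Φ (‖z - a‖ ^ 2) + (z i - a i) * (Φ' (‖z - a‖ ^ 2) * (2 * (z i - a i))))
      (hΦ.add ((hc i).mul (hΦ'.mul ((hc i).const_mul 2)))) (fun z => by
        have h2 : HasDerivAt (fun t : ℝ => (z + t • EuclideanSpace.single i (1 : ℝ)) i - a i) 1 0 := by
          simpa using ((hasDerivAt_id (0 : ℝ)).const_add (z i)).sub_const (a i)
        have h3 := hasDerivAt_norm_sq_line (z - a) (EuclideanSpace.single i (1 : ℝ)) 0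
        have h4 := HasDerivAt.comp (0 : ℝ) (h₂ := Φ)
          (h := fun t : ℝ => ‖z + t • EuclideanSpace.single i (1 : ℝ) - a‖ ^ 2)
          (h' := 2 * (z i - a i)) (by simpa using h (‖z - a‖ ^ 2) (by positivity)) (by
          have e : ∀ t : ℝ, z + t • EuclideanSpace.single i (1 : ℝ) - a =
            z - a + t • EuclideanSpace.single i (1 : ℝ) := fun t => by abel
          simp only [e]
          exact h3.congr_deriv (by rw [inner_single_one]; simp))
        exact (h2.mul h4).congr_deriv (by simp))
    simpa only [inner_single_one] using this
  have e1 : ∀ z : V, ⟪z, z - a⟫ * Φ (‖z - a‖ ^ 2) =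
      ∑ i, z i * ((z i - a i) * Φ (‖z - a‖ ^ 2)) := by
    intro z
    simp only [PiLp.inner_apply, Finset.sum_mul]
    refine Finset.sum_congr rfl fun i _ => ?_
    simp only [PiLp.sub_apply, RCLike.inner_apply, conj_trivial]
    ring
  have e2 : ∀ z : V, 2 * ‖z - a‖ ^ 2 * Φ' (‖z - a‖ ^ 2) + d * Φ (‖z - a‖ ^ 2) =
      ∑ i, (Φ (‖z - a‖ ^ 2) + (z i - a i) * (Φ' (‖z - a‖ ^ 2) * (2 * (z i - a i)))) := by
    intro z
    have : ‖z - a‖ ^ 2 = ∑ i, (z i - a i) ^ 2 := by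
      rw [EuclideanSpace.real_norm_sq_eq]; simp
    rw [Finset.sum_add_distrib]
    have h3 : ∑ i, (z i - a i) * (Φ' (‖z - a‖ ^ 2) * (2 * (z i - a i))) =
        2 * Φ' (‖z - a‖ ^ 2) * ∑ i, (z i - a i) ^ 2 := by
      rw [Finset.mul_sum]
      exact Finset.sum_congr rfl fun i _ => by ring
    rw [h3, ← this]
    simp only [Finset.sum_const, Finset.card_univ, Fintype.card_fin, nsmul_eq_mul]
    ring
  simp_rw [e1, e2]
  rw [integral_finsetSum _ fun i _ => ((PolyGrowth.apply i).mul ((hc i).mul hΦ)).integrable _,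
    integral_finsetSum _ fun i _ =>
      (hΦ.add ((hc i).mul (hΦ'.mul ((hc i).const_mul 2)))).integrable _]
  exact Finset.sum_congr rfl fun i _ => h1 i

/-- The pointwise estimate behind the shell bound. With `y = z - a`, `m² = d + |a|²`,
`N = ⟪z, y⟫ - (d - 1)` and `U = |y|² - m²`, the positive part of `N / |y|` is controlled by
quantities of bounded expectation. For `|y| ≥ m / 2` this is clear; for `|y| < m / 2` one has
`|U| ≥ 3 m² / 4`, and if moreover `|y| < 1` then `N ≤ |y| (|y| + |a|)`, because `d ≥ 1`. -/
theorem radial_pointwise_bound (hd : 0 < d) (a z : V) {r m : ℝ} (hm : 0 < m)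
    (hm2 : m ^ 2 = d + ‖a‖ ^ 2) (hr : 0 < r) (hyr : ‖z - a‖ ≤ r) :
    (⟪z, z - a⟫ - (d - 1)) * r⁻¹ ≤ 1 + 2 * (⟪z, z - a⟫ - (d - 1)) ^ 2 / m ^ 2 +
      5 * (‖z - a‖ ^ 2 - m ^ 2) ^ 2 / m ^ 2 := by
  set N := ⟪z, z - a⟫ - ((d : ℝ) - 1) with hN
  set y := ‖z - a‖ with hy
  set U := y ^ 2 - m ^ 2 with hU
  have hd1 : (1 : ℝ) ≤ d := by exact_mod_cast hd
  have hy0 : 0 ≤ y := norm_nonneg _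
  have hm1 : 1 ≤ m := by nlinarith [sq_nonneg ‖a‖]
  have ham : ‖a‖ ≤ m := abs_le_of_sq_le_sq' (by linarith) hm.le |>.2
  have hNle : N ≤ y * (y + ‖a‖) := by
    have h1 : ⟪z, z - a⟫ = y ^ 2 + ⟪a, z - a⟫ := by
      rw [hy, ← real_inner_self_eq_norm_sq, ← inner_add_left]
      simp
    have h2 := real_inner_le_norm a (z - a)
    rw [hN, h1]
    nlinarith
  have hm2p : 0 < m ^ 2 := by positivity
  have hU0 : 0 ≤ 5 * U ^ 2 / m ^ 2 := by positivity
  have hN0 : 0 ≤ 2 * N ^ 2 / m ^ 2 := by positivity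
  rcases le_or_gt N 0 with hneg | hpos
  · have : N * r⁻¹ ≤ 0 := mul_nonpos_of_nonpos_of_nonneg hneg (by positivity)
    linarith
  rcases le_or_gt (m / 2) y with hbig | hsmall
  · have h1 : N * r⁻¹ ≤ 2 * (N / m) := by
      rw [← div_eq_mul_inv, div_le_iff₀ hr]
      have : N = 2 * (N / m) * (m / 2) := by field_simp
      calc N = 2 * (N / m) * (m / 2) := this
        _ ≤ 2 * (N / m) * r := by gcongr; linarith
    have h2 : 2 * (N / m) ≤ 1 + N ^ 2 / m ^ 2 := by
      rw [← div_pow]; nlinarith [sq_nonneg (N / m - 1)]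
    have h3 : 2 * N ^ 2 / m ^ 2 = N ^ 2 / m ^ 2 + N ^ 2 / m ^ 2 := by ring
    have : 0 ≤ N ^ 2 / m ^ 2 := by positivity
    linarith
  · have hUle : U ≤ -(3 / 4 * m ^ 2) := by
      rw [hU]; nlinarith
    have hU2 : (9 / 16) * m ^ 4 ≤ U ^ 2 := by nlinarith
    rcases le_or_gt 1 y with h1 | h1
    · have h2 : N * r⁻¹ ≤ N := mul_le_of_le_one_right hpos.le (inv_le_one_of_one_le₀ (h1.trans hyr))
      have h3 : N ≤ (2 * N ^ 2 + 5 * U ^ 2) / m ^ 2 := by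
        rw [le_div_iff₀ hm2p]
        nlinarith [sq_nonneg (N + U)]
      have h4 : (2 * N ^ 2 + 5 * U ^ 2) / m ^ 2 = 2 * N ^ 2 / m ^ 2 + 5 * U ^ 2 / m ^ 2 := by ring
      linarith
    · have h2 : N * r⁻¹ ≤ y + ‖a‖ := by
        rw [← div_eq_mul_inv, div_le_iff₀ hr]
        nlinarith [norm_nonneg a]
      have h3 : m ≤ 5 * U ^ 2 / m ^ 2 := by
        rw [le_div_iff₀ hm2p]
        nlinarith [pow_le_pow_right₀ hm1 (show 3 ≤ 4 by norm_num)]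
      linarith

theorem polyGrowth_inner_self_sub (a : V) : PolyGrowth fun z : V => ⟪z, z - a⟫ := by
  have : PolyGrowth fun z : V => ‖z - 0‖ ^ 2 - ⟪z, a⟫ :=
    (PolyGrowth.norm_sq_sub 0).sub (PolyGrowth.inner_right a)
  simpa [inner_sub_right] using this

theorem polyGrowth_norm_sq_sub_dim : PolyGrowth fun z : V => ‖z‖ ^ 2 - d := by
  simpa using (PolyGrowth.norm_sq_sub (0 : V)).sub (.const (E := V) (d : ℝ))

theorem integral_dist_sq_sub_sq_le (a : V) {m : ℝ} (hm2 : m ^ 2 = d + ‖a‖ ^ 2) :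
    ∫ z : V, (‖z - a‖ ^ 2 - m ^ 2) ^ 2 ∂stdGaussian V ≤ 8 * m ^ 2 := by
  have gq := polyGrowth_norm_sq_sub_dim (d := d)
  have gia := PolyGrowth.inner_right a
  have gU := (PolyGrowth.norm_sq_sub a).sub (.const (E := V) (m ^ 2))
  have iq := integral_norm_sq_sub_dim_sq_le (d := d)
  have iia := integral_inner_sq_stdGaussian a
  calc ∫ z : V, (‖z - a‖ ^ 2 - m ^ 2) ^ 2 ∂stdGaussian V
      ≤ ∫ z : V, (2 * (‖z‖ ^ 2 - d) ^ 2 + 8 * ⟪z, a⟫ ^ 2) ∂stdGaussian V := by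
        refine integral_mono ((gU.pow 2).integrable _)
          ((((gq.pow 2).const_mul 2).add ((gia.pow 2).const_mul 8)).integrable _) fun z => ?_
        simp only []
        rw [norm_sub_sq_real, hm2]
        nlinarith [sq_nonneg (‖z‖ ^ 2 - d + 2 * ⟪z, a⟫)]
    _ ≤ 8 * m ^ 2 := by
        rw [integral_add (((gq.pow 2).const_mul 2).integrable _)
          (((gia.pow 2).const_mul 8).integrable _), integral_const_mul, integral_const_mul, iia,
          hm2]
        linarith

theorem integral_inner_self_sub_sq_le (hd : 0 < d) (a : V) {m : ℝ} (hm2 : m ^ 2 = d + ‖a‖ ^ 2) :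
    ∫ z : V, (⟪z, z - a⟫ - ((d : ℝ) - 1)) ^ 2 ∂stdGaussian V ≤ 9 * m ^ 2 := by
  have hd1 : (1 : ℝ) ≤ d := by exact_mod_cast hd
  have gq := polyGrowth_norm_sq_sub_dim (d := d)
  have gia := PolyGrowth.inner_right a
  have gN := (polyGrowth_inner_self_sub a).sub (.const (E := V) ((d : ℝ) - 1))
  have iq := integral_norm_sq_sub_dim_sq_le (d := d)
  have iia := integral_inner_sq_stdGaussian a
  calc ∫ z : V, (⟪z, z - a⟫ - ((d : ℝ) - 1)) ^ 2 ∂stdGaussian V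
      ≤ ∫ z : V, (3 * (‖z‖ ^ 2 - d) ^ 2 + 3 * ⟪z, a⟫ ^ 2 + 3) ∂stdGaussian V := by
        refine integral_mono ((gN.pow 2).integrable _)
          (((((gq.pow 2).const_mul 3).add ((gia.pow 2).const_mul 3)).add (.const 3)).integrable _)
          fun z => ?_
        simp only [inner_sub_right, real_inner_self_eq_norm_sq]
        nlinarith [sq_nonneg (‖z‖ ^ 2 - d + ⟪z, a⟫), sq_nonneg (‖z‖ ^ 2 - d - 1),
          sq_nonneg (⟪z, a⟫ + 1)]
    _ ≤ 9 * m ^ 2 := by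
        rw [integral_add ((((gq.pow 2).const_mul 3).add ((gia.pow 2).const_mul 3)).integrable _)
          (integrable_const _), integral_add (((gq.pow 2).const_mul 3).integrable _)
          (((gia.pow 2).const_mul 3).integrable _), integral_const_mul, integral_const_mul, iia,
          hm2]
        simp only [integral_const, probReal_univ, one_smul]
        linarith [sq_nonneg ‖a‖]

/-- For every smooth increasing step `S` with values in `[0, 1]`, the Gaussian average of
`S'(|z - a|²)`, with the weight that turns it into a radial derivative, is bounded by an absolute
constant. -/
theorem stdGaussian_integral_step_le (hd : 0 < d) (a : V) {ρ K : ℝ} (hρ : 0 < ρ) {S S' : ℝ → ℝ}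
    (hS01 : ∀ t, 0 ≤ S t ∧ S t ≤ 1) (hS'0 : ∀ t, 0 ≤ S' t) (hS'le : ∀ t, S' t ≤ K)
    (hS'c : Continuous S') (hSd : ∀ t, HasDerivAt S (S' t) t) :
    PolyGrowth (fun z : V => 2 * ‖z - a‖ ^ 2 *
      (S' (‖z - a‖ ^ 2) * (Real.sqrt (‖z - a‖ ^ 2 + ρ ^ 2))⁻¹)) ∧
    ∫ z : V, 2 * ‖z - a‖ ^ 2 *
      (S' (‖z - a‖ ^ 2) * (Real.sqrt (‖z - a‖ ^ 2 + ρ ^ 2))⁻¹) ∂stdGaussian V ≤ 59 := by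
  set R : ℝ → ℝ := fun t => (Real.sqrt (t + ρ ^ 2))⁻¹ with hR
  have hRd : ∀ t, 0 ≤ t → HasDerivAt R (-(R t ^ 3 / 2)) t := by
    intro t ht
    have hp : 0 < t + ρ ^ 2 := by positivity
    have h1 : HasDerivAt (fun t => t + ρ ^ 2) 1 t := (hasDerivAt_id t).add_const _
    have h2 := (h1.sqrt hp.ne').inv (Real.sqrt_pos.2 hp).ne'
    refine h2.congr_deriv ?_
    simp only [hR]
    have := (Real.sqrt_pos.2 hp).ne'
    field_simp
  have hsq0 : ∀ z : V, 0 < Real.sqrt (‖z - a‖ ^ 2 + ρ ^ 2) := fun z =>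
    Real.sqrt_pos.2 (by positivity)
  have gR : PolyGrowth fun z : V => R (‖z - a‖ ^ 2) := by
    refine .of_bound (Continuous.inv₀ (by fun_prop) fun z => (hsq0 z).ne') ρ⁻¹ fun z => ?_
    rw [abs_of_pos (inv_pos.2 (hsq0 z))]
    refine inv_anti₀ hρ ?_
    exact Real.le_sqrt_of_sq_le (by nlinarith [sq_nonneg ‖z - a‖])
  have gS : PolyGrowth fun z : V => S (‖z - a‖ ^ 2) := by
    have hSc : Continuous S := continuous_iff_continuousAt.2 fun t => (hSd t).continuousAt
    refine .of_bound (hSc.comp (by fun_prop)) 1 fun z => ?_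
    rw [abs_of_nonneg (hS01 _).1]
    exact (hS01 _).2
  have gS' : PolyGrowth fun z : V => S' (‖z - a‖ ^ 2) := by
    refine .of_bound (hS'c.comp (by fun_prop)) K fun z => ?_
    rw [abs_of_nonneg (hS'0 _)]
    exact hS'le _
  have gin := polyGrowth_inner_self_sub a
  have gn := PolyGrowth.norm_sq_sub a
  have gΦ := gS.mul gR
  have gΦ' := (gS'.mul gR).sub (gS.mul ((gR.pow 3).const_mul (1 / 2)))
  have ibp := stdGaussian_integral_radial a (Φ := fun t => S t * R t)
    (Φ' := fun t => S' t * R t - S t * (1 / 2 * R t ^ 3)) gΦ gΦ' (fun t ht =>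
      ((hSd t).mul (hRd t ht)).congr_deriv (by ring))
  set m := Real.sqrt (d + ‖a‖ ^ 2) with hmdef
  have hd1 : (1 : ℝ) ≤ d := by exact_mod_cast hd
  have hm2 : m ^ 2 = d + ‖a‖ ^ 2 := Real.sq_sqrt (by positivity)
  have hm : 0 < m := Real.sqrt_pos.2 (by positivity)
  have hm2p : 0 < m ^ 2 := by positivity
  have gN := gin.sub (.const (E := V) ((d : ℝ) - 1))
  have gU := gn.sub (.const (E := V) (m ^ 2))
  have hUint := integral_dist_sq_sub_sq_le a hm2
  have hNint := integral_inner_self_sub_sq_le hd a hm2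
  have gG : PolyGrowth fun z : V => 2 * ‖z - a‖ ^ 2 * (S' (‖z - a‖ ^ 2) * R (‖z - a‖ ^ 2)) :=
    (gn.const_mul 2).mul (gS'.mul gR)
  refine ⟨gG, ?_⟩
  have h1 : ∫ z : V, 2 * ‖z - a‖ ^ 2 * (S' (‖z - a‖ ^ 2) * R (‖z - a‖ ^ 2)) ∂stdGaussian V =
      ∫ z : V, (2 * ‖z - a‖ ^ 2 * (S' (‖z - a‖ ^ 2) * R (‖z - a‖ ^ 2)) +
        (⟪z, z - a⟫ * (S (‖z - a‖ ^ 2) * R (‖z - a‖ ^ 2)) -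
        (2 * ‖z - a‖ ^ 2 * (S' (‖z - a‖ ^ 2) * R (‖z - a‖ ^ 2) -
          S (‖z - a‖ ^ 2) * (1 / 2 * R (‖z - a‖ ^ 2) ^ 3)) +
          d * (S (‖z - a‖ ^ 2) * R (‖z - a‖ ^ 2))))) ∂stdGaussian V := by
    rw [integral_add (gG.integrable _) (((gin.mul gΦ).sub
      (((gn.const_mul 2).mul gΦ').add (gΦ.const_mul d))).integrable _),
      integral_sub ((gin.mul gΦ).integrable _)
        ((((gn.const_mul 2).mul gΦ').add (gΦ.const_mul d)).integrable _), ibp]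
    ring
  rw [h1]
  calc _ ≤ ∫ z : V, (1 + 2 / m ^ 2 * (⟪z, z - a⟫ - ((d : ℝ) - 1)) ^ 2 +
        5 / m ^ 2 * (‖z - a‖ ^ 2 - m ^ 2) ^ 2) ∂stdGaussian V := by
        refine integral_mono ((gG.add ((gin.mul gΦ).sub
          (((gn.const_mul 2).mul gΦ').add (gΦ.const_mul d)))).integrable _)
          ((((PolyGrowth.const 1).add ((gN.pow 2).const_mul _)).add
            ((gU.pow 2).const_mul _)).integrable _) fun z => ?_
        have hr := hsq0 z
        set r := Real.sqrt (‖z - a‖ ^ 2 + ρ ^ 2) with hrdef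
        have hr2 : r ^ 2 = ‖z - a‖ ^ 2 + ρ ^ 2 := Real.sq_sqrt (by positivity)
        have hRz : R (‖z - a‖ ^ 2) = r⁻¹ := rfl
        have hyr : ‖z - a‖ ≤ r := Real.le_sqrt_of_sq_le (by nlinarith)
        have key := radial_pointwise_bound hd a z hm hm2 hr hyr
        have hs := hS01 (‖z - a‖ ^ 2)
        simp only [hRz]
        have hfrac : ‖z - a‖ ^ 2 * r⁻¹ ^ 2 ≤ 1 := by
          rw [inv_pow, ← div_eq_mul_inv, div_le_one (by positivity), hr2]
          nlinarith
        set s := S (‖z - a‖ ^ 2)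
        set B := 1 + 2 * (⟪z, z - a⟫ - ((d : ℝ) - 1)) ^ 2 / m ^ 2 +
          5 * (‖z - a‖ ^ 2 - m ^ 2) ^ 2 / m ^ 2 with hB
        have hB0 : 0 ≤ B := by positivity
        have hri : 0 < r⁻¹ := inv_pos.2 hr
        have e : 2 * ‖z - a‖ ^ 2 * (S' (‖z - a‖ ^ 2) * r⁻¹) + (⟪z, z - a⟫ * (s * r⁻¹) -
            (2 * ‖z - a‖ ^ 2 * (S' (‖z - a‖ ^ 2) * r⁻¹ - s * (1 / 2 * r⁻¹ ^ 3)) +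
              d * (s * r⁻¹))) =
            s * ((⟪z, z - a⟫ - ((d : ℝ) - 1)) * r⁻¹ - r⁻¹ * (1 - ‖z - a‖ ^ 2 * r⁻¹ ^ 2)) := by
          ring
        rw [e]
        have h2 : (⟪z, z - a⟫ - ((d : ℝ) - 1)) * r⁻¹ - r⁻¹ * (1 - ‖z - a‖ ^ 2 * r⁻¹ ^ 2) ≤ B := by
          have := mul_nonneg hri.le (sub_nonneg.2 hfrac)
          linarith
        calc _ ≤ s * B := mul_le_mul_of_nonneg_left h2 hs.1
          _ ≤ B := mul_le_of_le_one_left hB0 hs.2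
          _ = _ := by rw [hB]; ring
    _ ≤ 59 := by
        rw [integral_add (((PolyGrowth.const 1).add ((gN.pow 2).const_mul _)).integrable _)
          (((gU.pow 2).const_mul _).integrable _), integral_add (integrable_const _)
          (((gN.pow 2).const_mul _).integrable _), integral_const_mul, integral_const_mul]
        simp only [integral_const, probReal_univ, one_smul]
        have h2 : 2 / m ^ 2 * ∫ z : V, (⟪z, z - a⟫ - ((d : ℝ) - 1)) ^ 2 ∂stdGaussian V ≤ 18 := by
          calc _ ≤ 2 / m ^ 2 * (9 * m ^ 2) := by gcongr
            _ = 18 := by field_simp; norm_num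
        have h3 : 5 / m ^ 2 * ∫ z : V, (‖z - a‖ ^ 2 - m ^ 2) ^ 2 ∂stdGaussian V ≤ 40 := by
          calc _ ≤ 5 / m ^ 2 * (8 * m ^ 2) := by gcongr
            _ = 40 := by field_simp; norm_num
        linarith

/-- The law of `|Z - a|`, with `Z` standard Gaussian, has a density that is bounded by an absolute
constant, in the form of a bound on shells that are not thicker than their inner radius. -/
theorem stdGaussian_shell_le (hd : 0 < d) (a : V) {ρ ε : ℝ} (hε : 0 < ε) (hερ : ε ≤ ρ) :
    (stdGaussian V).real {z | ρ < ‖z - a‖ ∧ ‖z - a‖ ≤ ρ + ε} ≤ 1416 * ε := by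
  have hρ : 0 < ρ := hε.trans_le hερ
  set ℓ : ℝ := 3 * ρ * ε with hℓ
  have hℓ0 : 0 < ℓ := by positivity
  have hπ := Real.pi_pos
  set S : ℝ → ℝ := fun t => 1 / 2 + Real.arctan ((t - ρ ^ 2) / ℓ) / Real.pi with hS
  set S' : ℝ → ℝ := fun t => 1 / (1 + ((t - ρ ^ 2) / ℓ) ^ 2) * (1 / ℓ) / Real.pi with hS'
  have hS01 : ∀ t, 0 ≤ S t ∧ S t ≤ 1 := by
    intro t
    have h1 := Real.neg_pi_div_two_lt_arctan ((t - ρ ^ 2) / ℓ)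
    have h2 := Real.arctan_lt_pi_div_two ((t - ρ ^ 2) / ℓ)
    have h3 : -(1 / 2) ≤ Real.arctan ((t - ρ ^ 2) / ℓ) / Real.pi := by
      rw [le_div_iff₀ hπ]; linarith
    have h4 : Real.arctan ((t - ρ ^ 2) / ℓ) / Real.pi ≤ 1 / 2 := by
      rw [div_le_iff₀ hπ]; linarith
    constructor <;> simp only [hS] <;> linarith
  have hS'0 : ∀ t, 0 ≤ S' t := fun t => by simp only [hS']; positivity
  have hS'le : ∀ t, S' t ≤ 1 / ℓ / Real.pi := by
    intro t
    simp only [hS']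
    gcongr
    refine mul_le_of_le_one_left (by positivity) ?_
    rw [div_le_one (by positivity)]
    nlinarith [sq_nonneg ((t - ρ ^ 2) / ℓ)]
  have hSd : ∀ t, HasDerivAt S (S' t) t := by
    intro t
    have h1 : HasDerivAt (fun t => (t - ρ ^ 2) / ℓ) (1 / ℓ) t :=
      ((hasDerivAt_id t).sub_const _).div_const _
    exact (h1.arctan.div_const _).const_add _
  have hS'c : Continuous S' := by
    simp only [hS']
    refine ((continuous_const.div (by fun_prop) fun t => ?_).mul continuous_const).div_const _
    positivity
  obtain ⟨gG, hG⟩ := stdGaussian_integral_step_le hd a hρ hS01 hS'0 hS'le hS'c hSd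
  -- on the shell the localized term is at least `1 / (24 ε)`
  have hA : MeasurableSet {z : V | ρ < ‖z - a‖ ∧ ‖z - a‖ ≤ ρ + ε} :=
    by measurability
  have hlow : ∫ z : V, {z : V | ρ < ‖z - a‖ ∧ ‖z - a‖ ≤ ρ + ε}.indicator
      (fun _ => 1 / (24 * ε)) z ∂stdGaussian V ≤ 59 := by
    refine (integral_mono ((integrable_const _).indicator hA) (gG.integrable _) fun z => ?_).trans hG
    refine Set.indicator_apply_le' (fun hz => ?_) (fun _ => ?_)
    · have ht1 : ρ ^ 2 ≤ ‖z - a‖ ^ 2 := by nlinarith [hz.1]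
      have ht2 : ‖z - a‖ ^ 2 - ρ ^ 2 ≤ ℓ := by
        have := hz.2
        have := hz.1
        rw [hℓ]; nlinarith
      set t := ‖z - a‖ ^ 2
      have hq : ((t - ρ ^ 2) / ℓ) ^ 2 ≤ 1 := by
        have h0 : 0 ≤ (t - ρ ^ 2) / ℓ := div_nonneg (by linarith) hℓ0.le
        have h1 : (t - ρ ^ 2) / ℓ ≤ 1 := (div_le_one hℓ0).2 ht2
        exact pow_le_one₀ h0 h1
      have hS'low : 1 / (2 * ℓ * Real.pi) ≤ S' t := by
        simp only [hS']
        rw [show 1 / (2 * ℓ * Real.pi) = 1 / 2 * (1 / ℓ) / Real.pi by field_simp]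
        gcongr
        linarith
      have hRlow : ρ ≤ 2 * t * (Real.sqrt (t + ρ ^ 2))⁻¹ := by
        have hp : 0 < Real.sqrt (t + ρ ^ 2) := Real.sqrt_pos.2 (by positivity)
        rw [← div_eq_mul_inv, le_div_iff₀ hp]
        have h3 : Real.sqrt (t + ρ ^ 2) ^ 2 = t + ρ ^ 2 := Real.sq_sqrt (by positivity)
        have ht0 : 0 < t := lt_of_lt_of_le (by positivity) ht1
        refine abs_le_of_sq_le_sq' ?_ (by positivity) |>.2
        rw [mul_pow, h3]
        nlinarith [mul_nonneg (sub_nonneg.2 ht1) ht0.le, sq_nonneg ρ]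
      calc 1 / (24 * ε) ≤ 1 / (2 * ℓ * Real.pi) * ρ := by
            rw [hℓ, div_mul_eq_mul_div, div_le_div_iff₀ (by positivity) (by positivity)]
            nlinarith [Real.pi_lt_four, mul_pos hρ hε]
        _ ≤ S' t * (2 * t * (Real.sqrt (t + ρ ^ 2))⁻¹) := by
            gcongr
        _ = _ := by ring
    · exact mul_nonneg (by positivity) (mul_nonneg (hS'0 _) (by positivity))
  rw [integral_indicator_const _ hA, smul_eq_mul, mul_one_div, div_le_iff₀ (by positivity)] at hlow
  linarith

end Shell

/-! ### Gaussian measures with covariance at least the identity -/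

section Covariance

variable {d : ℕ}

local notation "V" => EuclideanSpace ℝ (Fin d)

theorem gaussianReal_real_abs_sub_le (b : ℝ) {r : ℝ} (hr : 0 ≤ r) :
    (gaussianReal 0 1).real {x | |x - b| ≤ r} ≤ 2 * r := by
  have hset : {x : ℝ | |x - b| ≤ r} = Set.Icc (b - r) (b + r) := by
    ext x
    simp only [Set.mem_ofPred_eq, Set.mem_Icc, abs_le]
    constructor <;> rintro ⟨h1, h2⟩ <;> constructor <;> linarith
  rw [hset, measureReal_def, gaussianReal_apply 0 one_ne_zero]
  have hle : ∀ x, gaussianPDF 0 1 x ≤ 1 := by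
    intro x
    rw [gaussianPDF_def, ENNReal.ofReal_le_one, gaussianPDFReal_def]
    refine mul_le_one₀ (inv_le_one_of_one_le₀ ?_) (Real.exp_pos _).le (Real.exp_le_one_iff.2 ?_)
    · rw [Real.one_le_sqrt]
      simp only [NNReal.coe_one, mul_one]
      linarith [Real.pi_gt_three]
    · simp only [NNReal.coe_one, mul_one, sub_zero]
      have := sq_nonneg x
      linarith
  have h1 : ∫⁻ x in Set.Icc (b - r) (b + r), gaussianPDF 0 1 x ≤ ENNReal.ofReal (2 * r) := by
    calc ∫⁻ x in Set.Icc (b - r) (b + r), gaussianPDF 0 1 x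
        ≤ ∫⁻ x in Set.Icc (b - r) (b + r), 1 := lintegral_mono fun x => hle x
      _ = ENNReal.ofReal (2 * r) := by
        simp only [lintegral_const, one_mul, MeasurableSet.univ, Measure.restrict_apply,
          Set.univ_inter, Real.volume_Icc]
        congr 1; ring
  exact ENNReal.toReal_le_of_le_ofReal (by positivity) h1

/-- On `|z - a|² ≤ d η²` at least three quarters of the coordinates of `z - a` are at most `2η`,
so Markov's inequality reduces the small-ball bound to dimension one. -/
theorem stdGaussian_smallBall_le (hd : 0 < d) (a : V) {η : ℝ} (hη : 0 < η) :
    (stdGaussian V).real {z | ‖z - a‖ ≤ η * Real.sqrt d} ≤ 6 * η := by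
  have hd1 : (0 : ℝ) < d := by exact_mod_cast hd
  have hA : MeasurableSet {z : V | ‖z - a‖ ≤ η * Real.sqrt d} := by measurability
  have hAi : ∀ i, MeasurableSet {z : V | |z i - a i| ≤ 2 * η} := fun i => by measurability
  have hP : ∀ i, (stdGaussian V).real {z : V | |z i - a i| ≤ 2 * η} ≤ 4 * η := by
    intro i
    have mp := measurePreserving_eval_multivariateGaussian (μ := (0 : V))
      (S := (1 : Matrix (Fin d) (Fin d) ℝ)) Matrix.PosSemidef.one (i := i)
    rw [multivariateGaussian_zero_one] at mp
    have h1 := gaussianReal_real_abs_sub_le (a i) (r := 2 * η) (by positivity)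
    have h2 : (stdGaussian V).real {z : V | |z i - a i| ≤ 2 * η} =
        (gaussianReal 0 1).real {x | |x - a i| ≤ 2 * η} := by
      have h3 := mp.measureReal_preimage (s := {x : ℝ | |x - a i| ≤ 2 * η})
        (by measurability : MeasurableSet _).nullMeasurableSet
      simpa using h3
    rw [h2]; linarith
  have h1 : (stdGaussian V).real {z | ‖z - a‖ ≤ η * Real.sqrt d} * (3 / 4 * d) ≤
      ∑ i : Fin d, (stdGaussian V).real {z : V | |z i - a i| ≤ 2 * η} := by
    have e1 : (stdGaussian V).real {z | ‖z - a‖ ≤ η * Real.sqrt d} * (3 / 4 * d) =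
        ∫ z : V, {z : V | ‖z - a‖ ≤ η * Real.sqrt d}.indicator (fun _ => (3 / 4 * d : ℝ)) z
          ∂stdGaussian V := by
      rw [integral_indicator_const _ hA, smul_eq_mul]
    have e2 : ∑ i : Fin d, (stdGaussian V).real {z : V | |z i - a i| ≤ 2 * η} =
        ∫ z : V, ∑ i, {z : V | |z i - a i| ≤ 2 * η}.indicator (fun _ => (1 : ℝ)) z
          ∂stdGaussian V := by
      rw [integral_finsetSum _ fun i _ => (integrable_const _).indicator (hAi i)]
      refine Finset.sum_congr rfl fun i _ => ?_
      rw [integral_indicator_const _ (hAi i), smul_eq_mul, mul_one]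
    rw [e1, e2]
    refine integral_mono ((integrable_const _).indicator hA) (integrable_finsetSum _ fun i _ =>
      (integrable_const _).indicator (hAi i)) fun z => ?_
    refine Set.indicator_apply_le' (fun hz => ?_) (fun _ => ?_)
    · have hz2 : ∑ i, (z i - a i) ^ 2 ≤ η ^ 2 * d := by
        have : ‖z - a‖ ^ 2 = ∑ i, (z i - a i) ^ 2 := by
          rw [EuclideanSpace.real_norm_sq_eq]; simp
        rw [← this]
        calc ‖z - a‖ ^ 2 ≤ (η * Real.sqrt d) ^ 2 := pow_le_pow_left₀ (norm_nonneg _) hz 2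
          _ = η ^ 2 * d := by rw [mul_pow, Real.sq_sqrt hd1.le]
      have hi : ∀ i, 1 - (z i - a i) ^ 2 / (4 * η ^ 2) ≤
          {z : V | |z i - a i| ≤ 2 * η}.indicator (fun _ => (1 : ℝ)) z := by
        intro i
        refine Set.le_indicator_apply (fun _ => ?_) (fun hn => ?_)
        · have : 0 ≤ (z i - a i) ^ 2 / (4 * η ^ 2) := by positivity
          linarith
        · have hn' : 2 * η < |z i - a i| := not_le.1 hn
          rw [sub_nonpos, one_le_div (by positivity), ← sq_abs (z i - a i)]
          nlinarith
      have hs := Finset.sum_le_sum fun i (_ : i ∈ Finset.univ) => hi i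
      refine le_trans ?_ hs
      rw [Finset.sum_sub_distrib, ← Finset.sum_div]
      simp only [Finset.sum_const, Finset.card_univ, Fintype.card_fin, nsmul_eq_mul, mul_one]
      have : (∑ i, (z i - a i) ^ 2) / (4 * η ^ 2) ≤ d / 4 := by
        rw [div_le_iff₀ (by positivity)]; linarith
      linarith
    · exact Finset.sum_nonneg fun i _ => Set.indicator_nonneg (fun _ _ => zero_le_one) _
  have h2 : ∑ i : Fin d, (stdGaussian V).real {z : V | |z i - a i| ≤ 2 * η} ≤ d * (4 * η) := by
    simpa using Finset.sum_le_sum fun i (_ : i ∈ Finset.univ) => hP i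
  have h3 : (stdGaussian V).real {z | ‖z - a‖ ≤ η * Real.sqrt d} * (3 / 4) ≤ 4 * η := by
    refine le_of_mul_le_mul_right ?_ hd1
    linarith
  linarith

/-- A Gaussian vector whose covariance matrix dominates the identity is the sum of a standard
Gaussian vector and an independent Gaussian vector. -/
theorem multivariateGaussian_eq_map_prod {S : Matrix (Fin d) (Fin d) ℝ} (hS : S.PosSemidef)
    (hS1 : (S - 1).PosSemidef) :
    multivariateGaussian (0 : V) S =
      ((stdGaussian V).prod (multivariateGaussian 0 (S - 1))).map (fun p : V × V => p.1 + p.2) := by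
  change _ = Measure.conv _ _
  apply Measure.ext_of_charFun
  ext t
  rw [charFun_conv, charFun_multivariateGaussian hS, charFun_multivariateGaussian hS1,
    charFun_stdGaussian, ← Complex.exp_add]
  congr 1
  have h1 : ‖t‖ ^ 2 = t.ofLp ⬝ᵥ t.ofLp := by
    rw [EuclideanSpace.real_norm_sq_eq]
    simp [dotProduct, pow_two]
  have h2 : (‖t‖ : ℂ) ^ 2 = ((t.ofLp ⬝ᵥ t.ofLp : ℝ) : ℂ) := by rw [← h1]; simp
  rw [h2, Matrix.sub_mulVec, dotProduct_sub, Matrix.one_mulVec]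
  push_cast
  simp
  ring

/-- A bound on the standard Gaussian measure that holds for all translates of a set carries over to
`N(0, S)`, by conditioning on the independent summand. -/
theorem multivariateGaussian_real_le {S : Matrix (Fin d) (Fin d) ℝ} (hS : S.PosSemidef)
    (hS1 : (S - 1).PosSemidef) {A : Set V} (hA : MeasurableSet A) {c : ℝ}
    (h : ∀ v : V, (stdGaussian V).real {z | z + v ∈ A} ≤ c) :
    (multivariateGaussian (0 : V) S).real A ≤ c := by
  have hc : 0 ≤ c := measureReal_nonneg.trans (h 0)
  rw [multivariateGaussian_eq_map_prod hS hS1, map_measureReal_apply (by fun_prop) hA,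
    measureReal_def, Measure.prod_apply_symm (hA.preimage (by fun_prop))]
  refine ENNReal.toReal_le_of_le_ofReal hc ?_
  calc _ ≤ ∫⁻ _, ENNReal.ofReal c ∂multivariateGaussian (0 : V) (S - 1) := by
        refine lintegral_mono fun v => ?_
        rw [← ENNReal.ofReal_toReal (measure_ne_top (stdGaussian V) _)]
        exact ENNReal.ofReal_le_ofReal (h v)
    _ = _ := by simp

theorem multivariateGaussian_shell_le (hd : 0 < d) {S : Matrix (Fin d) (Fin d) ℝ}
    (hS : S.PosSemidef) (hS1 : (S - 1).PosSemidef) (a : V) {ρ ε : ℝ} (hε : 0 < ε) (hερ : ε ≤ ρ) :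
    (multivariateGaussian (0 : V) S).real {z | ρ < ‖z - a‖ ∧ ‖z - a‖ ≤ ρ + ε} ≤ 1416 * ε := by
  refine multivariateGaussian_real_le hS hS1 (by measurability) fun v => ?_
  have := stdGaussian_shell_le hd (a - v) hε hερ
  simpa only [Set.mem_ofPred_eq, sub_sub_eq_add_sub] using this

theorem multivariateGaussian_smallBall_le (hd : 0 < d) {S : Matrix (Fin d) (Fin d) ℝ}
    (hS : S.PosSemidef) (hS1 : (S - 1).PosSemidef) (a : V) {η : ℝ} (hη : 0 < η) :
    (multivariateGaussian (0 : V) S).real {z | ‖z - a‖ ≤ η * Real.sqrt d} ≤ 6 * η := by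
  refine multivariateGaussian_real_le hS hS1 (by measurability) fun v => ?_
  have := stdGaussian_smallBall_le hd (a - v) hη
  simpa only [Set.mem_ofPred_eq, sub_sub_eq_add_sub] using this

/-- The analogue of `multivariateGaussian_real_le` for integrals. -/
theorem abs_integral_multivariateGaussian_le {S : Matrix (Fin d) (Fin d) ℝ} (hS : S.PosSemidef)
    (hS1 : (S - 1).PosSemidef) {φ : V → ℝ} (hφ : PolyGrowth φ) {c : ℝ}
    (h : ∀ v : V, |∫ z, φ (z + v) ∂stdGaussian V| ≤ c) :
    |∫ z, φ z ∂multivariateGaussian (0 : V) S| ≤ c := by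
  have hi := hφ.integrable (multivariateGaussian (0 : V) S)
  rw [multivariateGaussian_eq_map_prod hS hS1] at hi ⊢
  have hi' := (integrable_map_measure hi.aestronglyMeasurable (by fun_prop)).1 hi
  rw [integral_map (by fun_prop) hi.aestronglyMeasurable]
  have e := integral_prod_symm (fun p : V × V => φ (p.1 + p.2)) hi'
  rw [e]
  have := norm_integral_le_of_norm_le_const (μ := multivariateGaussian (0 : V) (S - 1))
    (f := fun v => ∫ z, φ (z + v) ∂stdGaussian V) (.of_forall h)
  simpa using this

open scoped MatrixOrder in
/-- Stein's identity for `N(0, S)`: `E ⟨Z, f(Z)⟩ = E ⟨S, Df(Z)⟩`. -/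
theorem multivariateGaussian_stein {S : Matrix (Fin d) (Fin d) ℝ} (hS : S.PosSemidef)
    {f : Fin d → V → ℝ} {f₂ : Fin d → Fin d → V → ℝ} (hf : ∀ i, PolyGrowth (f i))
    (hf₂ : ∀ i j, PolyGrowth (f₂ i j))
    (h : ∀ i z (w : V), HasDerivAt (fun t : ℝ => f i (z + t • w)) (∑ j, w j * f₂ i j z) 0) :
    ∫ z, ∑ i, z i * f i z ∂multivariateGaussian (0 : V) S =
      ∫ z, ∑ i, ∑ j, S i j * f₂ i j z ∂multivariateGaussian (0 : V) S := by
  set B : V →L[ℝ] V := Matrix.toEuclideanCLM (𝕜 := ℝ) (CFC.sqrt S) with hB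
  have hlaw : multivariateGaussian (0 : V) S = (stdGaussian V).map B := by
    rw [multivariateGaussian]; simp [hB]
  have hsa : ∀ x y : V, ⟪B x, y⟫ = ⟪x, B y⟫ := by
    have : IsSelfAdjoint B := (CFC.sqrt_nonneg S).isSelfAdjoint.map _
    intro x y
    rw [← ContinuousLinearMap.adjoint_inner_right, this.adjoint_eq]
  have hBB : ∀ x : V, B (B x) = Matrix.toEuclideanCLM (𝕜 := ℝ) S x := by
    intro x
    rw [← ContinuousLinearMap.comp_apply, ← ContinuousLinearMap.mul_def, hB, ← map_mul,
      CFC.sqrt_mul_sqrt_self _ hS.nonneg]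
  have hcomp : ∀ {φ : V → ℝ}, PolyGrowth φ → PolyGrowth (fun g => φ (B g)) := by
    intro φ hφ
    simpa using hφ.comp_affine B 0
  have hmap : ∀ {φ : V → ℝ}, PolyGrowth φ →
      ∫ z, φ z ∂multivariateGaussian (0 : V) S = ∫ g, φ (B g) ∂stdGaussian V := by
    intro φ hφ
    rw [hlaw, integral_map (by fun_prop) hφ.continuous.aestronglyMeasurable]
  rw [integral_finsetSum _ fun i _ => ((PolyGrowth.apply i).mul (hf i)).integrable _,
    integral_finsetSum (f := fun i z => ∑ j, S i j * f₂ i j z) _ fun i _ =>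
      (PolyGrowth.sum fun j _ => (hf₂ i j).const_mul _).integrable _]
  refine Finset.sum_congr rfl fun i _ => ?_
  rw [hmap ((PolyGrowth.apply i).mul (hf i)),
    hmap (PolyGrowth.sum fun j _ => (hf₂ i j).const_mul _)]
  have hentry : ∀ j, (B (B (EuclideanSpace.single i (1 : ℝ)))) j = S i j := by
    intro j
    have hsymm : S j i = S i j := by simpa using hS.isHermitian.apply i j
    rw [hBB, Matrix.ofLp_toEuclideanCLM]
    simp [Matrix.mulVec_single, hsymm]
  have := stdGaussian_integral_inner_mul (u := B (EuclideanSpace.single i (1 : ℝ))) (hcomp (hf i))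
    (f' := fun g => ∑ j, S i j * f₂ i j (B g)) (.sum fun j _ => (hcomp (hf₂ i j)).const_mul _)
    (fun g => by
      have h1 := h i (B g) (B (B (EuclideanSpace.single i (1 : ℝ))))
      simp only [hentry] at h1
      simpa only [map_add, map_smul] using h1)
  rw [← this]
  congr 1
  ext g
  rw [← hsa, inner_single_one]

end Covariance

/-! ### Smooth radial approximations of indicators of balls -/

/-- A smooth step function `g 0` decreasing from `1` on `(-∞, b]` to `0` on `[b + ℓ, ∞)`, together
with its derivatives `g 1, g 2, …`, of which the first four have their natural size in terms of the
width `ℓ`. -/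
structure SmoothStep (b ℓ M : ℝ) where
  g : ℕ → ℝ → ℝ
  hasDerivAt : ∀ k x, HasDerivAt (g k) (g (k + 1) x) x
  nonneg : ∀ x, 0 ≤ g 0 x
  le_one : ∀ x, g 0 x ≤ 1
  eq_one : ∀ x, x ≤ b → g 0 x = 1
  eq_zero : ∀ x, b + ℓ ≤ x → g 0 x = 0
  bound : ∀ k, 1 ≤ k → k ≤ 4 → ∀ x, |g k x| ≤ M / ℓ ^ k
  support : ∀ k, 1 ≤ k → ∀ x, x ≤ b ∨ b + ℓ ≤ x → g k x = 0

theorem iteratedDeriv_smoothTransition_eq_zero {k : ℕ} (hk : 1 ≤ k) {x : ℝ} (hx : x ≤ 0 ∨ 1 ≤ x) :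
    iteratedDeriv k Real.smoothTransition x = 0 := by
  have hc : Continuous (iteratedDeriv k Real.smoothTransition) :=
    (Real.smoothTransition.contDiff (n := ⊤)).continuous_iteratedDeriv k (by exact_mod_cast le_top)
  have aux : ∀ (c : ℝ) {s : Set ℝ}, IsOpen s → (∀ y ∈ s, Real.smoothTransition y = c) →
      ∀ y ∈ closure s, iteratedDeriv k Real.smoothTransition y = 0 := by
    intro c s hs hsc y hy
    have hclosed : IsClosed {y | iteratedDeriv k Real.smoothTransition y = 0} :=
      isClosed_eq hc continuous_const
    refine closure_minimal (fun z hz => ?_) hclosed hy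
    have he : Real.smoothTransition =ᶠ[nhds z] fun _ => c :=
      Filter.eventuallyEq_of_mem (hs.mem_nhds hz) hsc
    have : iteratedDeriv k Real.smoothTransition z = 0 := by
      rw [he.iteratedDeriv_eq k, iteratedDeriv_const]
      simp; omega
    exact this
  rcases hx with hx | hx
  · exact aux 0 isOpen_Iio (fun y hy => Real.smoothTransition.zero_of_nonpos (le_of_lt hy)) x
      (by rwa [closure_Iio, Set.mem_Iic])
  · exact aux 1 isOpen_Ioi (fun y hy => Real.smoothTransition.one_of_one_le (le_of_lt hy)) x
      (by rwa [closure_Ioi, Set.mem_Ici])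

theorem exists_abs_iteratedDeriv_smoothTransition_le (k : ℕ) :
    ∃ M : ℝ, ∀ x, |iteratedDeriv (k + 1) Real.smoothTransition x| ≤ M := by
  have hc : Continuous (iteratedDeriv (k + 1) Real.smoothTransition) :=
    (Real.smoothTransition.contDiff (n := ⊤)).continuous_iteratedDeriv _
      (by exact_mod_cast le_top)
  obtain ⟨M, hM⟩ := (isCompact_Icc (a := (0 : ℝ)) (b := 1)).exists_bound_of_continuousOn
    hc.continuousOn
  refine ⟨M, fun x => ?_⟩
  have hM0 : 0 ≤ M := (norm_nonneg _).trans (hM 0 (by simp))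
  by_cases hx : x ∈ Set.Icc (0 : ℝ) 1
  · exact hM x hx
  · rw [iteratedDeriv_smoothTransition_eq_zero (by omega), abs_zero]
    · exact hM0
    · by_contra! h
      exact hx ⟨h.1.le, h.2.le⟩

/-- Smooth steps of every position and width, rescalings of one fixed step, so with one constant. -/
theorem exists_smoothStep :
    ∃ M : ℝ, 1 ≤ M ∧ ∀ b ℓ : ℝ, 0 < ℓ → Nonempty (SmoothStep b ℓ M) := by
  choose C hC using exists_abs_iteratedDeriv_smoothTransition_le
  refine ⟨max 1 (∑ k ∈ Finset.range 4, |C k|), le_max_left _ _, fun b ℓ hℓ => ⟨?_⟩⟩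
  refine
    { g := fun k x => (if k = 0 then 1 else 0) -
        iteratedDeriv k Real.smoothTransition ((x - b) / ℓ) / ℓ ^ k
      hasDerivAt := fun k x => ?_
      nonneg := fun x => ?_
      le_one := fun x => ?_
      eq_one := fun x hx => ?_
      eq_zero := fun x hx => ?_
      bound := fun k hk hk4 x => ?_
      support := fun k hk x hx => ?_ }
  · have h0 : HasDerivAt (iteratedDeriv k Real.smoothTransition)
        (iteratedDeriv (k + 1) Real.smoothTransition ((x - b) / ℓ)) ((x - b) / ℓ) := by
      rw [iteratedDeriv_succ]
      exact (((Real.smoothTransition.contDiff (n := ⊤)).differentiable_iteratedDeriv k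
        (by exact_mod_cast WithTop.coe_lt_top _)) _).hasDerivAt
    have h1 : HasDerivAt (fun x => (x - b) / ℓ) (1 / ℓ) x :=
      ((hasDerivAt_id x).sub_const _).div_const _
    have h2 := ((h0.comp x h1).div_const (ℓ ^ k)).const_sub (if k = 0 then (1 : ℝ) else 0)
    refine h2.congr_deriv ?_
    simp only [Nat.add_eq_zero_iff, one_ne_zero, and_false, if_false, zero_sub, pow_succ]
    field_simp
  · simp [Real.smoothTransition.le_one]
  · simp [Real.smoothTransition.nonneg]
  · have : (x - b) / ℓ ≤ 0 := div_nonpos_of_nonpos_of_nonneg (by linarith) hℓ.le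
    simp [Real.smoothTransition.zero_of_nonpos this]
  · have : 1 ≤ (x - b) / ℓ := by rw [le_div_iff₀ hℓ]; linarith
    simp [Real.smoothTransition.one_of_one_le this]
  · obtain ⟨j, rfl⟩ : ∃ j, k = j + 1 := ⟨k - 1, by omega⟩
    simp only [Nat.add_eq_zero_iff, one_ne_zero, and_false, if_false, zero_sub, abs_neg, abs_div,
      abs_of_pos (pow_pos hℓ (j + 1))]
    gcongr
    refine (hC j _).trans ((le_abs_self _).trans (le_max_of_le_right ?_))
    exact Finset.single_le_sum (f := fun k => |C k|) (fun _ _ => abs_nonneg _)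
      (Finset.mem_range.2 (by omega))
  · rw [iteratedDeriv_smoothTransition_eq_zero hk]
    · simp; omega
    · refine hx.imp (fun h => ?_) fun h => ?_
      · exact div_nonpos_of_nonpos_of_nonneg (by linarith) hℓ.le
      · rw [le_div_iff₀ hℓ]; linarith

section Radial

variable {F : Type*} [NormedAddCommGroup F] [InnerProductSpace ℝ F]

/-- The radial function `y ↦ g₀(|y|²)`. -/
def rad0 {G : Type*} [NormedAddCommGroup G] (g : ℕ → ℝ → ℝ) (y : G) : ℝ := g 0 (‖y‖ ^ 2)

/-- The first derivative of `rad0 g` at `y` in the direction `u`. -/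
def rad1 (g : ℕ → ℝ → ℝ) (y u : F) : ℝ := 2 * g 1 (‖y‖ ^ 2) * ⟪y, u⟫

/-- The second derivative of `rad0 g` at `y` in the directions `u` and `v`. -/
def rad2 (g : ℕ → ℝ → ℝ) (y u v : F) : ℝ :=
  4 * g 2 (‖y‖ ^ 2) * (⟪y, u⟫ * ⟪y, v⟫) + 2 * g 1 (‖y‖ ^ 2) * ⟪u, v⟫

/-- The third derivative of `rad0 g` at `y` along the direction `u`. -/
def rad3 (g : ℕ → ℝ → ℝ) (y u : F) : ℝ :=
  8 * g 3 (‖y‖ ^ 2) * ⟪y, u⟫ ^ 3 + 12 * g 2 (‖y‖ ^ 2) * (⟪y, u⟫ * ‖u‖ ^ 2)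

/-- The fourth derivative of `rad0 g` at `y` along the direction `u`. -/
def rad4 (g : ℕ → ℝ → ℝ) (y u : F) : ℝ :=
  16 * g 4 (‖y‖ ^ 2) * ⟪y, u⟫ ^ 4 + 48 * g 3 (‖y‖ ^ 2) * (⟪y, u⟫ ^ 2 * ‖u‖ ^ 2) +
    12 * g 2 (‖y‖ ^ 2) * ‖u‖ ^ 4

variable {b ℓ M : ℝ} (T : SmoothStep b ℓ M)

theorem SmoothStep.hasDerivAt_norm_sq (k : ℕ) (y u : F) (t : ℝ) :
    HasDerivAt (fun t : ℝ => T.g k (‖y + t • u‖ ^ 2))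
      (2 * T.g (k + 1) (‖y + t • u‖ ^ 2) * ⟪y + t • u, u⟫) t :=
  ((T.hasDerivAt k _).comp t (hasDerivAt_norm_sq_line y u t)).congr_deriv (by ring)

theorem hasDerivAt_inner_line (y u v : F) (t : ℝ) :
    HasDerivAt (fun t : ℝ => ⟪y + t • u, v⟫) ⟪u, v⟫ t := by
  simp only [inner_add_left, real_inner_smul_left]
  simpa using ((hasDerivAt_id t).mul_const ⟪u, v⟫).const_add ⟪y, v⟫

theorem hasDerivAt_rad0 (y u : F) (t : ℝ) :
    HasDerivAt (fun t : ℝ => rad0 T.g (y + t • u)) (rad1 T.g (y + t • u) u) t :=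
  T.hasDerivAt_norm_sq 0 y u t

theorem hasDerivAt_rad1 (y u v : F) (t : ℝ) :
    HasDerivAt (fun t : ℝ => rad1 T.g (y + t • v) u) (rad2 T.g (y + t • v) u v) t := by
  refine (((T.hasDerivAt_norm_sq 1 y v t).const_mul 2).mul
    (hasDerivAt_inner_line y v u t)).congr_deriv ?_
  simp only [rad2, real_inner_comm u v]
  ring

theorem hasDerivAt_rad2 (y u : F) (t : ℝ) :
    HasDerivAt (fun t : ℝ => rad2 T.g (y + t • u) u u) (rad3 T.g (y + t • u) u) t := by
  have h := hasDerivAt_inner_line y u u t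
  refine ((((T.hasDerivAt_norm_sq 2 y u t).const_mul 4).mul (h.mul h)).add
    (((T.hasDerivAt_norm_sq 1 y u t).const_mul 2).mul_const ⟪u, u⟫)).congr_deriv ?_
  simp only [rad3, real_inner_self_eq_norm_sq, Pi.mul_apply]
  ring

theorem hasDerivAt_rad3 (y u : F) (t : ℝ) :
    HasDerivAt (fun t : ℝ => rad3 T.g (y + t • u) u) (rad4 T.g (y + t • u) u) t := by
  have h := hasDerivAt_inner_line y u u t
  refine ((((T.hasDerivAt_norm_sq 3 y u t).const_mul 8).mul (h.pow 3)).add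
    (((T.hasDerivAt_norm_sq 2 y u t).const_mul 12).mul (h.mul_const (‖u‖ ^ 2)))).congr_deriv ?_
  simp only [rad4, real_inner_self_eq_norm_sq]
  simp
  ring

theorem SmoothStep.continuous (k : ℕ) : Continuous (T.g k) :=
  continuous_iff_continuousAt.2 fun x => (T.hasDerivAt k x).continuousAt

theorem continuous_rad0 {G : Type*} [NormedAddCommGroup G] :
    Continuous (fun y : G => rad0 T.g y) :=
  (T.continuous 0).comp (by fun_prop)

theorem continuous_rad1 {X : Type*} [TopologicalSpace X] {f u : X → F} (hf : Continuous f)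
    (hu : Continuous u) : Continuous fun x => rad1 T.g (f x) (u x) := by
  have := T.continuous 1
  unfold rad1; fun_prop

theorem continuous_rad2 {X : Type*} [TopologicalSpace X] {f u v : X → F} (hf : Continuous f)
    (hu : Continuous u) (hv : Continuous v) : Continuous fun x => rad2 T.g (f x) (u x) (v x) := by
  have := T.continuous 1
  have := T.continuous 2
  unfold rad2; fun_prop

theorem continuous_rad4 {X : Type*} [TopologicalSpace X] {f u : X → F} (hf : Continuous f)
    (hu : Continuous u) : Continuous fun x => rad4 T.g (f x) (u x) := by
  have := T.continuous 2
  have := T.continuous 3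
  have := T.continuous 4
  unfold rad4; fun_prop

theorem abs_rad0_le {G : Type*} [NormedAddCommGroup G] (y : G) : |rad0 T.g y| ≤ 1 :=
  abs_le.2 ⟨by linarith [T.nonneg (‖y‖ ^ 2), show rad0 T.g y = T.g 0 (‖y‖ ^ 2) from rfl],
    T.le_one _⟩

end Radial

section RadialBounds

variable {F : Type*} [NormedAddCommGroup F] [InnerProductSpace ℝ F]

/-- The shell with inner radius `ρ` and thickness `ε` around the origin. -/
def shell (F : Type*) [NormedAddCommGroup F] (ρ ε : ℝ) : Set F := {y | ρ < ‖y‖ ∧ ‖y‖ ≤ ρ + ε}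

/-- A smooth step along which `|y|` crosses the interval `[ρ, ρ + ε]`. -/
abbrev ShellStep (ρ ε M : ℝ) := SmoothStep (ρ ^ 2) ((ρ + ε) ^ 2 - ρ ^ 2) M

variable {ρ ε M : ℝ} (T : ShellStep ρ ε M)

theorem ShellStep.eq_zero_of_notMem {G : Type*} [NormedAddCommGroup G] (hε : 0 < ε) (hρ : 0 < ρ)
    {k : ℕ} (hk : 1 ≤ k) {y : G} (hy : y ∉ shell G ρ ε) : T.g k (‖y‖ ^ 2) = 0 := by
  refine T.support k hk _ ?_
  by_cases h : ρ < ‖y‖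
  · right
    have h2 : ρ + ε < ‖y‖ := not_le.1 fun h2 => hy ⟨h, h2⟩
    nlinarith
  · left
    nlinarith [norm_nonneg y, not_lt.1 h]

theorem ShellStep.abs_le (hM : 0 ≤ M) (hε : 0 < ε) (hρ : 0 < ρ) {k : ℕ} (hk : 1 ≤ k) (hk4 : k ≤ 4)
    (x : ℝ) : |T.g k x| ≤ M / (2 * ρ * ε) ^ k := by
  refine (T.bound k hk hk4 x).trans ?_
  gcongr
  nlinarith

theorem abs_rad1_le (hM : 0 ≤ M) (hε : 0 < ε) (hερ : ε ≤ ρ) (y u : F) :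
    |rad1 T.g y u| ≤ 2 * M / ε * ‖u‖ := by
  have hρ : 0 < ρ := hε.trans_le hερ
  by_cases hy : y ∈ shell F ρ ε
  · have hy2 : ‖y‖ ≤ 2 * ρ := by linarith [hy.2]
    have h1 := T.abs_le hM hε hρ le_rfl (by norm_num) (‖y‖ ^ 2)
    have h2 := abs_real_inner_le_norm y u
    rw [rad1, abs_mul, abs_mul, abs_two]
    calc 2 * |T.g 1 (‖y‖ ^ 2)| * |⟪y, u⟫|
        ≤ 2 * (M / (2 * ρ * ε) ^ 1) * (2 * ρ * ‖u‖) := by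
          gcongr
          exact h2.trans (by gcongr)
      _ = 2 * M / ε * ‖u‖ := by field_simp
  · rw [rad1, T.eq_zero_of_notMem hε hρ le_rfl hy]
    simp only [mul_zero, zero_mul, abs_zero]
    positivity

theorem rad2_eq_zero_of_notMem (hε : 0 < ε) (hρ : 0 < ρ) {y : F} (hy : y ∉ shell F ρ ε) (u v : F) :
    rad2 T.g y u v = 0 := by
  rw [rad2, T.eq_zero_of_notMem hε hρ le_rfl hy, T.eq_zero_of_notMem hε hρ one_le_two hy]
  simp

theorem rad4_eq_zero_of_notMem (hε : 0 < ε) (hρ : 0 < ρ) {y : F} (hy : y ∉ shell F ρ ε) (u : F) :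
    rad4 T.g y u = 0 := by
  rw [rad4, T.eq_zero_of_notMem hε hρ one_le_two hy,
    T.eq_zero_of_notMem hε hρ (by norm_num : 1 ≤ 3) hy,
    T.eq_zero_of_notMem hε hρ (by norm_num : 1 ≤ 4) hy]
  simp

theorem four_mul_abs_g_two_le (hM : 0 ≤ M) (hε : 0 < ε) (hρ : 0 < ρ) (x : ℝ) :
    4 * |T.g 2 x| * (2 * ρ) ^ 2 ≤ 4 * M / ε ^ 2 := by
  have h1 := T.abs_le hM hε hρ one_le_two (by norm_num) x
  calc _ ≤ 4 * (M / (2 * ρ * ε) ^ 2) * (2 * ρ) ^ 2 := by gcongr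
    _ = _ := by field_simp

theorem two_mul_abs_g_one_le (hM : 0 ≤ M) (hε : 0 < ε) (hρ : 0 < ρ) (x : ℝ) :
    2 * |T.g 1 x| * ρ ≤ M / ε := by
  have h1 := T.abs_le hM hε hρ le_rfl (by norm_num) x
  calc _ ≤ 2 * (M / (2 * ρ * ε) ^ 1) * ρ := by gcongr
    _ = _ := by field_simp

theorem abs_rad2_le (hM : 0 ≤ M) (hε : 0 < ε) (hερ : ε ≤ ρ) (y u v : F) :
    |rad2 T.g y u v| ≤ 5 * M / ε ^ 2 * (‖u‖ * ‖v‖) := by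
  have hρ : 0 < ρ := hε.trans_le hερ
  by_cases hy : y ∈ shell F ρ ε
  · have hy2 : ‖y‖ ≤ 2 * ρ := by linarith [hy.2]
    have h1 := four_mul_abs_g_two_le T hM hε hρ (‖y‖ ^ 2)
    have h2 := two_mul_abs_g_one_le T hM hε hρ (‖y‖ ^ 2)
    have h3 : 2 * |T.g 1 (‖y‖ ^ 2)| ≤ M / ε ^ 2 := by
      have : 2 * |T.g 1 (‖y‖ ^ 2)| * ε ≤ M / ε := le_trans (by gcongr) h2
      rw [le_div_iff₀ (by positivity)]
      rw [le_div_iff₀ hε] at this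
      linarith
    calc |rad2 T.g y u v| ≤ 4 * |T.g 2 (‖y‖ ^ 2)| * (|⟪y, u⟫| * |⟪y, v⟫|) +
          2 * |T.g 1 (‖y‖ ^ 2)| * |⟪u, v⟫| := by
          rw [rad2]
          refine (abs_add_le _ _).trans (le_of_eq ?_)
          simp [abs_mul]
      _ ≤ 4 * |T.g 2 (‖y‖ ^ 2)| * ((2 * ρ * ‖u‖) * (2 * ρ * ‖v‖)) +
          2 * |T.g 1 (‖y‖ ^ 2)| * (‖u‖ * ‖v‖) := by
          gcongr
          · exact (abs_real_inner_le_norm y u).trans (by gcongr)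
          · exact (abs_real_inner_le_norm y v).trans (by gcongr)
          · exact abs_real_inner_le_norm u v
      _ = (4 * |T.g 2 (‖y‖ ^ 2)| * (2 * ρ) ^ 2 + 2 * |T.g 1 (‖y‖ ^ 2)|) * (‖u‖ * ‖v‖) := by ring
      _ ≤ (4 * M / ε ^ 2 + M / ε ^ 2) * (‖u‖ * ‖v‖) := by gcongr
      _ = _ := by ring
  · rw [rad2_eq_zero_of_notMem T hε hρ hy, abs_zero]
    positivity

theorem abs_rad4_le (hM : 0 ≤ M) (hε : 0 < ε) (hερ : ε ≤ ρ) (y u : F) :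
    |rad4 T.g y u| ≤ 43 * M / ε ^ 4 * ‖u‖ ^ 4 := by
  have hρ : 0 < ρ := hε.trans_le hερ
  by_cases hy : y ∈ shell F ρ ε
  · have hy2 : ‖y‖ ≤ 2 * ρ := by linarith [hy.2]
    have h2 := T.abs_le hM hε hρ (k := 2) (by norm_num) (by norm_num) (‖y‖ ^ 2)
    have h3 := T.abs_le hM hε hρ (k := 3) (by norm_num) (by norm_num) (‖y‖ ^ 2)
    have h4 := T.abs_le hM hε hρ (k := 4) (by norm_num) (by norm_num) (‖y‖ ^ 2)
    have hin : |⟪y, u⟫| ≤ 2 * ρ * ‖u‖ := (abs_real_inner_le_norm y u).trans (by gcongr)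
    calc |rad4 T.g y u| ≤ 16 * |T.g 4 (‖y‖ ^ 2)| * |⟪y, u⟫| ^ 4 +
          48 * |T.g 3 (‖y‖ ^ 2)| * (|⟪y, u⟫| ^ 2 * ‖u‖ ^ 2) +
          12 * |T.g 2 (‖y‖ ^ 2)| * ‖u‖ ^ 4 := by
          rw [rad4]
          refine (abs_add_le _ _).trans (add_le_add ((abs_add_le _ _).trans (le_of_eq ?_))
            (le_of_eq ?_)) <;> simp [abs_mul]
      _ ≤ 16 * (M / (2 * ρ * ε) ^ 4) * (2 * ρ * ‖u‖) ^ 4 +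
          48 * (M / (2 * ρ * ε) ^ 3) * ((2 * ρ * ‖u‖) ^ 2 * ‖u‖ ^ 2) +
          12 * (M / (2 * ρ * ε) ^ 2) * ‖u‖ ^ 4 := by gcongr
      _ = M * ‖u‖ ^ 4 * (16 / ε ^ 4 + 24 / (ε ^ 3 * ρ) + 3 / (ε ^ 2 * ρ ^ 2)) := by
          field_simp; ring
      _ ≤ M * ‖u‖ ^ 4 * (16 / ε ^ 4 + 24 / (ε ^ 3 * ε) + 3 / (ε ^ 2 * ε ^ 2)) := by gcongr
      _ = _ := by field_simp; ring
  · rw [rad4_eq_zero_of_notMem T hε hρ hy, abs_zero]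
    positivity

variable {d : ℕ}

local notation "V" => EuclideanSpace ℝ (Fin d)

/-- The matrix of the second derivative of the radial function `rad0 g` at `y`. -/
noncomputable def radHess (g : ℕ → ℝ → ℝ) (y : V) (i j : Fin d) : ℝ :=
  rad2 g y (EuclideanSpace.single i 1) (EuclideanSpace.single j 1)

theorem radHess_eq (g : ℕ → ℝ → ℝ) (y : V) (i j : Fin d) :
    radHess g y i j = 4 * g 2 (‖y‖ ^ 2) * (y i * y j) +
      2 * g 1 (‖y‖ ^ 2) * (1 : Matrix (Fin d) (Fin d) ℝ) i j := by
  rw [radHess, rad2, inner_single_one, inner_single_one, inner_single_single]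

theorem rad2_eq_sum (g : ℕ → ℝ → ℝ) (y u v : V) :
    rad2 g y u v = ∑ i, ∑ j, u i * v j * radHess g y i j := by
  have h1 : ∀ w : V, ⟪y, w⟫ = ∑ i, w i * y i := fun w => by simp [PiLp.inner_apply]
  have h2 : ⟪u, v⟫ = ∑ i, ∑ j, u i * v j * (1 : Matrix (Fin d) (Fin d) ℝ) i j := by
    simp [PiLp.inner_apply, Matrix.one_apply, mul_comm]
  simp only [rad2, radHess_eq, h1, h2, mul_add, Finset.sum_add_distrib, Finset.sum_mul_sum]
  simp only [Finset.mul_sum]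
  congr 1 <;> exact Finset.sum_congr rfl fun i _ => Finset.sum_congr rfl fun j _ => by ring

/-- For radii `ρ ≥ ε √d` the Hilbert-Schmidt norm of the Hessian of the smoothed indicator is of the
same order `ε⁻²` as its operator norm. -/
theorem abs_sum_mul_radHess_le (hd : 0 < d) (hM : 0 ≤ M) (hε : 0 < ε)
    (hρd : ε * Real.sqrt d ≤ ρ) (A : Matrix (Fin d) (Fin d) ℝ) (y : V) :
    |∑ i, ∑ j, A i j * radHess T.g y i j| ≤ 5 * M / ε ^ 2 * matHSNorm A := by
  have hA := matHSNorm_nonneg A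
  have hd1 : 1 ≤ Real.sqrt d := by rw [Real.one_le_sqrt]; exact_mod_cast hd
  have hερ : ε ≤ ρ := le_trans (le_mul_of_one_le_right hε.le hd1) hρd
  have hρ : 0 < ρ := hε.trans_le hερ
  by_cases hy : y ∈ shell V ρ ε
  · have hy2 : ‖y‖ ≤ 2 * ρ := by linarith [hy.2]
    have h1 := four_mul_abs_g_two_le T hM hε hρ (‖y‖ ^ 2)
    have h2 := two_mul_abs_g_one_le T hM hε hρ (‖y‖ ^ 2)
    have h3 : 2 * |T.g 1 (‖y‖ ^ 2)| * Real.sqrt d ≤ M / ε ^ 2 := by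
      have : 2 * |T.g 1 (‖y‖ ^ 2)| * (ε * Real.sqrt d) ≤ M / ε := le_trans (by gcongr) h2
      rw [le_div_iff₀ (by positivity)]
      rw [le_div_iff₀ hε] at this
      linarith
    have hyy : matHSNorm (Matrix.of fun i j => y i * y j) = ‖y‖ ^ 2 := by
      refine (sq_eq_sq₀ (matHSNorm_nonneg _) (by positivity)).1 ?_
      rw [matHSNorm_sq, EuclideanSpace.real_norm_sq_eq, pow_two, Finset.sum_mul_sum]
      exact Finset.sum_congr rfl fun i _ => Finset.sum_congr rfl fun j _ => by
        rw [Matrix.of_apply]; ring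
    have h1n : matHSNorm (1 : Matrix (Fin d) (Fin d) ℝ) = Real.sqrt d := by
      rw [← matHSNorm_one_sq, Real.sqrt_sq (matHSNorm_nonneg _)]
    have e : ∑ i, ∑ j, A i j * radHess T.g y i j =
        4 * T.g 2 (‖y‖ ^ 2) * ∑ i, ∑ j, A i j * (Matrix.of fun i j => y i * y j) i j +
        2 * T.g 1 (‖y‖ ^ 2) * ∑ i, ∑ j, A i j * (1 : Matrix (Fin d) (Fin d) ℝ) i j := by
      simp only [radHess_eq, mul_add, Finset.sum_add_distrib, Finset.mul_sum, Matrix.of_apply]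
      congr 1 <;> exact Finset.sum_congr rfl fun i _ => Finset.sum_congr rfl fun j _ => by ring
    rw [e]
    calc _ ≤ 4 * |T.g 2 (‖y‖ ^ 2)| *
          |∑ i, ∑ j, A i j * (Matrix.of fun i j => y i * y j) i j| +
          2 * |T.g 1 (‖y‖ ^ 2)| *
          |∑ i, ∑ j, A i j * (1 : Matrix (Fin d) (Fin d) ℝ) i j| := by
          refine (abs_add_le _ _).trans (le_of_eq ?_)
          simp [abs_mul]
      _ ≤ 4 * |T.g 2 (‖y‖ ^ 2)| * (matHSNorm A * (2 * ρ) ^ 2) +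
          2 * |T.g 1 (‖y‖ ^ 2)| * (matHSNorm A * Real.sqrt d) := by
          gcongr
          · refine (sum_mul_le_matHSNorm A _).trans ?_
            rw [hyy]; gcongr
          · exact (sum_mul_le_matHSNorm A _).trans (by rw [h1n])
      _ = (4 * |T.g 2 (‖y‖ ^ 2)| * (2 * ρ) ^ 2 + 2 * |T.g 1 (‖y‖ ^ 2)| * Real.sqrt d) *
          matHSNorm A := by ring
      _ ≤ (4 * M / ε ^ 2 + M / ε ^ 2) * matHSNorm A := by gcongr
      _ = _ := by ring
  · have : ∀ i j, radHess T.g y i j = 0 := fun i j => rad2_eq_zero_of_notMem T hε hρ hy _ _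
    simp only [this, mul_zero, Finset.sum_const_zero, abs_zero]
    positivity

end RadialBounds

/-! ### Gaussian averages of the derivatives of a smoothed indicator -/

section Averages

variable {d : ℕ}

local notation "V" => EuclideanSpace ℝ (Fin d)

theorem hasDerivAt_comp_mul_zero {φ : ℝ → ℝ} {φ' : ℝ} (s : ℝ) (h : HasDerivAt φ φ' 0) :
    HasDerivAt (fun t => φ (t * s)) (s * φ') 0 := by
  have h1 : HasDerivAt (fun t : ℝ => t * s) s 0 := by simpa using (hasDerivAt_id (0 : ℝ)).mul_const s
  have h2 : HasDerivAt φ φ' ((fun t : ℝ => t * s) 0) := by simpa using h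
  exact (h2.comp (0 : ℝ) h1).congr_deriv (mul_comm _ _)

section Step

variable {b ℓ M : ℝ} (T : SmoothStep b ℓ M)

theorem polyGrowth_inner_affine (y u : V) (s : ℝ) : PolyGrowth fun z : V => ⟪y + s • z, u⟫ := by
  simpa using (PolyGrowth.inner_right u).comp_affine (s • ContinuousLinearMap.id ℝ V) y

theorem polyGrowth_step {k : ℕ} (hk : k ≤ 4) (y : V) (s : ℝ) :
    PolyGrowth fun z : V => T.g k (‖y + s • z‖ ^ 2) := by
  have hc : Continuous fun z : V => T.g k (‖y + s • z‖ ^ 2) := (T.continuous k).comp (by fun_prop)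
  rcases Nat.eq_zero_or_pos k with rfl | h
  · refine .of_bound hc 1 fun z => ?_
    rw [abs_of_nonneg (T.nonneg _)]
    exact T.le_one _
  · exact .of_bound hc _ fun z => T.bound k h hk _

theorem polyGrowth_rad0 (y : V) (s : ℝ) : PolyGrowth fun z : V => rad0 T.g (y + s • z) :=
  polyGrowth_step T (by norm_num) y s

theorem polyGrowth_rad1 (y u : V) (s : ℝ) : PolyGrowth fun z : V => rad1 T.g (y + s • z) u :=
  ((polyGrowth_step T (by norm_num) y s).const_mul 2).mul (polyGrowth_inner_affine y u s)

theorem polyGrowth_rad2 (y u v : V) (s : ℝ) : PolyGrowth fun z : V => rad2 T.g (y + s • z) u v :=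
  (((polyGrowth_step T (by norm_num) y s).const_mul 4).mul
    ((polyGrowth_inner_affine y u s).mul (polyGrowth_inner_affine y v s))).add
    (((polyGrowth_step T (by norm_num) y s).const_mul 2).mul (.const _))

theorem polyGrowth_rad3 (y u : V) (s : ℝ) : PolyGrowth fun z : V => rad3 T.g (y + s • z) u :=
  (((polyGrowth_step T (by norm_num) y s).const_mul 8).mul
    ((polyGrowth_inner_affine y u s).pow 3)).add
    (((polyGrowth_step T (by norm_num) y s).const_mul 12).mul
      ((polyGrowth_inner_affine y u s).mul (.const _)))

theorem polyGrowth_rad4 (y u : V) (s : ℝ) : PolyGrowth fun z : V => rad4 T.g (y + s • z) u :=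
  ((((polyGrowth_step T (by norm_num) y s).const_mul 16).mul
    ((polyGrowth_inner_affine y u s).pow 4)).add
    (((polyGrowth_step T (by norm_num) y s).const_mul 48).mul
      (((polyGrowth_inner_affine y u s).pow 2).mul (.const _)))).add
    (((polyGrowth_step T (by norm_num) y s).const_mul 12).mul (.const _))

theorem polyGrowth_sum_radHess (A : Matrix (Fin d) (Fin d) ℝ) (y : V) (s : ℝ) :
    PolyGrowth fun z : V => ∑ i, ∑ j, A i j * radHess T.g (y + s • z) i j :=
  .sum fun _ _ => .sum fun _ _ => (polyGrowth_rad2 T y _ _ s).const_mul _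

theorem hasDerivAt_line_add_smul (y z u : V) (s : ℝ) {φ : V → ℝ} {φ' : ℝ}
    (h : HasDerivAt (fun t : ℝ => φ (y + s • z + t • u)) φ' 0) :
    HasDerivAt (fun t : ℝ => φ (y + s • (z + t • u))) (s * φ') 0 := by
  refine (hasDerivAt_comp_mul_zero s h).congr_of_eventuallyEq (.of_forall fun t => ?_)
  simp only [smul_add, smul_smul, add_assoc, mul_comm]

theorem stdGaussian_integral_rad4 (y u : V) (s : ℝ) :
    s ^ 2 * ∫ z, rad4 T.g (y + s • z) u ∂stdGaussian V =
      ∫ z, rad2 T.g (y + s • z) u u * (⟪z, u⟫ * ⟪z, u⟫ - ⟪u, u⟫) ∂stdGaussian V := by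
  rw [← integral_const_mul]
  refine stdGaussian_integral_second (polyGrowth_rad2 T y u u s)
    ((polyGrowth_rad3 T y u s).const_mul s) ((polyGrowth_rad4 T y u s).const_mul (s ^ 2))
    (fun z => hasDerivAt_line_add_smul y z u s (φ := fun x => rad2 T.g x u u) ?_) fun z => ?_
  · simpa using hasDerivAt_rad2 T (y + s • z) u 0
  · have := (hasDerivAt_line_add_smul y z u s (φ := fun x => rad3 T.g x u)
      (φ' := rad4 T.g (y + s • z) u) (by simpa using hasDerivAt_rad3 T (y + s • z) u 0)).const_mul s
    exact this.congr_deriv (by ring)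

theorem abs_stdGaussian_integral_radHess_le (A : Matrix (Fin d) (Fin d) ℝ) (y : V) {s : ℝ}
    (hs : 0 < s) :
    |∫ z, ∑ i, ∑ j, A i j * radHess T.g (y + s • z) i j ∂stdGaussian V| ≤
      2 * matHSNorm A / s ^ 2 := by
  have := abs_integral_hessian_le A (f := fun z => rad0 T.g (y + s • z))
    (f₁ := fun i z => s * rad1 T.g (y + s • z) (EuclideanSpace.single i 1))
    (f₂ := fun i j z => s ^ 2 * radHess T.g (y + s • z) i j) (polyGrowth_rad0 T y s)
    (fun i => (polyGrowth_rad1 T y _ s).const_mul s)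
    (fun i j => (polyGrowth_rad2 T y _ _ s).const_mul (s ^ 2))
    (fun i z => hasDerivAt_line_add_smul y z _ s
      (by simpa using hasDerivAt_rad0 T (y + s • z) (EuclideanSpace.single i (1 : ℝ)) 0))
    (fun i j z => by
      have := (hasDerivAt_line_add_smul y z (EuclideanSpace.single j (1 : ℝ)) s
        (φ := fun x => rad1 T.g x (EuclideanSpace.single i (1 : ℝ)))
        (φ' := radHess T.g (y + s • z) i j) (by
          simpa [radHess] using hasDerivAt_rad1 T (y + s • z) (EuclideanSpace.single i (1 : ℝ))
            (EuclideanSpace.single j (1 : ℝ)) 0)).const_mul s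
      exact this.congr_deriv (by ring))
    (fun z => abs_rad0_le T _)
  have e : ∀ z : V, ∑ i, ∑ j, A i j * (s ^ 2 * radHess T.g (y + s • z) i j) =
      s ^ 2 * ∑ i, ∑ j, A i j * radHess T.g (y + s • z) i j := by
    intro z
    simp only [Finset.mul_sum]
    exact Finset.sum_congr rfl fun i _ => Finset.sum_congr rfl fun j _ => by ring
  simp only [e] at this
  rw [integral_const_mul, abs_mul, abs_of_pos (pow_pos hs 2)] at this
  rw [le_div_iff₀ (by positivity)]
  linarith

end Step

/-- Two bounds `X ε² ≤ K` and `X s² ≤ K` combine into the kernel `1 / (s² + ε²)`, whose integral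
over `s ds` is logarithmic. -/
theorem le_two_mul_div_add {X K s ε : ℝ} (hε : 0 < ε) (hK : 0 ≤ K) (h1 : X ≤ K / ε ^ 2)
    (h2 : 0 < s → X ≤ K / s ^ 2) (hs : 0 ≤ s) : X ≤ 2 * K / (s ^ 2 + ε ^ 2) := by
  rw [le_div_iff₀ (by positivity)] at h1 ⊢
  rcases hs.eq_or_lt with rfl | hs
  · linarith
  · have := h2 hs
    rw [le_div_iff₀ (by positivity)] at this
    linarith

variable {ρ ε M : ℝ} (T : ShellStep ρ ε M)

/-- The Gaussian average at scale `s` of the pairing of `A` with the Hessian: the pointwise bound of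
order `ε⁻²` is combined with the bound of order `s⁻²` from integration by parts. -/
theorem abs_integral_radHess_le (hd : 0 < d) (hM : 1 ≤ M) (hε : 0 < ε)
    (hρd : ε * Real.sqrt d ≤ ρ) {S : Matrix (Fin d) (Fin d) ℝ} (hS : S.PosSemidef)
    (hS1 : (S - 1).PosSemidef) (A : Matrix (Fin d) (Fin d) ℝ) (y : V) {s : ℝ} (hs : 0 ≤ s) :
    |∫ z, ∑ i, ∑ j, A i j * radHess T.g (y + s • z) i j ∂multivariateGaussian (0 : V) S| ≤
      10 * M * matHSNorm A / (s ^ 2 + ε ^ 2) := by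
  have hA := matHSNorm_nonneg A
  refine (le_two_mul_div_add (K := 5 * M * matHSNorm A) hε (by positivity) ?_ (fun hs => ?_) hs).trans
    (le_of_eq (by ring))
  · have := norm_integral_le_of_norm_le_const (μ := multivariateGaussian (0 : V) S)
      (f := fun z => ∑ i, ∑ j, A i j * radHess T.g (y + s • z) i j)
      (.of_forall fun z => abs_sum_mul_radHess_le T hd (by linarith) hε hρd A (y + s • z))
    simp only [probReal_univ, mul_one] at this
    exact this.trans (le_of_eq (by ring))
  · refine abs_integral_multivariateGaussian_le hS hS1 (polyGrowth_sum_radHess T A y s) fun v => ?_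
    have e : ∀ z : V, y + s • (z + v) = y + s • v + s • z := fun z => by module
    simp only [e]
    refine (abs_stdGaussian_integral_radHess_le T A _ hs).trans ?_
    gcongr
    linarith

/-- If `X` charges no translate of the shell by more than `τ`, then a bounded function supported on
the shell has, at translates of `X`, an integral of order `τ`. -/
theorem abs_integral_le_of_shell {L : Measure V} [IsProbabilityMeasure L] {τ K : ℝ}
    (hτ : ∀ v : V, L.real {x | x + v ∈ shell V ρ ε} ≤ τ) {φ : V → ℝ} (hK : ∀ y, |φ y| ≤ K)
    (hφ : ∀ y ∉ shell V ρ ε, φ y = 0) (v : V) :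
    |∫ x, φ (x + v) ∂L| ≤ K * τ := by
  have hK0 : 0 ≤ K := (abs_nonneg _).trans (hK 0)
  have hms : MeasurableSet {x : V | x + v ∈ shell V ρ ε} := by
    simp only [shell]
    measurability
  calc |∫ x, φ (x + v) ∂L| ≤ ∫ x, |φ (x + v)| ∂L := abs_integral_le_integral_abs
    _ ≤ ∫ x, {x : V | x + v ∈ shell V ρ ε}.indicator (fun _ => K) x ∂L := by
        refine integral_mono_of_nonneg (.of_forall fun _ => abs_nonneg _)
          ((integrable_const _).indicator hms) (.of_forall fun x => ?_)
        refine Set.le_indicator_apply (fun _ => hK _) fun hx => ?_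
        simp only [hφ _ hx, abs_zero, le_refl]
    _ = L.real {x : V | x + v ∈ shell V ρ ε} * K := integral_indicator_const _ hms
    _ ≤ K * τ := by rw [mul_comm]; exact mul_le_mul_of_nonneg_left (hτ v) hK0

/-- Two integrations by parts in the Gaussian variable replace the fourth derivative by the second
one, which is supported in the shell; the average over `L` is then taken first, for a fixed value of
the Gaussian variable, and is of order `τ`. -/
theorem abs_stdGaussian_integral_rad4_le (hM : 1 ≤ M) (hε : 0 < ε) (hερ : ε ≤ ρ) {L : Measure V}
    [IsProbabilityMeasure L] {τ : ℝ} (hτ : ∀ v : V, L.real {x | x + v ∈ shell V ρ ε} ≤ τ)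
    (v u : V) {s : ℝ} (hs : 0 < s) :
    |∫ x, ∫ z, rad4 T.g (x + v + s • z) u ∂stdGaussian V ∂L| ≤
      10 * M / ε ^ 2 * τ * ‖u‖ ^ 4 / s ^ 2 := by
  have hρ : 0 < ρ := hε.trans_le hερ
  have hM0 : 0 ≤ M := by linarith
  set q : V → ℝ := fun z => ⟪z, u⟫ * ⟪z, u⟫ - ⟪u, u⟫ with hq
  have gq : PolyGrowth q :=
    ((PolyGrowth.inner_right u).mul (PolyGrowth.inner_right u)).sub (.const _)
  have hswap : s ^ 2 * ∫ x, ∫ z, rad4 T.g (x + v + s • z) u ∂stdGaussian V ∂L =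
      ∫ z, (∫ x, rad2 T.g (x + (v + s • z)) u u ∂L) * q z ∂stdGaussian V := by
    rw [← integral_const_mul]
    simp_rw [stdGaussian_integral_rad4 T]
    rw [integral_integral_swap]
    · congr 1; ext z
      rw [← integral_mul_const]
      simp only [add_assoc, hq]
    · have hqi : Integrable (fun p : V × V => q p.2) (L.prod (stdGaussian V)) :=
        (gq.integrable (stdGaussian V)).comp_snd L
      refine Integrable.bdd_mul (c := 5 * M / ε ^ 2 * (‖u‖ * ‖u‖)) hqi
        (f := fun p : V × V => rad2 T.g (p.1 + v + s • p.2) u u)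
        (Continuous.aestronglyMeasurable ?_) (.of_forall fun p => ?_)
      · exact continuous_rad2 T (by fun_prop) continuous_const continuous_const
      · exact abs_rad2_le T hM0 hε hερ _ u u
  have hq1 : ∫ z, |q z| ∂stdGaussian V ≤ 2 * ‖u‖ ^ 2 := by
    calc ∫ z, |q z| ∂stdGaussian V ≤ ∫ z, (⟪z, u⟫ * ⟪z, u⟫ + ‖u‖ ^ 2) ∂stdGaussian V := by
          refine integral_mono (gq.abs.integrable _)
            ((((PolyGrowth.inner_right u).mul (PolyGrowth.inner_right u)).add
              (.const _)).integrable _) fun z => ?_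
          simp only [hq, real_inner_self_eq_norm_sq]
          rw [abs_le]
          constructor <;> nlinarith [sq_nonneg ⟪z, u⟫, sq_nonneg ‖u‖]
      _ = 2 * ‖u‖ ^ 2 := by
          rw [integral_add (((PolyGrowth.inner_right u).mul (PolyGrowth.inner_right u)).integrable _)
            (integrable_const _), stdGaussian_integral_inner_mul_inner, real_inner_self_eq_norm_sq]
          simp; ring
  have hb : ∀ z : V, |∫ x, rad2 T.g (x + (v + s • z)) u u ∂L| ≤
      5 * M / ε ^ 2 * (‖u‖ * ‖u‖) * τ := fun z =>
    abs_integral_le_of_shell hτ (φ := fun y => rad2 T.g y u u)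
      (fun y => abs_rad2_le T hM0 hε hερ y u u)
      (fun y hy => rad2_eq_zero_of_notMem T hε hρ hy u u) _
  have hτ0 : 0 ≤ τ := measureReal_nonneg.trans (hτ 0)
  have hmain : |∫ z, (∫ x, rad2 T.g (x + (v + s • z)) u u ∂L) * q z ∂stdGaussian V| ≤
      5 * M / ε ^ 2 * (‖u‖ * ‖u‖) * τ * (2 * ‖u‖ ^ 2) := by
    refine abs_integral_le_integral_abs.trans ((integral_mono_of_nonneg
      (.of_forall fun _ => abs_nonneg _) ((gq.abs.integrable _).const_mul _)
      (.of_forall fun z => ?_)).trans ((integral_const_mul _ _).le.trans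
        (mul_le_mul_of_nonneg_left hq1 (by positivity))))
    simp only [abs_mul]
    exact mul_le_mul_of_nonneg_right (hb z) (abs_nonneg _)
  rw [← hswap, abs_mul, abs_of_pos (pow_pos hs 2)] at hmain
  rw [le_div_iff₀ (by positivity)]
  calc _ = s ^ 2 * |∫ x, ∫ z, rad4 T.g (x + v + s • z) u ∂stdGaussian V ∂L| := mul_comm _ _
    _ ≤ _ := hmain
    _ = _ := by ring

/-- The fourth derivative of the smoothed indicator, averaged over `X + sZ + q`: its size `ε⁻⁴`, or
`ε⁻² s⁻²` after two integrations by parts, gains the factor `τ` from the localization to the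
shell. -/
theorem abs_integral_rad4_le (hM : 1 ≤ M) (hε : 0 < ε) (hερ : ε ≤ ρ) {L : Measure V}
    [IsProbabilityMeasure L] {τ : ℝ} (hτ : ∀ v : V, L.real {x | x + v ∈ shell V ρ ε} ≤ τ)
    {S : Matrix (Fin d) (Fin d) ℝ} (hS : S.PosSemidef) (hS1 : (S - 1).PosSemidef)
    (q u : V) {s : ℝ} (hs : 0 ≤ s) :
    |∫ p, rad4 T.g (p.1 + s • p.2 + q) u ∂L.prod (multivariateGaussian (0 : V) S)| ≤
      86 * M * τ / ε ^ 2 / (s ^ 2 + ε ^ 2) * ‖u‖ ^ 4 := by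
  have hρ : 0 < ρ := hε.trans_le hερ
  have hM0 : 0 ≤ M := by linarith
  have hτ0 : 0 ≤ τ := measureReal_nonneg.trans (hτ 0)
  have hcomp : Continuous fun p : V × V => rad4 T.g (p.1 + s • p.2 + q) u :=
    continuous_rad4 T (by fun_prop) continuous_const
  have hint : ∀ {ν : Measure (V × V)} [IsFiniteMeasure ν],
      Integrable (fun p : V × V => rad4 T.g (p.1 + s • p.2 + q) u) ν := by
    intro ν _
    exact Integrable.of_bound hcomp.aestronglyMeasurable (43 * M / ε ^ 4 * ‖u‖ ^ 4)
      (.of_forall fun p => abs_rad4_le T hM0 hε hερ _ u)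
  rw [integral_prod_symm _ hint]
  simp only []
  have hφb : ∀ z : V, |∫ x, rad4 T.g (x + s • z + q) u ∂L| ≤ 43 * M / ε ^ 4 * ‖u‖ ^ 4 * τ := by
    intro z
    simp only [add_assoc]
    exact abs_integral_le_of_shell hτ (φ := fun y => rad4 T.g y u)
      (fun y => abs_rad4_le T hM0 hε hερ y u)
      (fun y hy => rad4_eq_zero_of_notMem T hε hρ hy u) _
  refine (le_two_mul_div_add (K := 43 * M * τ / ε ^ 2 * ‖u‖ ^ 4) hε
    (by positivity) ?_ (fun hs => ?_) hs).trans
    (le_of_eq (by ring))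
  · have := norm_integral_le_of_norm_le_const (μ := multivariateGaussian (0 : V) S)
      (f := fun z => ∫ x, rad4 T.g (x + s • z + q) u ∂L) (.of_forall hφb)
    simp only [probReal_univ, mul_one] at this
    exact this.trans (le_of_eq (by field_simp))
  · have gφ : PolyGrowth fun z : V => ∫ x, rad4 T.g (x + s • z + q) u ∂L := by
      refine .of_bound ?_ _ hφb
      refine continuous_of_dominated (bound := fun _ => 43 * M / ε ^ 4 * ‖u‖ ^ 4) (fun z => ?_)
        (fun z => .of_forall fun x => abs_rad4_le T hM0 hε hερ _ u) (integrable_const _)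
        (.of_forall fun x => ?_)
      · exact (continuous_rad4 T (by fun_prop) continuous_const).aestronglyMeasurable
      · exact continuous_rad4 T (by fun_prop) continuous_const
    refine abs_integral_multivariateGaussian_le hS hS1 gφ fun v => ?_
    have hsw : ∫ z, ∫ x, rad4 T.g (x + s • (z + v) + q) u ∂L ∂stdGaussian V =
        ∫ x, ∫ z, rad4 T.g (x + (s • v + q) + s • z) u ∂stdGaussian V ∂L := by
      rw [integral_integral_swap]
      · have e : ∀ x z : V, x + s • (z + v) + q = x + (s • v + q) + s • z := fun x z => by module
        simp only [e]
      · refine Integrable.of_bound (C := 43 * M / ε ^ 4 * ‖u‖ ^ 4)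
          (Continuous.aestronglyMeasurable ?_)
          (.of_forall fun p => abs_rad4_le T hM0 hε hερ _ u)
        exact continuous_rad4 T (by fun_prop) continuous_const
    rw [hsw]
    refine (abs_stdGaussian_integral_rad4_le T hM hε hερ hτ _ u hs).trans ?_
    rw [show 43 * M * τ / ε ^ 2 * ‖u‖ ^ 4 = 43 * (M / ε ^ 2 * τ * ‖u‖ ^ 4) by ring,
      show 10 * M / ε ^ 2 * τ * ‖u‖ ^ 4 = 10 * (M / ε ^ 2 * τ * ‖u‖ ^ 4) by ring]
    gcongr
    norm_num

end Averages

/-! ### Exchangeable pairs and the trapezoidal rule -/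

/-- The trapezoidal rule with its remainder in integral form. -/
theorem trapezoid_identity {f f₁ f₂ f₃ : ℝ → ℝ} (h₁ : ∀ t, HasDerivAt f (f₁ t) t)
    (h₂ : ∀ t, HasDerivAt f₁ (f₂ t) t) (h₃ : ∀ t, HasDerivAt f₂ (f₃ t) t) (hc : Continuous f₃) :
    f 1 - f 0 = (f₁ 0 + f₁ 1) / 2 - (∫ t in (0 : ℝ)..1, t * (1 - t) * f₃ t) / 2 := by
  have h : ∀ t ∈ Set.uIcc (0 : ℝ) 1,
      HasDerivAt (fun t => t * (1 - t) * f₂ t - (1 - 2 * t) * f₁ t - 2 * f t)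
        (t * (1 - t) * f₃ t) t := by
    intro t _
    have e1 : HasDerivAt (fun t : ℝ => t * (1 - t)) (1 - 2 * t) t :=
      ((hasDerivAt_id t).mul ((hasDerivAt_id t).const_sub 1)).congr_deriv (by simp; ring)
    have e2 : HasDerivAt (fun t : ℝ => 1 - 2 * t) (-2) t :=
      (((hasDerivAt_id t).const_mul 2).const_sub 1).congr_deriv (by simp)
    exact (((e1.mul (h₃ t)).sub (e2.mul (h₂ t))).sub ((h₁ t).const_mul 2)).congr_deriv (by ring)
  rw [intervalIntegral.integral_eq_sub_of_hasDerivAt h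
    (Continuous.intervalIntegrable (by fun_prop) _ _)]
  ring

section Exchange

variable {d : ℕ}

local notation "V" => EuclideanSpace ℝ (Fin d)

variable {ρ ε M : ℝ} (T : ShellStep ρ ε M)

theorem trapezoid_rad1 (y w : V) (c : ℝ) :
    rad1 T.g (y + c • w) w - rad1 T.g y w =
      c / 2 * (rad2 T.g y w w + rad2 T.g (y + c • w) w w) -
        c ^ 3 / 2 * ∫ t in (0 : ℝ)..1, t * (1 - t) * rad4 T.g (y + (t * c) • w) w := by
  have hc : ∀ {φ : ℝ → ℝ} {φ' t : ℝ}, HasDerivAt φ φ' (t * c) →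
      HasDerivAt (fun t => φ (t * c)) (φ' * c) t := by
    intro φ φ' t h
    have hl : HasDerivAt (fun t : ℝ => t * c) c t := by simpa using (hasDerivAt_id t).mul_const c
    exact HasDerivAt.comp t (h₂ := φ) h hl
  have h := trapezoid_identity (f := fun t => rad1 T.g (y + (t * c) • w) w)
    (f₁ := fun t => c * rad2 T.g (y + (t * c) • w) w w)
    (f₂ := fun t => c ^ 2 * rad3 T.g (y + (t * c) • w) w)
    (f₃ := fun t => c ^ 3 * rad4 T.g (y + (t * c) • w) w)
    (fun t => (hc (hasDerivAt_rad1 T y w w (t * c))).congr_deriv (by ring))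
    (fun t => ((hc (hasDerivAt_rad2 T y w (t * c))).const_mul c).congr_deriv (by ring))
    (fun t => ((hc (hasDerivAt_rad3 T y w (t * c))).const_mul (c ^ 2)).congr_deriv (by ring))
    (continuous_const.mul (continuous_rad4 T (by fun_prop) continuous_const))
  simp only [one_mul, zero_mul, zero_smul, add_zero] at h
  rw [h]
  have e : ∀ t : ℝ, t * (1 - t) * (c ^ 3 * rad4 T.g (y + (t * c) • w) w) =
      c ^ 3 * (t * (1 - t) * rad4 T.g (y + (t * c) • w) w) := fun t => by ring
  simp only [e, intervalIntegral.integral_const_mul]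
  ring

section Integrals

variable {L μ : Measure (EuclideanSpace ℝ (Fin d))} [IsProbabilityMeasure L] [IsProbabilityMeasure μ]

theorem integrable_of_growth_four (hμ : Integrable (fun x : V => ‖x‖ ^ 4) μ)
    {φ : V × V × V → ℝ} (hφ : Continuous φ) (K : ℝ)
    (h : ∀ p x x', |φ (p, x, x')| ≤ K * (1 + ‖x‖ ^ 4 + ‖x'‖ ^ 4)) :
    Integrable φ (L.prod (μ.prod μ)) := by
  have h1 : Integrable (fun q : V × V => 1 + ‖q.1‖ ^ 4 + ‖q.2‖ ^ 4) (μ.prod μ) :=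
    ((integrable_const 1).add (hμ.comp_fst μ)).add (hμ.comp_snd μ)
  exact ((h1.comp_snd L).const_mul K).mono' hφ.aestronglyMeasurable
    (.of_forall fun q => h q.1 q.2.1 q.2.2)

theorem integral_swap_pair {φ : V × V × V → ℝ} (hφ : Continuous φ) :
    ∫ q : V × V × V, φ (q.1, q.2.2, q.2.1) ∂L.prod (μ.prod μ) = ∫ q, φ q ∂L.prod (μ.prod μ) := by
  have mp : MeasurePreserving (Prod.map id Prod.swap) (L.prod (μ.prod μ)) (L.prod (μ.prod μ)) :=
    (MeasurePreserving.id L).prod Measure.measurePreserving_swap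
  conv_rhs => rw [← mp.map_eq]
  rw [integral_map mp.measurable.aemeasurable hφ.aestronglyMeasurable]
  rfl

/-- A function that is linear in the last variable has integral zero when this variable is
centered. -/
theorem integral_inner_centered (hμ1 : Integrable (fun x : V => x) μ) (h0 : ∫ x, x ∂μ = 0)
    {Y : V × V → V} {φ : V × V × V → ℝ} (hφ : Integrable φ (L.prod (μ.prod μ)))
    (h : ∀ p x x', φ (p, x, x') = ⟪Y (p, x), x'⟫) : ∫ q, φ q ∂L.prod (μ.prod μ) = 0 := by
  have mp := measurePreserving_prodAssoc L μ μ
  rw [← mp.map_eq, integral_map mp.measurable.aemeasurable (by rw [mp.map_eq]; exact hφ.1),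
    integral_prod]
  · have : ∀ q : V × V, ∫ x', φ (MeasurableEquiv.prodAssoc (q, x')) ∂μ = 0 := by
      intro q
      have e : ∀ x', φ (MeasurableEquiv.prodAssoc (q, x')) = ⟪Y q, x'⟫ := fun x' => h q.1 q.2 x'
      simp only [e]
      rw [integral_inner hμ1, h0, inner_zero_right]
    simp [this]
  · exact mp.integrable_comp_of_integrable hφ

theorem pow_le_one_add_pow_four {a : ℝ} (ha : 0 ≤ a) {k : ℕ} (hk : k ≤ 4) : a ^ k ≤ 1 + a ^ 4 := by
  rcases le_total a 1 with h | h
  · have := pow_le_one₀ ha h (n := k)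
    have := pow_nonneg ha 4
    linarith
  · have := pow_le_pow_right₀ h hk
    linarith

theorem integral_norm_sub_pow_four_le (hμ : Integrable (fun x : V => ‖x‖ ^ 4) μ) :
    ∫ q : V × V, ‖q.1 - q.2‖ ^ 4 ∂μ.prod μ ≤ 16 * ∫ x, ‖x‖ ^ 4 ∂μ := by
  have h1 := hμ.comp_fst μ
  have h2 := hμ.comp_snd μ
  calc ∫ q : V × V, ‖q.1 - q.2‖ ^ 4 ∂μ.prod μ
      ≤ ∫ q : V × V, (8 * ‖q.1‖ ^ 4 + 8 * ‖q.2‖ ^ 4) ∂μ.prod μ := by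
        refine integral_mono_of_nonneg (.of_forall fun _ => by positivity)
          ((h1.const_mul 8).add (h2.const_mul 8)) (.of_forall fun q => ?_)
        have h3 := norm_sub_le q.1 q.2
        have h4 : ‖q.1 - q.2‖ ^ 4 ≤ (‖q.1‖ + ‖q.2‖) ^ 4 := by gcongr
        have h5 := add_pow_le (norm_nonneg q.1) (norm_nonneg q.2) 4
        simp only []
        norm_num at h5
        linarith
    _ = 16 * ∫ x, ‖x‖ ^ 4 ∂μ := by
        rw [integral_add (h1.const_mul 8) (h2.const_mul 8), integral_const_mul, integral_const_mul,
          integral_fun_fst (fun x : V => ‖x‖ ^ 4), integral_fun_snd (fun x : V => ‖x‖ ^ 4)]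
        simp
        ring

/-- The remainder of the trapezoidal rule, averaged over `p` with law `L` and over an independent pair
`x`, `x'` with law `μ`: the average over `p` is taken first, where `hB` applies. -/
theorem abs_integral_trapezoid_remainder_le (hM : 0 ≤ M) (hε : 0 < ε) (hερ : ε ≤ ρ)
    (hμ : Integrable (fun x : V => ‖x‖ ^ 4) μ) {B : ℝ}
    (hB : ∀ q u : V, |∫ p, rad4 T.g (p + q) u ∂L| ≤ B * ‖u‖ ^ 4) (c : ℝ) :
    |∫ q : V × V × V, (∫ t in (0 : ℝ)..1, t * (1 - t) *
      rad4 T.g (q.1 + c • q.2.2 + (t * c) • (q.2.1 - q.2.2)) (q.2.1 - q.2.2))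
        ∂L.prod (μ.prod μ)| ≤ 16 * B * ∫ x, ‖x‖ ^ 4 ∂μ := by
  set K := 43 * M / ε ^ 4 with hK
  have hK0 : 0 ≤ K := by positivity
  have hb4 : ∀ y u : V, |rad4 T.g y u| ≤ K * ‖u‖ ^ 4 := abs_rad4_le T hM hε hερ
  have hkt : ∀ t ∈ Set.Ioc (0 : ℝ) 1, |t * (1 - t)| ≤ 1 := by
    intro t ht
    rw [abs_of_nonneg (mul_nonneg ht.1.le (by linarith [ht.2]))]
    nlinarith [ht.1, ht.2]
  -- for fixed `x`, `x'` the integrals over `p` and `t` are interchanged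
  have hp : ∀ q : V × V, |∫ p, (∫ t in (0 : ℝ)..1, t * (1 - t) *
      rad4 T.g (p + c • q.2 + (t * c) • (q.1 - q.2)) (q.1 - q.2)) ∂L| ≤
        B * ‖q.1 - q.2‖ ^ 4 := by
    intro q
    simp only [intervalIntegral.integral_of_le zero_le_one]
    rw [integral_integral_swap]
    · have h1 : ∀ t ∈ Set.Ioc (0 : ℝ) 1, ‖∫ p, t * (1 - t) *
          rad4 T.g (p + c • q.2 + (t * c) • (q.1 - q.2)) (q.1 - q.2) ∂L‖ ≤
            B * ‖q.1 - q.2‖ ^ 4 := by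
        intro t ht
        rw [integral_const_mul, norm_mul]
        simp only [add_assoc]
        have h2 := hB (c • q.2 + (t * c) • (q.1 - q.2)) (q.1 - q.2)
        calc _ ≤ 1 * |∫ p, rad4 T.g (p + (c • q.2 + (t * c) • (q.1 - q.2))) (q.1 - q.2) ∂L| := by
              gcongr
              · exact hkt t ht
              · exact le_rfl
          _ ≤ _ := by rw [one_mul]; exact h2
      have := norm_setIntegral_le_of_norm_le_const (μ := volume) (by simp) h1
      simpa using this
    · have hc : Continuous fun p : V × ℝ => p.2 * (1 - p.2) *
          rad4 T.g (p.1 + c • q.2 + (p.2 * c) • (q.1 - q.2)) (q.1 - q.2) :=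
        (by fun_prop : Continuous fun p : V × ℝ => p.2 * (1 - p.2)).mul
          (continuous_rad4 T (by fun_prop) continuous_const)
      have hr : L.prod (volume.restrict (Set.Ioc (0 : ℝ) 1)) =
          (L.prod volume).restrict (Set.univ ×ˢ Set.Ioc (0 : ℝ) 1) := by
        rw [← Measure.prod_restrict, Measure.restrict_univ]
      refine Integrable.of_bound hc.aestronglyMeasurable (K * ‖q.1 - q.2‖ ^ 4) ?_
      rw [hr]
      filter_upwards [ae_restrict_mem (MeasurableSet.univ.prod measurableSet_Ioc)] with p hp
      rw [Function.uncurry, norm_mul]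
      calc _ ≤ 1 * (K * ‖q.1 - q.2‖ ^ 4) := by
            gcongr
            · exact hkt _ hp.2
            · exact hb4 _ _
        _ = _ := one_mul _
  have hc : Continuous fun q : V × V × V => ∫ t in (0 : ℝ)..1, t * (1 - t) *
      rad4 T.g (q.1 + c • q.2.2 + (t * c) • (q.2.1 - q.2.2)) (q.2.1 - q.2.2) := by
    refine intervalIntegral.continuous_parametric_intervalIntegral_of_continuous' ?_ 0 1
    exact (by fun_prop : Continuous fun p : (V × V × V) × ℝ => p.2 * (1 - p.2)).mul
      (continuous_rad4 T (by fun_prop) (by fun_prop))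
  have hint : Integrable (fun q : V × V × V => ∫ t in (0 : ℝ)..1, t * (1 - t) *
      rad4 T.g (q.1 + c • q.2.2 + (t * c) • (q.2.1 - q.2.2)) (q.2.1 - q.2.2))
        (L.prod (μ.prod μ)) := by
    refine integrable_of_growth_four hμ hc (8 * K) fun p x x' => ?_
    have h1 := intervalIntegral.norm_integral_le_of_norm_le_const (a := (0 : ℝ)) (b := 1)
      (f := fun t => t * (1 - t) * rad4 T.g (p + c • x' + (t * c) • (x - x')) (x - x'))
      (C := K * ‖x - x'‖ ^ 4) (fun t ht => by
        rw [Set.uIoc_of_le zero_le_one] at ht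
        rw [norm_mul]
        calc _ ≤ 1 * (K * ‖x - x'‖ ^ 4) := by
              gcongr
              · exact hkt t ht
              · exact hb4 _ _
          _ = _ := one_mul _)
    simp only [sub_zero, abs_one, mul_one, Real.norm_eq_abs] at h1
    refine h1.trans ?_
    have h3 := norm_sub_le x x'
    have h4 : ‖x - x'‖ ^ 4 ≤ (‖x‖ + ‖x'‖) ^ 4 := by gcongr
    have h5 := add_pow_le (norm_nonneg x) (norm_nonneg x') 4
    norm_num at h5
    calc K * ‖x - x'‖ ^ 4 ≤ K * (8 * (1 + ‖x‖ ^ 4 + ‖x'‖ ^ 4)) := by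
          gcongr; linarith
      _ = _ := by ring
  -- `hB` forces `B ≥ 0`, except in dimension zero
  have hB0 : 0 ≤ B ∨ ∀ u : V, ‖u‖ = 0 := by
    by_contra! h
    obtain ⟨hB1, u, hu⟩ := h
    have h1 := (abs_nonneg _).trans (hB 0 u)
    have h2 : 0 < ‖u‖ ^ 4 := by positivity
    nlinarith
  rw [integral_prod_symm _ hint]
  have hsub : Integrable (fun q : V × V => ‖q.1 - q.2‖ ^ 4) (μ.prod μ) := by
    have := (integrable_of_growth_four (L := L) hμ
      (φ := fun q => ‖q.2.1 - q.2.2‖ ^ 4) (by fun_prop) 8 fun p x x' => by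
        have h3 := norm_sub_le x x'
        have h4 : ‖x - x'‖ ^ 4 ≤ (‖x‖ + ‖x'‖) ^ 4 := by gcongr
        have h5 := add_pow_le (norm_nonneg x) (norm_nonneg x') 4
        norm_num at h5
        rw [abs_of_nonneg (by positivity)]
        linarith)
    simpa using this.integral_prod_right
  calc _ ≤ ∫ q : V × V, B * ‖q.1 - q.2‖ ^ 4 ∂μ.prod μ := by
        refine abs_integral_le_integral_abs.trans (integral_mono_of_nonneg
          (.of_forall fun _ => abs_nonneg _) (hsub.const_mul B) (.of_forall fun q => hp q))
    _ = B * ∫ q : V × V, ‖q.1 - q.2‖ ^ 4 ∂μ.prod μ := integral_const_mul _ _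
    _ ≤ 16 * B * ∫ x, ‖x‖ ^ 4 ∂μ := by
        rcases hB0 with hB0 | hB0
        · have := mul_le_mul_of_nonneg_left (integral_norm_sub_pow_four_le hμ) hB0
          linarith
        · simp [hB0]

/-- The matrix of second moments of a law, which is its covariance matrix if the law is centered. -/
noncomputable def secondMoment (μ : Measure V) : Matrix (Fin d) (Fin d) ℝ :=
  Matrix.of fun i j => ∫ x, x i * x j ∂μ

theorem integrable_norm_of_pow_four (hμ : Integrable (fun x : V => ‖x‖ ^ 4) μ) {k : ℕ}
    (hk : k ≤ 4) : Integrable (fun x : V => ‖x‖ ^ k) μ := by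
  refine ((integrable_const (1 : ℝ)).add hμ).mono' (by fun_prop) (.of_forall fun x => ?_)
  rw [Real.norm_of_nonneg (by positivity)]
  exact pow_le_one_add_pow_four (norm_nonneg x) hk

theorem integrable_apply_mul_apply (hμ : Integrable (fun x : V => ‖x‖ ^ 4) μ) (i j : Fin d) :
    Integrable (fun x : V => x i * x j) μ := by
  refine (integrable_norm_of_pow_four hμ (k := 2) (by norm_num)).mono'
    (Continuous.aestronglyMeasurable (by fun_prop)) (.of_forall fun x => ?_)
  rw [norm_mul, pow_two]
  exact mul_le_mul (PiLp.norm_apply_le x i) (PiLp.norm_apply_le x j) (norm_nonneg _) (norm_nonneg _)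

theorem integral_rad2_diag (hμ : Integrable (fun x : V => ‖x‖ ^ 4) μ) (g : ℕ → ℝ → ℝ) (y : V) :
    ∫ x, rad2 g y x x ∂μ = ∑ i, ∑ j, secondMoment μ i j * radHess g y i j := by
  simp_rw [rad2_eq_sum g y]
  rw [integral_sum_sum (fun i j (x : V) => x i * x j * radHess g y i j) fun i j =>
    (integrable_apply_mul_apply hμ i j).mul_const _]
  refine Finset.sum_congr rfl fun i _ => Finset.sum_congr rfl fun j _ => ?_
  rw [integral_mul_const, secondMoment, Matrix.of_apply]

/-- The approximate Stein identity. If `p` and `x` are independent and `x` is centered, then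
`E ⟨x, ∇h(p + c x)⟩` is `c / 2` times the mean pairing of the Hessian with `x xᵀ + E x xᵀ`, up to a
term of fourth order: the difference of `∇h` at `p + c x` and at `p + c x'`, for an independent copy
`x'` of `x`, is evaluated by the trapezoidal rule, and exchangeability removes the third moments. -/
theorem abs_integral_rad1_sub_le (hM : 0 ≤ M) (hε : 0 < ε) (hερ : ε ≤ ρ)
    (hμ : Integrable (fun x : V => ‖x‖ ^ 4) μ) (h0 : ∫ x, x ∂μ = 0) {B : ℝ}
    (hB : ∀ q u : V, |∫ p, rad4 T.g (p + q) u ∂L| ≤ B * ‖u‖ ^ 4) {c : ℝ} (hc : 0 ≤ c) :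
    |∫ q : V × V, rad1 T.g (q.1 + c • q.2) q.2 ∂L.prod μ -
      c / 2 * ∫ q : V × V, ∑ i, ∑ j, (q.2 i * q.2 j + secondMoment μ i j) *
        radHess T.g (q.1 + c • q.2) i j ∂L.prod μ| ≤ 4 * c ^ 3 * B * ∫ x, ‖x‖ ^ 4 ∂μ := by
  set κ := L.prod (μ.prod μ) with hκ
  have hμ1 : Integrable (fun x : V => x) μ := by
    refine (integrable_norm_iff (by fun_prop)).1 ?_
    simpa using integrable_norm_of_pow_four hμ (k := 1) (by norm_num)
  set K₁ := 2 * M / ε with hK₁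
  set K₂ := 5 * M / ε ^ 2 with hK₂
  have hK₁0 : 0 ≤ K₁ := by positivity
  have hK₂0 : 0 ≤ K₂ := by positivity
  have hb1 : ∀ y u : V, |rad1 T.g y u| ≤ K₁ * ‖u‖ := abs_rad1_le T hM hε hερ
  have hb2 : ∀ y u v : V, |rad2 T.g y u v| ≤ K₂ * (‖u‖ * ‖v‖) := abs_rad2_le T hM hε hερ
  -- integrability of all the terms
  have i1 : ∀ {f u : V × V × V → V}, Continuous f → Continuous u →
      (∀ q, ‖u q‖ ≤ ‖q.2.1‖ + ‖q.2.2‖) → Integrable (fun q => rad1 T.g (f q) (u q)) κ := by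
    intro f u hf hu h
    refine integrable_of_growth_four hμ (continuous_rad1 T hf hu) (2 * K₁) fun p x x' => ?_
    have h1 := pow_le_one_add_pow_four (norm_nonneg x) (k := 1) (by norm_num)
    have h2 := pow_le_one_add_pow_four (norm_nonneg x') (k := 1) (by norm_num)
    have h3 := h (p, x, x')
    simp only [pow_one] at h1 h2 h3
    calc _ ≤ K₁ * ‖u (p, x, x')‖ := hb1 _ _
      _ ≤ K₁ * (2 * (1 + ‖x‖ ^ 4 + ‖x'‖ ^ 4)) := by
        gcongr
        have := pow_nonneg (norm_nonneg x) 4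
        have := pow_nonneg (norm_nonneg x') 4
        linarith
      _ = _ := by ring
  have i2 : ∀ {f u v : V × V × V → V}, Continuous f → Continuous u → Continuous v →
      (∀ q, ‖u q‖ ≤ ‖q.2.1‖ + ‖q.2.2‖) → (∀ q, ‖v q‖ ≤ ‖q.2.1‖ + ‖q.2.2‖) →
      Integrable (fun q => rad2 T.g (f q) (u q) (v q)) κ := by
    intro f u v hf hu hv h h'
    refine integrable_of_growth_four hμ (continuous_rad2 T hf hu hv) (4 * K₂) fun p x x' => ?_
    have h1 := pow_le_one_add_pow_four (norm_nonneg x) (k := 2) (by norm_num)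
    have h2 := pow_le_one_add_pow_four (norm_nonneg x') (k := 2) (by norm_num)
    have h3 := h (p, x, x')
    have h4 := h' (p, x, x')
    simp only [] at h3 h4
    calc _ ≤ K₂ * (‖u (p, x, x')‖ * ‖v (p, x, x')‖) := hb2 _ _ _
      _ ≤ K₂ * ((‖x‖ + ‖x'‖) * (‖x‖ + ‖x'‖)) := by gcongr
      _ ≤ K₂ * (4 * (1 + ‖x‖ ^ 4 + ‖x'‖ ^ 4)) := by
        refine mul_le_mul_of_nonneg_left ?_ hK₂0
        have := pow_nonneg (norm_nonneg x) 4
        have := pow_nonneg (norm_nonneg x') 4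
        nlinarith [sq_nonneg (‖x‖ - ‖x'‖)]
      _ = _ := by ring
  have nx : ∀ q : V × V × V, ‖q.2.1‖ ≤ ‖q.2.1‖ + ‖q.2.2‖ := fun q => by simp
  have nx' : ∀ q : V × V × V, ‖q.2.2‖ ≤ ‖q.2.1‖ + ‖q.2.2‖ := fun q => by simp
  have nw : ∀ q : V × V × V, ‖q.2.1 - q.2.2‖ ≤ ‖q.2.1‖ + ‖q.2.2‖ := fun q => norm_sub_le _ _
  set J := ∫ q : V × V × V, rad1 T.g (q.1 + c • q.2.1) q.2.1 ∂κ with hJ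
  -- the two first-order terms
  have hA0 : ∫ q : V × V × V, rad1 T.g (q.1 + c • q.2.1) q.2.2 ∂κ = 0 :=
    integral_inner_centered hμ1 h0 (i1 (by fun_prop) (by fun_prop) nx')
      (Y := fun q => (2 * T.g 1 (‖q.1 + c • q.2‖ ^ 2)) • (q.1 + c • q.2)) fun p x x' => by
        rw [rad1, real_inner_smul_left]
  have hA1 : ∫ q : V × V × V, rad1 T.g (q.1 + c • q.2.1) (q.2.1 - q.2.2) ∂κ = J := by
    have e : ∀ q : V × V × V, rad1 T.g (q.1 + c • q.2.1) (q.2.1 - q.2.2) =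
        rad1 T.g (q.1 + c • q.2.1) q.2.1 - rad1 T.g (q.1 + c • q.2.1) q.2.2 := by
      intro q; simp only [rad1, inner_sub_right]; ring
    simp_rw [e]
    rw [integral_sub (i1 (by fun_prop) (by fun_prop) nx) (i1 (by fun_prop) (by fun_prop) nx'), hA0,
      sub_zero]
  have hA2 : ∫ q : V × V × V, rad1 T.g (q.1 + c • q.2.2) (q.2.1 - q.2.2) ∂κ = -J := by
    have := integral_swap_pair (L := L) (μ := μ)
      (φ := fun q => rad1 T.g (q.1 + c • q.2.1) (q.2.2 - q.2.1))
      (continuous_rad1 T (by fun_prop) (by fun_prop))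
    rw [← hκ] at this
    simp only [] at this
    rw [this, ← hA1, ← integral_neg]
    congr 1; ext q
    simp only [rad1, inner_sub_right]; ring
  -- the second-order terms
  have hQ0 : ∫ q : V × V × V, rad2 T.g (q.1 + c • q.2.1) q.2.1 q.2.2 ∂κ = 0 :=
    integral_inner_centered hμ1 h0 (i2 (by fun_prop) (by fun_prop) (by fun_prop) nx nx')
      (Y := fun q => (4 * T.g 2 (‖q.1 + c • q.2‖ ^ 2) * ⟪q.1 + c • q.2, q.2⟫) • (q.1 + c • q.2) +
        (2 * T.g 1 (‖q.1 + c • q.2‖ ^ 2)) • q.2) fun p x x' => by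
        conv_rhs => rw [inner_add_left, real_inner_smul_left, real_inner_smul_left]
        simp only [rad2]
        ring
  set Q := ∫ q : V × V × V, rad2 T.g (q.1 + c • q.2.1) (q.2.1 - q.2.2) (q.2.1 - q.2.2) ∂κ with hQ
  have hQ2 : ∫ q : V × V × V, rad2 T.g (q.1 + c • q.2.2) (q.2.1 - q.2.2) (q.2.1 - q.2.2) ∂κ = Q := by
    have := integral_swap_pair (L := L) (μ := μ)
      (φ := fun q => rad2 T.g (q.1 + c • q.2.1) (q.2.2 - q.2.1) (q.2.2 - q.2.1))
      (continuous_rad2 T (by fun_prop) (by fun_prop) (by fun_prop))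
    rw [← hκ] at this
    simp only [] at this
    rw [this, hQ]
    congr 1; ext q
    simp only [rad2, inner_sub_right, inner_sub_left]; ring
  have hd12 : Integrable (fun q : V × V × V => rad2 T.g (q.1 + c • q.2.1) q.2.1 q.2.1 +
      rad2 T.g (q.1 + c • q.2.1) q.2.2 q.2.2) κ :=
    (i2 (f := fun q => q.1 + c • q.2.1) (by fun_prop) (by fun_prop) (by fun_prop) nx nx).add
      (i2 (by fun_prop) (by fun_prop) (by fun_prop) nx' nx')
  have hQ1 : Q = ∫ q : V × V × V, (rad2 T.g (q.1 + c • q.2.1) q.2.1 q.2.1 +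
      rad2 T.g (q.1 + c • q.2.1) q.2.2 q.2.2) ∂κ := by
    have e : ∀ q : V × V × V, rad2 T.g (q.1 + c • q.2.1) (q.2.1 - q.2.2) (q.2.1 - q.2.2) =
        (rad2 T.g (q.1 + c • q.2.1) q.2.1 q.2.1 + rad2 T.g (q.1 + c • q.2.1) q.2.2 q.2.2) -
          2 * rad2 T.g (q.1 + c • q.2.1) q.2.1 q.2.2 := by
      intro q
      simp only [rad2, inner_sub_right, inner_sub_left, real_inner_comm q.2.1 q.2.2]
      ring
    rw [hQ]
    simp_rw [e]
    rw [integral_sub hd12 ((i2 (by fun_prop) (by fun_prop) (by fun_prop) nx nx').const_mul 2),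
      integral_const_mul, hQ0]
    simp
  -- assembling the trapezoidal rule
  set R := ∫ q : V × V × V, (∫ t in (0 : ℝ)..1, t * (1 - t) *
      rad4 T.g (q.1 + c • q.2.2 + (t * c) • (q.2.1 - q.2.2)) (q.2.1 - q.2.2)) ∂κ with hR
  have hRle : |R| ≤ 16 * B * ∫ x, ‖x‖ ^ 4 ∂μ :=
    abs_integral_trapezoid_remainder_le T hM hε hερ hμ hB c
  have hpt : ∀ q : V × V × V, c ^ 3 / 2 * (∫ t in (0 : ℝ)..1, t * (1 - t) *
      rad4 T.g (q.1 + c • q.2.2 + (t * c) • (q.2.1 - q.2.2)) (q.2.1 - q.2.2)) =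
      c / 2 * (rad2 T.g (q.1 + c • q.2.2) (q.2.1 - q.2.2) (q.2.1 - q.2.2) +
        rad2 T.g (q.1 + c • q.2.1) (q.2.1 - q.2.2) (q.2.1 - q.2.2)) -
      (rad1 T.g (q.1 + c • q.2.1) (q.2.1 - q.2.2) - rad1 T.g (q.1 + c • q.2.2) (q.2.1 - q.2.2)) := by
    intro q
    have h := trapezoid_rad1 T (q.1 + c • q.2.2) (q.2.1 - q.2.2) c
    have e : q.1 + c • q.2.2 + c • (q.2.1 - q.2.2) = q.1 + c • q.2.1 := by module
    rw [e] at h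
    linarith
  have hident : c ^ 3 / 2 * R = c * Q - 2 * J := by
    rw [hR, ← integral_const_mul]
    simp_rw [hpt]
    have j1 := i2 (f := fun q => q.1 + c • q.2.2) (by fun_prop) (by fun_prop) (by fun_prop) nw nw
    have j2 := i2 (f := fun q => q.1 + c • q.2.1) (by fun_prop) (by fun_prop) (by fun_prop) nw nw
    have j3 := i1 (f := fun q => q.1 + c • q.2.1) (by fun_prop) (by fun_prop) nw
    have j4 := i1 (f := fun q => q.1 + c • q.2.2) (by fun_prop) (by fun_prop) nw
    have j5 : Integrable (fun q : V × V × V => c / 2 *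
        (rad2 T.g (q.1 + c • q.2.2) (q.2.1 - q.2.2) (q.2.1 - q.2.2) +
          rad2 T.g (q.1 + c • q.2.1) (q.2.1 - q.2.2) (q.2.1 - q.2.2))) κ :=
      (j1.add j2).const_mul _
    have j6 : Integrable (fun q : V × V × V => rad1 T.g (q.1 + c • q.2.1) (q.2.1 - q.2.2) -
        rad1 T.g (q.1 + c • q.2.2) (q.2.1 - q.2.2)) κ := j3.sub j4
    rw [integral_sub j5 j6, integral_const_mul, integral_add j1 j2, integral_sub j3 j4, hQ2, ← hQ,
      hA1, hA2]
    ring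
  -- rewriting in terms of the pair `(p, x)`
  have mp := measurePreserving_prodAssoc L μ μ
  have hred : ∀ {φ : V × V × V → ℝ}, Integrable φ κ →
      ∫ q, φ q ∂κ = ∫ q : V × V, ∫ x', φ (q.1, q.2, x') ∂μ ∂L.prod μ := by
    intro φ hφ
    rw [hκ] at hφ ⊢
    rw [← mp.map_eq, integral_map mp.measurable.aemeasurable (by rw [mp.map_eq]; exact hφ.1),
      integral_prod]
    · rfl
    · exact mp.integrable_comp_of_integrable hφ
  have hJ' : J = ∫ q : V × V, rad1 T.g (q.1 + c • q.2) q.2 ∂L.prod μ := by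
    rw [hJ, hred (i1 (by fun_prop) (by fun_prop) nx)]
    simp
  have hQ' : Q = ∫ q : V × V, ∑ i, ∑ j, (q.2 i * q.2 j + secondMoment μ i j) *
        radHess T.g (q.1 + c • q.2) i j ∂L.prod μ := by
    rw [hQ1, hred hd12]
    congr 1; ext q
    dsimp only
    rw [integral_add (integrable_const _), integral_rad2_diag hμ]
    · simp only [integral_const, probReal_univ, one_smul]
      rw [rad2_eq_sum]
      simp only [add_mul, Finset.sum_add_distrib]
    · refine ((integrable_norm_of_pow_four hμ (k := 2) (by norm_num)).const_mul K₂).mono'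
        (continuous_rad2 T continuous_const continuous_id continuous_id).aestronglyMeasurable
        (.of_forall fun x => ?_)
      rw [pow_two ‖x‖]
      exact hb2 _ _ _
  rw [← hJ', ← hQ', show J - c / 2 * Q = -(c ^ 3 / 4 * R) by linarith, abs_neg, abs_mul,
    abs_of_nonneg (by positivity)]
  calc c ^ 3 / 4 * |R| ≤ c ^ 3 / 4 * (16 * B * ∫ x, ‖x‖ ^ 4 ∂μ) := by gcongr
    _ = _ := by ring

end Integrals

end Exchange

/-! ### Sums of independent centered vectors: second moments -/

/-- Measurable, independent and centered random vectors with finite fourth moments. -/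
structure IndepSummands {Ω ι : Type*} [MeasurableSpace Ω] {d : ℕ}
    (ξ : ι → Ω → EuclideanSpace ℝ (Fin d)) (P : Measure Ω) : Prop where
  measurable : ∀ k, Measurable (ξ k)
  indep : iIndepFun ξ P
  integrable_four : ∀ k, Integrable (fun ω => ‖ξ k ω‖ ^ 4) P
  integral_eq_zero : ∀ k, ∫ ω, ξ k ω ∂P = 0

section Moments

variable {Ω ι : Type*} [MeasurableSpace Ω] {d : ℕ} {P : Measure Ω}
  {ξ : ι → Ω → EuclideanSpace ℝ (Fin d)}

local notation "V" => EuclideanSpace ℝ (Fin d)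

/-- The sum of the fourth moments of the summands indexed by `s`. -/
noncomputable def sumFourth (P : Measure Ω) (ξ : ι → Ω → EuclideanSpace ℝ (Fin d))
    (s : Finset ι) : ℝ :=
  ∑ k ∈ s, ∫ ω, ‖ξ k ω‖ ^ 4 ∂P

/-- The sum of the covariance matrices of the centered summands indexed by `s`. -/
noncomputable def sumCov (P : Measure Ω) (ξ : ι → Ω → EuclideanSpace ℝ (Fin d))
    (s : Finset ι) : Matrix (Fin d) (Fin d) ℝ :=
  ∑ k ∈ s, secondMoment (P.map (ξ k))

/-- Half the sum of `ξ_k ξ_kᵀ + E ξ_k ξ_kᵀ` over `k ∈ s`: the random matrix that the exchangeable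
pair method produces in place of the covariance matrix of the sum. -/
noncomputable def sumHalf (P : Measure Ω) (ξ : ι → Ω → EuclideanSpace ℝ (Fin d))
    (s : Finset ι) (ω : Ω) : Matrix (Fin d) (Fin d) ℝ :=
  Matrix.of fun i j => ∑ k ∈ s, 2⁻¹ * (ξ k ω i * ξ k ω j + secondMoment (P.map (ξ k)) i j)

theorem sumFourth_nonneg (s : Finset ι) : 0 ≤ sumFourth P ξ s :=
  Finset.sum_nonneg fun _ _ => integral_nonneg fun _ => by positivity

theorem norm_pow_four_eq_sum (x : V) : ‖x‖ ^ 4 = ∑ i, ∑ j, (x i * x j) ^ 2 := by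
  rw [show ‖x‖ ^ 4 = ‖x‖ ^ 2 * ‖x‖ ^ 2 by ring, EuclideanSpace.real_norm_sq_eq, Finset.sum_mul_sum]
  simp only [mul_pow]

namespace IndepSummands

theorem integrable_map (H : IndepSummands ξ P) (k : ι) : Integrable (fun x : V => ‖x‖ ^ 4) (P.map (ξ k)) :=
  (integrable_map_measure (by fun_prop) (H.measurable k).aemeasurable).2 (H.integrable_four k)

theorem secondMoment_apply (H : IndepSummands ξ P) (k : ι) (i j : Fin d) :
    secondMoment (P.map (ξ k)) i j = ∫ ω, ξ k ω i * ξ k ω j ∂P := by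
  rw [secondMoment, Matrix.of_apply, integral_map (H.measurable k).aemeasurable
    (Continuous.aestronglyMeasurable (by fun_prop))]

theorem memLp_apply_mul_apply (H : IndepSummands ξ P) (k : ι) (i j : Fin d) :
    MemLp (fun ω => ξ k ω i * ξ k ω j) 2 P := by
  have hm := H.measurable k
  rw [memLp_two_iff_integrable_sq (by fun_prop)]
  refine (H.integrable_four k).mono' (by fun_prop) (.of_forall fun ω => ?_)
  rw [Real.norm_of_nonneg (by positivity), norm_pow_four_eq_sum]
  exact (Finset.single_le_sum (f := fun j => (ξ k ω i * ξ k ω j) ^ 2)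
    (fun _ _ => by positivity) (Finset.mem_univ j)).trans
    (Finset.single_le_sum (f := fun i => ∑ j, (ξ k ω i * ξ k ω j) ^ 2)
    (fun _ _ => by positivity) (Finset.mem_univ i))

theorem measurable_sumHalf (H : IndepSummands ξ P) (s : Finset ι) (i j : Fin d) :
    Measurable fun ω => sumHalf P ξ s ω i j := by
  simp only [sumHalf, Matrix.of_apply]
  refine Finset.measurable_sum _ fun k _ => ?_
  have := H.measurable k
  fun_prop

theorem sum_integral_sq (H : IndepSummands ξ P) (s : Finset ι) :
    ∑ i, ∑ j, ∑ k ∈ s, ∫ ω, (ξ k ω i * ξ k ω j) ^ 2 ∂P = sumFourth P ξ s := by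
  have e : ∀ i : Fin d, ∑ j, ∑ k ∈ s, ∫ ω, (ξ k ω i * ξ k ω j) ^ 2 ∂P =
      ∑ k ∈ s, ∑ j, ∫ ω, (ξ k ω i * ξ k ω j) ^ 2 ∂P := fun i => Finset.sum_comm
  simp_rw [e]
  rw [Finset.sum_comm, sumFourth]
  refine Finset.sum_congr rfl fun k _ => ?_
  simp_rw [norm_pow_four_eq_sum]
  exact (integral_sum_sum (fun i j ω => (ξ k ω i * ξ k ω j) ^ 2) fun i j =>
    (H.memLp_apply_mul_apply k i j).integrable_sq).symm

variable [IsProbabilityMeasure P]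

theorem integrable_norm_pow (H : IndepSummands ξ P) (k : ι) {m : ℕ} (hm : m ≤ 4) :
    Integrable (fun ω => ‖ξ k ω‖ ^ m) P := by
  have := Measure.isProbabilityMeasure_map (μ := P) (H.measurable k).aemeasurable
  exact (integrable_map_measure (by fun_prop) (H.measurable k).aemeasurable).1
    (integrable_norm_of_pow_four (H.integrable_map k) hm)

theorem integrable_apply_mul_apply (H : IndepSummands ξ P) (k : ι) (i j : Fin d) :
    Integrable (fun ω => ξ k ω i * ξ k ω j) P :=
  (H.memLp_apply_mul_apply k i j).integrable (by norm_num)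

theorem integral_sum_sq_le (H : IndepSummands ξ P) (s : Finset ι) (i j : Fin d) :
    ∫ ω, (∑ k ∈ s, (ξ k ω i * ξ k ω j - secondMoment (P.map (ξ k)) i j)) ^ 2 ∂P ≤
      ∑ k ∈ s, ∫ ω, (ξ k ω i * ξ k ω j) ^ 2 ∂P := by
  set X : ι → Ω → ℝ := fun k ω => ξ k ω i * ξ k ω j with hX
  have hvar : variance (∑ k ∈ s, X k) P = ∑ k ∈ s, variance (X k) P :=
    IndepFun.variance_sum (fun k _ => H.memLp_apply_mul_apply k i j) fun k _ l _ hkl =>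
      (H.indep.indepFun hkl).comp (φ := fun x : V => x i * x j) (ψ := fun x : V => x i * x j)
        (Measurable.mul (by fun_prop) (by fun_prop)) (Measurable.mul (by fun_prop) (by fun_prop))
  have hmean : ∫ ω, (∑ k ∈ s, X k) ω ∂P = ∑ k ∈ s, secondMoment (P.map (ξ k)) i j := by
    simp only [Finset.sum_apply]
    rw [integral_finsetSum _ fun k _ => H.integrable_apply_mul_apply k i j]
    exact Finset.sum_congr rfl fun k _ => (H.secondMoment_apply k i j).symm
  rw [variance_eq_integral, hmean] at hvar
  · have e : ∀ ω, (∑ k ∈ s, (ξ k ω i * ξ k ω j - secondMoment (P.map (ξ k)) i j)) ^ 2 =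
        ((∑ k ∈ s, X k) ω - ∑ k ∈ s, secondMoment (P.map (ξ k)) i j) ^ 2 := by
      intro ω
      rw [Finset.sum_sub_distrib, Finset.sum_apply]
    simp_rw [e]
    rw [hvar]
    refine Finset.sum_le_sum fun k _ => ?_
    exact variance_le_expectation_sq (H.memLp_apply_mul_apply k i j).1
  · exact (memLp_finsetSum' s fun k _ => H.memLp_apply_mul_apply k i j).1.aemeasurable

theorem memLp_sum_sub (H : IndepSummands ξ P) (s : Finset ι) (i j : Fin d) :
    MemLp (fun ω => ∑ k ∈ s, (ξ k ω i * ξ k ω j - secondMoment (P.map (ξ k)) i j)) 2 P :=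
  memLp_finsetSum s fun k _ => (H.memLp_apply_mul_apply k i j).sub (memLp_const _)

/-- The random matrix `sumHalf` is close to the matrix `S` as soon as the covariance matrix of the
sum is and the fourth moments are small: its entries are sums of independent terms. -/
theorem integral_matHSNorm_sub_sumHalf_le (H : IndepSummands ξ P)
    (S : Matrix (Fin d) (Fin d) ℝ) (s : Finset ι) :
    Integrable (fun ω => matHSNorm (S - sumHalf P ξ s ω)) P ∧
    ∫ ω, matHSNorm (S - sumHalf P ξ s ω) ∂P ≤
      matHSNorm (S - sumCov P ξ s) + Real.sqrt (sumFourth P ξ s) := by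
  set D : Ω → Matrix (Fin d) (Fin d) ℝ := fun ω => Matrix.of fun i j =>
    ∑ k ∈ s, (ξ k ω i * ξ k ω j - secondMoment (P.map (ξ k)) i j) with hD
  have hDm : ∀ i j, MemLp (fun ω => D ω i j) 2 P := fun i j => H.memLp_sum_sub s i j
  have hfm : AEStronglyMeasurable (fun ω => matHSNorm (D ω)) P := by
    simp_rw [matHSNorm_eq_sqrt]
    refine (AEMeasurable.sqrt ?_).aestronglyMeasurable
    exact Finset.aemeasurable_fun_sum _ fun i _ => Finset.aemeasurable_fun_sum _ fun j _ =>
      (hDm i j).1.aemeasurable.pow_const 2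
  have hfi : Integrable (fun ω => matHSNorm (D ω) ^ 2) P := by
    simp_rw [matHSNorm_sq]
    exact integrable_finsetSum _ fun i _ => integrable_finsetSum _ fun j _ =>
      (hDm i j).integrable_sq
  have hf : MemLp (fun ω => matHSNorm (D ω)) 2 P := (memLp_two_iff_integrable_sq hfm).2 hfi
  have hle : ∫ ω, |matHSNorm (D ω)| ∂P ≤ Real.sqrt (sumFourth P ξ s) := by
    refine integral_abs_le_of_integral_sq_le hf (Real.sqrt_nonneg _) ?_
    rw [Real.sq_sqrt (sumFourth_nonneg s), ← H.sum_integral_sq s]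
    simp_rw [matHSNorm_sq]
    rw [integral_sum_sum (fun i j ω => D ω i j ^ 2) fun i j => (hDm i j).integrable_sq]
    exact Finset.sum_le_sum fun i _ => Finset.sum_le_sum fun j _ => H.integral_sum_sq_le s i j
  have hpt : ∀ ω, matHSNorm (S - sumHalf P ξ s ω) ≤
      matHSNorm (S - sumCov P ξ s) + |matHSNorm (D ω)| := by
    intro ω
    have e : S - sumHalf P ξ s ω = (S - sumCov P ξ s) + (-2⁻¹ : ℝ) • D ω := by
      ext i j
      simp only [sumHalf, sumCov, hD, Matrix.sub_apply, Matrix.add_apply, Matrix.smul_apply,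
        Matrix.of_apply, Matrix.sum_apply, smul_eq_mul, Finset.mul_sum]
      have h : ∑ k ∈ s, 2⁻¹ * (ξ k ω i * ξ k ω j + secondMoment (P.map (ξ k)) i j) =
          ∑ k ∈ s, secondMoment (P.map (ξ k)) i j -
            ∑ k ∈ s, -2⁻¹ * (ξ k ω i * ξ k ω j - secondMoment (P.map (ξ k)) i j) := by
        rw [← Finset.sum_sub_distrib]
        exact Finset.sum_congr rfl fun k _ => by ring
      linarith
    rw [e]
    refine (matHSNorm_add_le _ _).trans ?_
    rw [matHSNorm_smul, abs_of_nonneg (matHSNorm_nonneg (D ω)), show |(-2⁻¹ : ℝ)| = 2⁻¹ by norm_num]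
    linarith [matHSNorm_nonneg (D ω)]
  have hdom : Integrable (fun ω => matHSNorm (S - sumCov P ξ s) + |matHSNorm (D ω)|) P :=
    (integrable_const _).add (hf.integrable (by norm_num)).abs
  have hint : Integrable (fun ω => matHSNorm (S - sumHalf P ξ s ω)) P := by
    refine hdom.mono' ?_ (.of_forall fun ω => ?_)
    · simp_rw [matHSNorm_eq_sqrt, Matrix.sub_apply]
      refine (Measurable.sqrt ?_).aestronglyMeasurable
      exact Finset.measurable_sum _ fun i _ => Finset.measurable_sum _ fun j _ =>
        ((H.measurable_sumHalf s i j).const_sub _).pow_const 2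
    · rw [Real.norm_of_nonneg (matHSNorm_nonneg _)]
      exact hpt ω
  refine ⟨hint, (integral_mono hint hdom hpt).trans ?_⟩
  rw [integral_add (integrable_const _) (hf.integrable (by norm_num)).abs]
  simpa using hle

/-- The covariance matrix of one summand is dominated by its fourth moment. -/
theorem matHSNorm_secondMoment_le (H : IndepSummands ξ P) (k : ι) :
    matHSNorm (secondMoment (P.map (ξ k))) ≤ Real.sqrt (∫ ω, ‖ξ k ω‖ ^ 4 ∂P) := by
  rw [matHSNorm_eq_sqrt]
  refine Real.sqrt_le_sqrt ?_
  have h := H.sum_integral_sq {k}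
  simp only [Finset.sum_singleton, sumFourth] at h
  rw [← h]
  refine Finset.sum_le_sum fun i _ => Finset.sum_le_sum fun j _ => ?_
  rw [H.secondMoment_apply]
  have h2 := variance_nonneg (fun ω => ξ k ω i * ξ k ω j) P
  rw [variance_eq_sub (H.memLp_apply_mul_apply k i j)] at h2
  simpa using h2

/-- Dropping one summand at most doubles the error quantity. -/
theorem error_erase_le (H : IndepSummands ξ P) [DecidableEq ι]
    (S : Matrix (Fin d) (Fin d) ℝ) {s : Finset ι} {k : ι}
    (hk : k ∈ s) :
    matHSNorm (S - sumCov P ξ (s.erase k)) + Real.sqrt (sumFourth P ξ (s.erase k)) ≤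
      2 * (matHSNorm (S - sumCov P ξ s) + Real.sqrt (sumFourth P ξ s)) := by
  have e : S - sumCov P ξ (s.erase k) = (S - sumCov P ξ s) + secondMoment (P.map (ξ k)) := by
    simp only [sumCov]
    rw [← Finset.add_sum_erase s _ hk]
    abel
  have hs : sumFourth P ξ s = (∫ ω, ‖ξ k ω‖ ^ 4 ∂P) + sumFourth P ξ (s.erase k) :=
    (Finset.add_sum_erase s _ hk).symm
  have h1 : 0 ≤ ∫ ω, ‖ξ k ω‖ ^ 4 ∂P := integral_nonneg fun _ => by positivity
  have h2 : sumFourth P ξ (s.erase k) ≤ sumFourth P ξ s := by linarith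
  have h3 : (∫ ω, ‖ξ k ω‖ ^ 4 ∂P) ≤ sumFourth P ξ s := by
    linarith [sumFourth_nonneg (P := P) (ξ := ξ) (s.erase k)]
  have h4 := matHSNorm_add_le (S - sumCov P ξ s) (secondMoment (P.map (ξ k)))
  rw [← e] at h4
  linarith [Real.sqrt_le_sqrt h2, Real.sqrt_le_sqrt h3, H.matHSNorm_secondMoment_le k,
    matHSNorm_nonneg (S - sumCov P ξ s)]

end IndepSummands

end Moments

/-! ### The interpolation between the sum and the Gaussian vector -/

section Interpolation

variable {d : ℕ}

local notation "V" => EuclideanSpace ℝ (Fin d)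

variable {ρ ε M : ℝ} (T : ShellStep ρ ε M)

theorem measurableSet_add_mem_shell {ρ ε : ℝ} (v : V) :
    MeasurableSet {x : V | x + v ∈ shell V ρ ε} := by
  simp only [shell]
  measurability

theorem hasDerivAt_rad0_rotation (u y a : V) (θ : ℝ) :
    HasDerivAt (fun θ => rad0 T.g (Real.cos θ • u + Real.sin θ • y - a))
      (rad1 T.g (Real.cos θ • u + Real.sin θ • y - a)
        (-Real.sin θ • u + Real.cos θ • y)) θ := by
  have h : HasDerivAt (fun θ : ℝ => Real.cos θ • u + Real.sin θ • y - a)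
      (-Real.sin θ • u + Real.cos θ • y) θ :=
    (((Real.hasDerivAt_cos θ).smul_const u).add ((Real.hasDerivAt_sin θ).smul_const y)).sub_const a
  exact ((T.hasDerivAt 0 _).comp θ h.norm_sq).congr_deriv (by rw [rad1]; ring)

/-- The derivative of `θ ↦ E h(cos θ U + sin θ Y)` for the smoothed indicator `h` of a ball. -/
theorem hasDerivAt_integral_rotation (hM : 0 ≤ M) (hε : 0 < ε) (hερ : ε ≤ ρ) {Ω : Type*}
    [MeasurableSpace Ω] {π : Measure Ω} [IsProbabilityMeasure π] {U Y : Ω → V}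
    (hU : Measurable U) (hY : Measurable Y) (hUi : Integrable (fun p => ‖U p‖) π)
    (hYi : Integrable (fun p => ‖Y p‖) π) (a : V) (θ : ℝ) :
    HasDerivAt (fun θ => ∫ p, rad0 T.g (Real.cos θ • U p + Real.sin θ • Y p - a) ∂π)
      (∫ p, rad1 T.g (Real.cos θ • U p + Real.sin θ • Y p - a)
        (-Real.sin θ • U p + Real.cos θ • Y p) ∂π) θ := by
  have hm : ∀ θ : ℝ, Measurable fun p => rad0 T.g (Real.cos θ • U p + Real.sin θ • Y p - a) :=
    fun θ => (continuous_rad0 T).measurable.comp (by fun_prop)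
  refine (hasDerivAt_integral_of_dominated_loc_of_deriv_le (bound := fun p =>
    2 * M / ε * (‖U p‖ + ‖Y p‖)) (s := Set.univ) Filter.univ_mem
    (.of_forall fun θ => (hm θ).aestronglyMeasurable) ?_ ?_ (.of_forall fun p θ _ => ?_)
    ((hUi.add hYi).const_mul _) (.of_forall fun p θ _ => hasDerivAt_rad0_rotation T _ _ a θ)).2
  · exact (integrable_const (1 : ℝ)).mono' (hm θ).aestronglyMeasurable
      (.of_forall fun p => abs_rad0_le T _)
  · have hc : Continuous fun q : V × V => rad1 T.g q.1 q.2 :=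
      continuous_rad1 T continuous_fst continuous_snd
    exact (hc.measurable.comp (Measurable.prodMk (f := fun p =>
      Real.cos θ • U p + Real.sin θ • Y p - a) (by fun_prop) (by fun_prop))).aestronglyMeasurable
  · refine (abs_rad1_le T hM hε hερ _ _).trans ?_
    have : 0 ≤ 2 * M / ε := by positivity
    refine mul_le_mul_of_nonneg_left ((norm_add_le _ _).trans (add_le_add ?_ ?_)) this
    · rw [norm_smul, norm_neg]
      exact mul_le_of_le_one_left (norm_nonneg _) (Real.abs_sin_le_one θ)
    · rw [norm_smul]
      exact mul_le_of_le_one_left (norm_nonneg _) (Real.abs_cos_le_one θ)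

theorem rad1_eq_sum (g : ℕ → ℝ → ℝ) (y u : V) :
    rad1 g y u = ∑ i, u i * rad1 g y (EuclideanSpace.single i 1) := by
  simp only [rad1, PiLp.inner_apply, Finset.mul_sum]
  refine Finset.sum_congr rfl fun i _ => ?_
  simp
  ring

/-- Gaussian integration by parts for the radial test function. -/
theorem integral_rad1_gaussian {S : Matrix (Fin d) (Fin d) ℝ} (hS : S.PosSemidef) (y : V) (s : ℝ) :
    ∫ z, rad1 T.g (y + s • z) z ∂multivariateGaussian (0 : V) S =
      s * ∫ z, ∑ i, ∑ j, S i j * radHess T.g (y + s • z) i j ∂multivariateGaussian (0 : V) S := by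
  have h := multivariateGaussian_stein hS
    (f := fun i z => rad1 T.g (y + s • z) (EuclideanSpace.single i 1))
    (f₂ := fun i j z => s * radHess T.g (y + s • z) i j)
    (fun i => polyGrowth_rad1 T y _ s) (fun i j => (polyGrowth_rad2 T y _ _ s).const_mul s)
    fun i z w => by
      refine (hasDerivAt_line_add_smul y z w s
        (φ := fun x => rad1 T.g x (EuclideanSpace.single i 1))
        (by simpa using hasDerivAt_rad1 T (y + s • z) (EuclideanSpace.single i 1) w 0)).congr_deriv ?_
      rw [rad2_eq_sum, Finset.mul_sum, Finset.sum_eq_single i]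
      · simp only [PiLp.single_apply, if_true]
        rw [Finset.mul_sum]
        exact Finset.sum_congr rfl fun j _ => by ring
      · intro b _ hb
        simp [hb]
      · simp
  rw [integral_congr_ae (.of_forall fun z => rad1_eq_sum T.g (y + s • z) z), h, ← integral_const_mul]
  congr 1; ext z
  simp only [Finset.mul_sum]
  exact Finset.sum_congr rfl fun i _ => Finset.sum_congr rfl fun j _ => by ring

/-- Perturbing the first of two independent vectors by noise that is independent of both keeps them
independent. -/
theorem map_prodMk_eq_prod {Ω F : Type*} [MeasurableSpace Ω] [MeasurableSpace F] {P : Measure Ω}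
    [IsProbabilityMeasure P] {Γ : Measure F} [IsProbabilityMeasure Γ] {U X : Ω → V}
    (hU : Measurable U) (hX : Measurable X) (h : IndepFun U X P) {f : V → F → V}
    (hf : Measurable fun q : V × F => f q.1 q.2) :
    (P.prod Γ).map (fun p => (f (U p.1) p.2, X p.1)) =
      ((P.prod Γ).map fun p => f (U p.1) p.2).prod (P.map X) := by
  have hfm : Measurable fun p : Ω × F => f (U p.1) p.2 :=
    hf.comp (Measurable.prodMk (by fun_prop) (by fun_prop))
  have := Measure.isProbabilityMeasure_map (μ := P) hX.aemeasurable
  have := Measure.isProbabilityMeasure_map (μ := P.prod Γ) hfm.aemeasurable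
  refine (Measure.prod_eq fun A B hA hB => ?_).symm
  rw [Measure.map_apply (by fun_prop) (hA.prod hB), Measure.map_apply hfm hA,
    Measure.map_apply hX hB, Measure.prod_apply_symm ((hfm.prodMk (by fun_prop)) (hA.prod hB)),
    Measure.prod_apply_symm (hfm hA), ← lintegral_mul_const _ (measurable_measure_prodMk_right (hfm hA))]
  refine lintegral_congr fun z => ?_
  have hfz : Measurable fun u : V => f u z :=
    hf.comp (Measurable.prodMk measurable_id measurable_const)
  exact h.measure_inter_preimage_eq_mul _ _ (hfz hA) hB

end Interpolation

section Summand

variable {Ω ι : Type*} [MeasurableSpace Ω] {d : ℕ} {P : Measure Ω} [IsProbabilityMeasure P]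
  {ξ : ι → Ω → EuclideanSpace ℝ (Fin d)} [DecidableEq ι]

local notation "V" => EuclideanSpace ℝ (Fin d)

variable {ρ ε M : ℝ} (T : ShellStep ρ ε M)

/-- The contribution of one summand to the derivative along the interpolation. -/
theorem abs_integral_rad1_summand_le (H : IndepSummands ξ P) (hM : 1 ≤ M) (hε : 0 < ε)
    (hερ : ε ≤ ρ) {S : Matrix (Fin d) (Fin d) ℝ} (hS : S.PosSemidef) (hS1 : (S - 1).PosSemidef)
    {s : Finset ι} {k : ι} (hk : k ∈ s) (a : V) {c t τ : ℝ} (hc : 0 ≤ c) (ht : 0 ≤ t)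
    (hτ : ∀ v : V, P.real {ω | c • ∑ l ∈ s.erase k, ξ l ω + v ∈ shell V ρ ε} ≤ τ) :
    |∫ p : Ω × V, rad1 T.g (c • ∑ l ∈ s, ξ l p.1 + t • p.2 - a) (ξ k p.1)
        ∂P.prod (multivariateGaussian 0 S) -
      c / 2 * ∫ p : Ω × V, ∑ i, ∑ j, (ξ k p.1 i * ξ k p.1 j + secondMoment (P.map (ξ k)) i j) *
        radHess T.g (c • ∑ l ∈ s, ξ l p.1 + t • p.2 - a) i j ∂P.prod (multivariateGaussian 0 S)| ≤
      4 * c ^ 3 * (86 * M * τ / ε ^ 2 / (t ^ 2 + ε ^ 2)) * ∫ ω, ‖ξ k ω‖ ^ 4 ∂P := by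
  set Γ := multivariateGaussian (0 : V) S with hΓ
  set U : Ω → V := fun ω => ∑ l ∈ s.erase k, ξ l ω with hU
  have hξ := H.measurable
  have hUm : Measurable U := Finset.measurable_fun_sum _ fun l _ => hξ l
  have hind : IndepFun U (ξ k) P := by
    have := H.indep.indepFun_finsetSum_of_notMem hξ (Finset.notMem_erase k s)
    rwa [show (∑ j ∈ s.erase k, ξ j) = U by ext1 ω; simp [hU]] at this
  have hsum : ∀ ω, ∑ l ∈ s, ξ l ω = U ω + ξ k ω := fun ω =>
    (Finset.sum_erase_add s (fun l => ξ l ω) hk).symm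
  have hfm : Measurable fun p : Ω × V => c • U p.1 + t • p.2 - a := by fun_prop
  have := Measure.isProbabilityMeasure_map (μ := P) (hξ k).aemeasurable
  have := Measure.isProbabilityMeasure_map (μ := P.prod Γ) hfm.aemeasurable
  have hmap := map_prodMk_eq_prod (P := P) (Γ := Γ) hUm (hξ k) hind
    (f := fun u z => c • u + t • z - a) (by fun_prop)
  have hB : ∀ q u : V, |∫ p, rad4 T.g (p + q) u ∂((P.prod Γ).map fun p => c • U p.1 + t • p.2 - a)| ≤
      86 * M * τ / ε ^ 2 / (t ^ 2 + ε ^ 2) * ‖u‖ ^ 4 := by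
    intro q u
    have hcU : Measurable fun ω => c • U ω := by fun_prop
    have := Measure.isProbabilityMeasure_map (μ := P) hcU.aemeasurable
    have h := abs_integral_rad4_le T hM hε hερ (L := P.map fun ω => c • U ω) (τ := τ) (fun v => by
      rw [map_measureReal_apply hcU (measurableSet_add_mem_shell v)]
      exact hτ v) hS hS1 (q - a) u ht
    rw [← hΓ] at h
    have e : (P.map fun ω => c • U ω).prod Γ =
        (P.prod Γ).map (Prod.map (fun ω => c • U ω) id) := by
      rw [← Measure.map_prod_map P Γ hcU measurable_id, Measure.map_id]
    rw [e, integral_map (by fun_prop)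
      (continuous_rad4 T (by fun_prop) continuous_const).aestronglyMeasurable] at h
    rw [integral_map hfm.aemeasurable
      (continuous_rad4 T (by fun_prop) continuous_const).aestronglyMeasurable]
    refine le_trans (le_of_eq ?_) h
    congr 2; ext p
    simp only [Prod.map_fst, Prod.map_snd, id]
    congr 1
    abel
  have hμ0 : ∫ x, x ∂P.map (ξ k) = 0 := by
    rw [integral_map (hξ k).aemeasurable (by fun_prop), H.integral_eq_zero k]
  have h := abs_integral_rad1_sub_le T (by linarith) hε hερ (H.integrable_map k) hμ0 hB hc
  rw [← hmap, integral_map (by fun_prop)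
    (continuous_rad1 T (by fun_prop) (by fun_prop)).aestronglyMeasurable,
    integral_map (by fun_prop) (Continuous.aestronglyMeasurable <| by
      refine continuous_finsetSum _ fun i _ => continuous_finsetSum _ fun j _ =>
        Continuous.mul (by fun_prop) ?_
      exact continuous_rad2 T (by fun_prop) continuous_const continuous_const),
    integral_map (hξ k).aemeasurable (by fun_prop)] at h
  simp_rw [hsum]
  have e : ∀ p : Ω × V, c • (U p.1 + ξ k p.1) + t • p.2 - a =
      c • U p.1 + t • p.2 - a + c • ξ k p.1 := fun p => by module
  simp_rw [e]
  exact h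

end Summand

section Derivative

variable {Ω ι : Type*} [MeasurableSpace Ω] {d : ℕ} {P : Measure Ω} [IsProbabilityMeasure P]
  {ξ : ι → Ω → EuclideanSpace ℝ (Fin d)} [DecidableEq ι]

local notation "V" => EuclideanSpace ℝ (Fin d)

variable {ρ ε M : ℝ} (T : ShellStep ρ ε M)

theorem continuous_radHess (i j : Fin d) : Continuous fun y : V => radHess T.g y i j :=
  continuous_rad2 T continuous_id continuous_const continuous_const

theorem abs_radHess_le (hM : 0 ≤ M) (hε : 0 < ε) (hερ : ε ≤ ρ) (y : V) (i j : Fin d) :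
    |radHess T.g y i j| ≤ 5 * M / ε ^ 2 :=
  (abs_rad2_le T hM hε hερ y (EuclideanSpace.single i 1) (EuclideanSpace.single j 1)).trans
    (by simp)

theorem integrable_mul_radHess (hM : 0 ≤ M) (hε : 0 < ε) (hερ : ε ≤ ρ) {Ω' : Type*}
    [MeasurableSpace Ω'] {π : Measure Ω'} {A : Ω' → ℝ} (hA : Integrable A π) {X : Ω' → V}
    (hX : Measurable X) (i j : Fin d) :
    Integrable (fun p => A p * radHess T.g (X p) i j) π := by
  refine (hA.norm.mul_const (5 * M / ε ^ 2)).mono'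
    (hA.1.mul ((continuous_radHess T i j).measurable.comp hX).aestronglyMeasurable)
    (.of_forall fun p => ?_)
  rw [norm_mul]
  exact mul_le_mul_of_nonneg_left (abs_radHess_le T hM hε hερ _ i j) (norm_nonneg _)

theorem integrable_rad1 (hM : 0 ≤ M) (hε : 0 < ε) (hερ : ε ≤ ρ) {Ω' : Type*}
    [MeasurableSpace Ω'] {π : Measure Ω'} {X Y : Ω' → V} (hX : Measurable X) (hY : Measurable Y)
    (hYi : Integrable (fun p => ‖Y p‖) π) : Integrable (fun p => rad1 T.g (X p) (Y p)) π := by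
  have hc : Continuous fun q : V × V => rad1 T.g q.1 q.2 :=
    continuous_rad1 T continuous_fst continuous_snd
  exact (hYi.const_mul (2 * M / ε)).mono' (hc.measurable.comp (hX.prodMk hY)).aestronglyMeasurable
    (.of_forall fun p => abs_rad1_le T hM hε hερ _ _)

theorem integrable_norm_multivariateGaussian (S : Matrix (Fin d) (Fin d) ℝ) :
    Integrable (fun z : V => ‖z‖) (multivariateGaussian (0 : V) S) :=
  (IsGaussian.integrable_id (μ := multivariateGaussian (0 : V) S)).norm

/-- The derivative along the interpolation is controlled by the closeness of `sumHalf` to `S` and by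
the fourth moments times the probability `τ` that a leave-one-out sum lies in a shell. -/
theorem abs_integral_rad1_interpolation_le (H : IndepSummands ξ P) (hd : 0 < d) (hM : 1 ≤ M)
    (hε : 0 < ε) (hερ : ε ≤ ρ) (hρd : ε * Real.sqrt d ≤ ρ) {S : Matrix (Fin d) (Fin d) ℝ}
    (hS : S.PosSemidef) (hS1 : (S - 1).PosSemidef) {s : Finset ι} (a : V) {c t τ : ℝ} (hc : 0 < c)
    (hc1 : c ≤ 1) (ht : 0 ≤ t) (hτ0 : 0 ≤ τ)
    (hτ : ∀ k ∈ s, ∀ v : V,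
      P.real {ω | c • ∑ l ∈ s.erase k, ξ l ω + v ∈ shell V ρ ε} ≤ τ / c) :
    |∫ p : Ω × V, rad1 T.g (c • ∑ l ∈ s, ξ l p.1 + t • p.2 - a)
        (-t • ∑ l ∈ s, ξ l p.1 + c • p.2) ∂P.prod (multivariateGaussian 0 S)| ≤
      (10 * M * (matHSNorm (S - sumCov P ξ s) + Real.sqrt (sumFourth P ξ s)) +
        344 * M * τ / ε ^ 2 * sumFourth P ξ s) * (t * c / (t ^ 2 + ε ^ 2)) := by
  set Γ := multivariateGaussian (0 : V) S with hΓ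
  set π := P.prod Γ with hπ
  have hM0 : 0 ≤ M := by linarith
  have hξ := H.measurable
  have hWm : Measurable fun ω => ∑ l ∈ s, ξ l ω := Finset.measurable_fun_sum _ fun l _ => hξ l
  set X : Ω × V → V := fun p => c • ∑ l ∈ s, ξ l p.1 + t • p.2 - a with hX
  have hXm : Measurable X :=
    ((((hWm.comp measurable_fst).const_smul c).add (measurable_snd.const_smul t)).sub_const a)
  have hDpos : 0 < t ^ 2 + ε ^ 2 := by positivity
  set J : ι → ℝ := fun k => ∫ p, rad1 T.g (X p) (ξ k p.1) ∂π with hJ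
  set Q : ι → ℝ := fun k => ∫ p, ∑ i, ∑ j,
    (ξ k p.1 i * ξ k p.1 j + secondMoment (P.map (ξ k)) i j) * radHess T.g (X p) i j ∂π with hQ
  set G : ℝ := ∫ p, ∑ i, ∑ j, S i j * radHess T.g (X p) i j ∂π with hG
  have iJ : ∀ k, Integrable (fun p => rad1 T.g (X p) (ξ k p.1)) π := fun k => by
    have := (H.integrable_norm_pow k (m := 1) (by norm_num)).comp_fst Γ
    simp only [pow_one] at this
    exact integrable_rad1 T hM0 hε hερ hXm (by have := hξ k; fun_prop) this
  have iZ : Integrable (fun p => rad1 T.g (X p) p.2) π :=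
    integrable_rad1 T hM0 hε hερ hXm (by fun_prop)
      ((integrable_norm_multivariateGaussian S).comp_snd P)
  have iQ : ∀ k, Integrable (fun p => ∑ i, ∑ j,
      (ξ k p.1 i * ξ k p.1 j + secondMoment (P.map (ξ k)) i j) * radHess T.g (X p) i j) π :=
    fun k => integrable_finsetSum _ fun i _ => integrable_finsetSum _ fun j _ =>
      integrable_mul_radHess T hM0 hε hερ
        (((H.integrable_apply_mul_apply k i j).comp_fst Γ).add (integrable_const _)) hXm i j
  have iG : Integrable (fun p => ∑ i, ∑ j, S i j * radHess T.g (X p) i j) π :=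
    integrable_finsetSum _ fun i _ => integrable_finsetSum _ fun j _ =>
      integrable_mul_radHess T hM0 hε hερ (integrable_const _) hXm i j
  have hlin : ∀ p : Ω × V, rad1 T.g (X p) (-t • ∑ l ∈ s, ξ l p.1 + c • p.2) =
      -t * ∑ k ∈ s, rad1 T.g (X p) (ξ k p.1) + c * rad1 T.g (X p) p.2 := by
    intro p
    simp only [rad1, inner_add_right, real_inner_smul_right, inner_sum, Finset.mul_sum, mul_add]
    congr 1
    · exact Finset.sum_congr rfl fun k _ => by ring
    · ring
  have hF : ∫ p, rad1 T.g (X p) (-t • ∑ l ∈ s, ξ l p.1 + c • p.2) ∂π =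
      -t * ∑ k ∈ s, J k + c * ∫ p, rad1 T.g (X p) p.2 ∂π := by
    simp_rw [hlin]
    rw [integral_add ((integrable_finsetSum _ fun k _ => iJ k).const_mul _) (iZ.const_mul _),
      integral_const_mul, integral_const_mul, integral_finsetSum _ fun k _ => iJ k]
  have hXe : ∀ ω z, X (ω, z) = (c • ∑ l ∈ s, ξ l ω - a) + t • z := fun ω z => by
    simp only [hX]; abel
  -- Gaussian integration by parts, conditionally on the summands
  have hZ : ∫ p, rad1 T.g (X p) p.2 ∂π = t * G := by
    rw [hG, integral_prod _ iZ, integral_prod _ iG, ← integral_const_mul]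
    congr 1; ext ω
    simp only [hXe]
    exact integral_rad1_gaussian T hS _ t
  have hpt : ∀ p : Ω × V, ∑ i, ∑ j, (S - sumHalf P ξ s p.1) i j * radHess T.g (X p) i j =
      ∑ i, ∑ j, S i j * radHess T.g (X p) i j - ∑ k ∈ s, 2⁻¹ * ∑ i, ∑ j,
        (ξ k p.1 i * ξ k p.1 j + secondMoment (P.map (ξ k)) i j) * radHess T.g (X p) i j := by
    intro p
    have e : ∑ k ∈ s, 2⁻¹ * ∑ i, ∑ j, (ξ k p.1 i * ξ k p.1 j + secondMoment (P.map (ξ k)) i j) *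
        radHess T.g (X p) i j = ∑ i, ∑ j, sumHalf P ξ s p.1 i j * radHess T.g (X p) i j := by
      simp only [sumHalf, Matrix.of_apply, Finset.sum_mul, Finset.mul_sum]
      rw [Finset.sum_comm]
      refine Finset.sum_congr rfl fun i _ => ?_
      rw [Finset.sum_comm]
      exact Finset.sum_congr rfl fun j _ => Finset.sum_congr rfl fun k _ => by ring
    rw [e]
    simp only [Matrix.sub_apply, sub_mul, Finset.sum_sub_distrib]
  have iQs : Integrable (fun p => ∑ k ∈ s, 2⁻¹ * ∑ i, ∑ j,
      (ξ k p.1 i * ξ k p.1 j + secondMoment (P.map (ξ k)) i j) * radHess T.g (X p) i j) π :=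
    integrable_finsetSum _ fun k _ => (iQ k).const_mul _
  set D := ∫ p, ∑ i, ∑ j, (S - sumHalf P ξ s p.1) i j * radHess T.g (X p) i j ∂π with hD
  have hDe : D = G - ∑ k ∈ s, 2⁻¹ * Q k := by
    rw [hD]
    simp_rw [hpt]
    rw [integral_sub iG iQs, integral_finsetSum _ fun k _ => (iQ k).const_mul _]
    simp_rw [integral_const_mul]
    rfl
  obtain ⟨hhi, hhle⟩ := H.integral_matHSNorm_sub_sumHalf_le S s
  -- conditionally on the summands, the Hessian is averaged over the Gaussian variable
  have hDle : |D| ≤ 10 * M / (t ^ 2 + ε ^ 2) *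
      (matHSNorm (S - sumCov P ξ s) + Real.sqrt (sumFourth P ξ s)) := by
    have iD : Integrable (fun p : Ω × V =>
        ∑ i, ∑ j, (S - sumHalf P ξ s p.1) i j * radHess T.g (X p) i j) π := by
      simp_rw [hpt]
      exact iG.sub iQs
    rw [hD, integral_prod _ iD]
    refine abs_integral_le_integral_abs.trans ?_
    calc _ ≤ ∫ ω, 10 * M / (t ^ 2 + ε ^ 2) * matHSNorm (S - sumHalf P ξ s ω) ∂P := by
          refine integral_mono_of_nonneg (.of_forall fun _ => abs_nonneg _) (hhi.const_mul _)
            (.of_forall fun ω => ?_)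
          simp only [hXe]
          exact (abs_integral_radHess_le T hd hM hε hρd hS hS1 _ _ ht).trans (le_of_eq (by ring))
      _ ≤ _ := by
          rw [integral_const_mul]
          exact mul_le_mul_of_nonneg_left hhle (by positivity)
  -- the fourth-order remainders
  have hrem : ∀ k ∈ s, |J k - c / 2 * Q k| ≤
      4 * c ^ 3 * (86 * M * (τ / c) / ε ^ 2 / (t ^ 2 + ε ^ 2)) * ∫ ω, ‖ξ k ω‖ ^ 4 ∂P := fun k hk =>
    abs_integral_rad1_summand_le T H hM hε hερ hS hS1 hk a hc.le ht (hτ k hk)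
  have hrems : |∑ k ∈ s, (J k - c / 2 * Q k)| ≤
      c * (344 * M * τ / ε ^ 2 / (t ^ 2 + ε ^ 2) * sumFourth P ξ s) := by
    refine (Finset.abs_sum_le_sum_abs _ _).trans ((Finset.sum_le_sum hrem).trans ?_)
    rw [← Finset.mul_sum]
    have e : 4 * c ^ 3 * (86 * M * (τ / c) / ε ^ 2 / (t ^ 2 + ε ^ 2)) =
        c * (c * (344 * M * τ / ε ^ 2 / (t ^ 2 + ε ^ 2))) := by
      field_simp; ring
    rw [e, mul_assoc]
    refine mul_le_mul_of_nonneg_left ?_ hc.le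
    refine mul_le_mul_of_nonneg_right (mul_le_of_le_one_left (by positivity) hc1)
      (sumFourth_nonneg s)
  have hfin : ∫ p, rad1 T.g (X p) (-t • ∑ l ∈ s, ξ l p.1 + c • p.2) ∂π =
      c * t * D - t * ∑ k ∈ s, (J k - c / 2 * Q k) := by
    rw [hF, hZ, hDe, Finset.sum_sub_distrib, ← Finset.mul_sum, ← Finset.mul_sum]
    ring
  rw [hfin]
  refine (abs_sub _ _).trans ?_
  rw [abs_mul, abs_mul t, abs_of_nonneg (by positivity : 0 ≤ c * t), abs_of_nonneg ht]
  refine (add_le_add (mul_le_mul_of_nonneg_left hDle (by positivity))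
    (mul_le_mul_of_nonneg_left hrems ht)).trans (le_of_eq ?_)
  field_simp

/-- The smooth comparison: replacing the sum `W` by the Gaussian vector `Z` in a radial test function.
Along `cos θ W + sin θ Z` the derivative is at most a constant times `sin θ cos θ / (sin² θ + ε²)`,
which integrates to the logarithm. The probability of a shell under a leave-one-out sum contracted by
the factor `c = cos θ` may be as large as `τ / c`; this singularity is absorbed by the factor `c³` of
the fourth-order remainder. -/
theorem abs_integral_rad0_sub_le (H : IndepSummands ξ P) (hd : 0 < d) (hM : 1 ≤ M)
    (hε : 0 < ε) (hρd : ε * Real.sqrt d ≤ ρ) {S : Matrix (Fin d) (Fin d) ℝ}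
    (hS : S.PosSemidef) (hS1 : (S - 1).PosSemidef) {s : Finset ι} (a : V) {τ : ℝ} (hτ0 : 0 ≤ τ)
    (hτ : ∀ k ∈ s, ∀ c : ℝ, 0 < c → c ≤ 1 → ∀ v : V,
      P.real {ω | c • ∑ l ∈ s.erase k, ξ l ω + v ∈ shell V ρ ε} ≤ τ / c) :
    |∫ z, rad0 T.g (z - a) ∂multivariateGaussian (0 : V) S -
        ∫ ω, rad0 T.g (∑ l ∈ s, ξ l ω - a) ∂P| ≤
      (10 * M * (matHSNorm (S - sumCov P ξ s) + Real.sqrt (sumFourth P ξ s)) +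
        344 * M * τ / ε ^ 2 * sumFourth P ξ s) / 2 * Real.log (1 + 1 / ε ^ 2) := by
  set Γ := multivariateGaussian (0 : V) S with hΓ
  set K := 10 * M * (matHSNorm (S - sumCov P ξ s) + Real.sqrt (sumFourth P ξ s)) +
        344 * M * τ / ε ^ 2 * sumFourth P ξ s with hK
  have hM0 : 0 ≤ M := by linarith
  have hd1 : (1 : ℝ) ≤ Real.sqrt d := by
    rw [Real.one_le_sqrt]; exact_mod_cast hd
  have hερ : ε ≤ ρ := (le_mul_of_one_le_right hε.le hd1).trans hρd
  have hξ := H.measurable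
  have hWm : Measurable fun ω => ∑ l ∈ s, ξ l ω := Finset.measurable_fun_sum _ fun l _ => hξ l
  have hWi : Integrable (fun ω => ‖∑ l ∈ s, ξ l ω‖) P := by
    refine (integrable_finsetSum s (f := fun l ω => ξ l ω) fun l _ => ?_).norm
    have := H.integrable_norm_pow l (m := 1) (by norm_num)
    simp only [pow_one] at this
    exact (integrable_norm_iff (hξ l).aestronglyMeasurable).1 this
  set F : ℝ → ℝ := fun θ => ∫ p : Ω × V, rad0 T.g
    (Real.cos θ • ∑ l ∈ s, ξ l p.1 + Real.sin θ • p.2 - a) ∂P.prod Γ with hF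
  set F' : ℝ → ℝ := fun θ => ∫ p : Ω × V, rad1 T.g
    (Real.cos θ • ∑ l ∈ s, ξ l p.1 + Real.sin θ • p.2 - a)
    (-Real.sin θ • ∑ l ∈ s, ξ l p.1 + Real.cos θ • p.2) ∂P.prod Γ with hF'
  have hder : ∀ θ, HasDerivAt F (F' θ) θ := fun θ =>
    hasDerivAt_integral_rotation T hM0 hε hερ (π := P.prod Γ) (U := fun p => ∑ l ∈ s, ξ l p.1)
      (Y := fun p => p.2) (hWm.comp measurable_fst) measurable_snd (hWi.comp_fst Γ)
      ((integrable_norm_multivariateGaussian S).comp_snd P) a θ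
  have hBd : ∀ θ, HasDerivAt (fun θ => K / 2 *
      (Real.log (Real.sin θ ^ 2 + ε ^ 2) - Real.log (ε ^ 2)))
      (K * (Real.sin θ * Real.cos θ / (Real.sin θ ^ 2 + ε ^ 2))) θ := by
    intro θ
    have hp : Real.sin θ ^ 2 + ε ^ 2 ≠ 0 := by positivity
    have h := ((((Real.hasDerivAt_sin θ).pow 2).add_const (ε ^ 2)).log hp).sub_const
      (Real.log (ε ^ 2))
    refine (h.const_mul (K / 2)).congr_deriv ?_
    simp only [Nat.cast_ofNat, Nat.add_one_sub_one, pow_one, Pi.pow_apply]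
    ring
  have hpi := Real.pi_pos
  have hmain := image_norm_le_of_norm_deriv_right_le_deriv_boundary (a := 0) (b := Real.pi / 2)
    (f := fun θ => F θ - F 0) (f' := F')
    (Continuous.continuousOn (continuous_iff_continuousAt.2 fun θ =>
      ((hder θ).sub_const _).continuousAt))
    (fun θ _ => ((hder θ).sub_const (F 0)).hasDerivWithinAt)
    (by simp) hBd (fun θ hθ => by
      rw [Real.norm_eq_abs]
      have hcos : 0 < Real.cos θ := Real.cos_pos_of_mem_Ioo ⟨by linarith [hθ.1], hθ.2⟩
      have hsin : 0 ≤ Real.sin θ := Real.sin_nonneg_of_nonneg_of_le_pi hθ.1 (by linarith [hθ.2])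
      exact abs_integral_rad1_interpolation_le T H hd hM hε hερ hρd hS hS1 a hcos
        (Real.cos_le_one θ) hsin hτ0 fun k hk => hτ k hk _ hcos (Real.cos_le_one θ))
    (Set.right_mem_Icc.2 (by positivity))
  have h0 : F 0 = ∫ ω, rad0 T.g (∑ l ∈ s, ξ l ω - a) ∂P := by
    simp only [hF, Real.cos_zero, Real.sin_zero, one_smul, zero_smul, add_zero]
    rw [integral_fun_fst (fun ω => rad0 T.g (∑ l ∈ s, ξ l ω - a))]
    simp
  have h1 : F (Real.pi / 2) = ∫ z, rad0 T.g (z - a) ∂Γ := by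
    simp only [hF, Real.cos_pi_div_two, Real.sin_pi_div_two, one_smul, zero_smul, zero_add]
    rw [integral_fun_snd (fun z => rad0 T.g (z - a))]
    simp
  rw [h0, h1, Real.norm_eq_abs, Real.sin_pi_div_two, one_pow,
    ← Real.log_div (by positivity) (by positivity)] at hmain
  rw [show 1 + 1 / ε ^ 2 = (1 + ε ^ 2) / ε ^ 2 by field_simp; ring]
  exact hmain

end Derivative

/-! ### From smooth test functions to balls -/

section Balls

variable {d : ℕ}

local notation "V" => EuclideanSpace ℝ (Fin d)

theorem measureReal_closedBall_sandwich {ρ ε M : ℝ} (T : ShellStep ρ ε M) (hρ : 0 ≤ ρ) (hε : 0 ≤ ε)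
    (ν : Measure V) [IsProbabilityMeasure ν] (a : V) :
    ν.real (Metric.closedBall a ρ) ≤ ∫ z, rad0 T.g (z - a) ∂ν ∧
      ∫ z, rad0 T.g (z - a) ∂ν ≤ ν.real (Metric.closedBall a (ρ + ε)) := by
  have hc : Continuous fun z : V => rad0 T.g (z - a) := (continuous_rad0 T).comp (by fun_prop)
  have hi : Integrable (fun z : V => rad0 T.g (z - a)) ν :=
    (integrable_const (1 : ℝ)).mono' hc.aestronglyMeasurable (.of_forall fun z => abs_rad0_le T _)
  have hB : ∀ r, MeasurableSet (Metric.closedBall a r) := fun r => measurableSet_closedBall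
  have hind : ∀ r, Integrable ((Metric.closedBall a r).indicator fun _ => (1 : ℝ)) ν := fun r =>
    (integrable_const _).indicator (hB r)
  have e : ∀ r, ν.real (Metric.closedBall a r) =
      ∫ z, (Metric.closedBall a r).indicator (fun _ => (1 : ℝ)) z ∂ν := fun r => by
    rw [integral_indicator_const _ (hB r), smul_eq_mul, mul_one]
  rw [e, e]
  refine ⟨integral_mono (hind _) hi fun z => ?_, integral_mono hi (hind _) fun z => ?_⟩
  · by_cases hz : z ∈ Metric.closedBall a ρ
    · rw [Set.indicator_of_mem hz, rad0, T.eq_one]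
      rw [mem_closedBall_iff_norm] at hz
      gcongr
    · rw [Set.indicator_of_notMem hz]
      exact T.nonneg _
  · by_cases hz : z ∈ Metric.closedBall a (ρ + ε)
    · rw [Set.indicator_of_mem hz]
      exact T.le_one _
    · rw [Set.indicator_of_notMem hz, rad0, T.eq_zero]
      rw [mem_closedBall_iff_norm, not_le] at hz
      rw [add_sub_cancel]
      gcongr

/-- Comparing a law with a Gaussian law on enlarged balls of radius at least `ε √d` is enough:
Gaussian anti-concentration in shells removes the enlargement, and smaller balls have a Gaussian
measure of order `ε`. -/
theorem abs_measureReal_closedBall_sub_le (hd : 0 < d) {S : Matrix (Fin d) (Fin d) ℝ}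
    (hS : S.PosSemidef) (hS1 : (S - 1).PosSemidef) {ε R : ℝ} (hε : 0 < ε) (hR : 0 ≤ R)
    {ν : Measure V} [IsProbabilityMeasure ν] {a : V}
    (h : ∀ ρ, ε * Real.sqrt d ≤ ρ →
      ν.real (Metric.closedBall a ρ) ≤
        (multivariateGaussian 0 S).real (Metric.closedBall a (ρ + ε)) + R ∧
      (multivariateGaussian 0 S).real (Metric.closedBall a ρ) ≤
        ν.real (Metric.closedBall a (ρ + ε)) + R) (r : ℝ) :
    |ν.real (Metric.closedBall a r) - (multivariateGaussian 0 S).real (Metric.closedBall a r)| ≤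
      1422 * ε + R := by
  set Γ := multivariateGaussian (0 : V) S
  have hd1 : (1 : ℝ) ≤ Real.sqrt d := by
    rw [Real.one_le_sqrt]; exact_mod_cast hd
  have hεd : ε ≤ ε * Real.sqrt d := le_mul_of_one_le_right hε.le hd1
  have mono : ∀ (μ : Measure V) [IsProbabilityMeasure μ] {r r' : ℝ}, r ≤ r' →
      μ.real (Metric.closedBall a r) ≤ μ.real (Metric.closedBall a r') := fun μ _ r r' h =>
    measureReal_mono (Metric.closedBall_subset_closedBall h)
  have hsh : ∀ ρ, ε * Real.sqrt d ≤ ρ →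
      Γ.real (Metric.closedBall a (ρ + ε)) ≤ Γ.real (Metric.closedBall a ρ) + 1416 * ε := by
    intro ρ hρ
    have h1 := multivariateGaussian_shell_le hd hS hS1 a hε (hεd.trans hρ)
    have hsub : Metric.closedBall a (ρ + ε) ⊆
        Metric.closedBall a ρ ∪ {z | ρ < ‖z - a‖ ∧ ‖z - a‖ ≤ ρ + ε} := by
      intro z hz
      rw [mem_closedBall_iff_norm] at hz
      rcases le_or_gt ‖z - a‖ ρ with h | h
      · exact Or.inl (mem_closedBall_iff_norm.2 h)
      · exact Or.inr ⟨h, hz⟩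
    linarith [(measureReal_mono hsub (μ := Γ)).trans (measureReal_union_le _ _)]
  have hsm : ∀ η : ℝ, 0 < η → Γ.real (Metric.closedBall a (η * Real.sqrt d)) ≤ 6 * η := by
    intro η hη
    have := multivariateGaussian_smallBall_le hd hS hS1 a hη
    rwa [show {z : V | ‖z - a‖ ≤ η * Real.sqrt d} = Metric.closedBall a (η * Real.sqrt d) by
      ext z; rw [mem_closedBall_iff_norm]; rfl] at this
  have hν0 : 0 ≤ ν.real (Metric.closedBall a r) := measureReal_nonneg
  have hΓ0 : 0 ≤ Γ.real (Metric.closedBall a r) := measureReal_nonneg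
  rw [abs_le]
  constructor
  · rcases le_or_gt (2 * ε * Real.sqrt d) r with hr | hr
    · have h1 := (h (r - ε) (by linarith)).2
      have h2 := hsh (r - ε) (by linarith)
      rw [sub_add_cancel] at h1 h2
      linarith
    · have h1 := mono Γ hr.le
      have h2 := hsm (2 * ε) (by positivity)
      linarith
  · rcases le_or_gt (ε * Real.sqrt d) r with hr | hr
    · linarith [(h r hr).1, hsh r hr]
    · linarith [mono ν hr.le, (h _ le_rfl).1, hsh _ le_rfl, hsm ε hε]

theorem psiLog_nonneg {x : ℝ} (hx : 0 ≤ x) : 0 ≤ psiLog x :=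
  mul_nonneg hx (zero_le_one.trans (le_max_right _ _))

theorem le_psiLog {x : ℝ} (hx : 0 ≤ x) : x ≤ psiLog x :=
  le_mul_of_one_le_right hx (le_max_right _ _)

theorem psiLog_two_mul_le {x : ℝ} (hx : 0 < x) : psiLog (2 * x) ≤ 4 * psiLog x := by
  have h2 : Real.log (2 * x) = Real.log 2 + Real.log x := Real.log_mul two_ne_zero hx.ne'
  have h3 : max |Real.log (2 * x)| 1 ≤ 2 * max |Real.log x| 1 := by
    have h4 := le_max_left |Real.log x| 1
    have h5 := le_max_right |Real.log x| 1
    refine max_le ?_ (by linarith)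
    rw [h2]
    refine (abs_add_le _ _).trans ?_
    rw [abs_of_nonneg (Real.log_nonneg (by norm_num : (1 : ℝ) ≤ 2))]
    linarith [Real.log_two_lt_d9]
  simp only [psiLog]
  calc 2 * x * max |Real.log (2 * x)| 1 ≤ 2 * x * (2 * max |Real.log x| 1) := by gcongr
    _ = _ := by ring

/-- The law `ν` of a vector that is close to the Gaussian law on closed balls charges the translates
of a shell little, and so do the laws of its contractions, up to the inverse contraction factor. -/
theorem measureReal_smul_add_mem_shell_le (hd : 0 < d) {S : Matrix (Fin d) (Fin d) ℝ}
    (hS : S.PosSemidef) (hS1 : (S - 1).PosSemidef) {ν : Measure V} [IsProbabilityMeasure ν] {κ : ℝ}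
    (hκ : ∀ a r, |ν.real (Metric.closedBall a r) -
      (multivariateGaussian 0 S).real (Metric.closedBall a r)| ≤ κ) {ρ ε c : ℝ} (hε : 0 < ε)
    (hερ : ε ≤ ρ) (hc : 0 < c) (hc1 : c ≤ 1) (v : V) :
    ν.real {x | c • x + v ∈ shell V ρ ε} ≤ (1416 * ε + 2 * κ) / c := by
  set Γ := multivariateGaussian (0 : V) S
  set a : V := -(c⁻¹ • v) with ha
  have hn : ∀ x : V, ‖c • x + v‖ = c * ‖x - a‖ := by
    intro x
    rw [show c • x + v = c • (x - a) by
      rw [ha, sub_neg_eq_add, smul_add, smul_inv_smul₀ hc.ne'], norm_smul,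
      Real.norm_of_nonneg hc.le]
  have hset : {x : V | c • x + v ∈ shell V ρ ε} =
      {x | ρ / c < ‖x - a‖ ∧ ‖x - a‖ ≤ ρ / c + ε / c} := by
    ext x
    simp only [shell, Set.mem_ofPred_eq, hn]
    rw [div_lt_iff₀ hc, ← add_div, le_div_iff₀ hc, mul_comm]
  have hdiff : {x : V | ρ / c < ‖x - a‖ ∧ ‖x - a‖ ≤ ρ / c + ε / c} =
      Metric.closedBall a (ρ / c + ε / c) \ Metric.closedBall a (ρ / c) := by
    ext x
    simp only [Set.mem_ofPred_eq, Set.mem_sdiff, mem_closedBall_iff_norm, not_le]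
    exact and_comm
  have hsub : Metric.closedBall a (ρ / c) ⊆ Metric.closedBall a (ρ / c + ε / c) :=
    Metric.closedBall_subset_closedBall (by linarith [div_pos hε hc])
  have hG := multivariateGaussian_shell_le hd hS hS1 a (div_pos hε hc)
    (div_le_div_of_nonneg_right hερ hc.le)
  rw [hdiff, measureReal_sdiff hsub measurableSet_closedBall] at hG
  rw [hset, hdiff, measureReal_sdiff hsub measurableSet_closedBall]
  have h1 := abs_le.1 (hκ a (ρ / c + ε / c))
  have h2 := abs_le.1 (hκ a (ρ / c))
  have h3 : κ ≤ κ / c := by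
    rw [le_div_iff₀ hc]
    exact mul_le_of_le_one_right ((abs_nonneg _).trans (hκ a 0)) hc1
  have e : (1416 * ε + 2 * κ) / c = 1416 * (ε / c) + 2 * (κ / c) := by ring
  rw [e]
  linarith [h1.2, h2.1]

end Balls

section Induction

variable {Ω ι : Type*} [MeasurableSpace Ω] {d : ℕ} {P : Measure Ω} [IsProbabilityMeasure P]
  {ξ : ι → Ω → EuclideanSpace ℝ (Fin d)}

local notation "V" => EuclideanSpace ℝ (Fin d)

/-- The choice of the smoothing parameter. Here `L` stands for `|log η|`, `lg` for `log (1 + ε⁻²)`,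
and `τ` contains the bound with constant `300000 M` for the leave-one-out sums. With `ε = 100 M η L`
the contribution of the latter to the bound for the full sum is reduced by a factor below one half,
so the constant is reproduced. -/
theorem smoothing_bound {M η L ε τ δ β lg : ℝ} (hM : 1 ≤ M) (hη : 0 < η) (hL : 1 ≤ L)
    (hε : ε = 100 * M * (η * L)) (hτ : τ = 1416 * ε + 2 * (300000 * M * (4 * (η * L))))
    (hδη : δ ≤ η) (hβ : β ≤ η ^ 2) (hlg0 : 0 ≤ lg) (hlg : lg ≤ 3 * L) :
    1422 * ε + (10 * M * δ + 344 * M * τ / ε ^ 2 * β) / 2 * lg ≤ 300000 * M * (η * L) := by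
  have hM0 : 0 < M := by linarith
  have hL0 : 0 < L := by linarith
  have hε0 : 0 < ε := by rw [hε]; positivity
  have hτ0 : 0 < τ := by rw [hτ]; positivity
  have h1 : 344 * M * τ / ε ^ 2 * β ≤ 344 * M * τ / ε ^ 2 * η ^ 2 := by gcongr
  have h2 : 344 * M * τ / ε ^ 2 * η ^ 2 = 344 * 2541600 / 10000 * (η / L) := by
    rw [hτ, hε]; field_simp; ring
  have h3 : 10 * M * δ ≤ 10 * M * η := by gcongr
  have h4 : (10 * M * δ + 344 * M * τ / ε ^ 2 * β) / 2 * lg ≤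
      (10 * M * η + 344 * 2541600 / 10000 * (η / L)) / 2 * (3 * L) := by
    refine (mul_le_mul_of_nonneg_right (b := _) (by linarith) hlg0).trans
      (mul_le_mul_of_nonneg_left hlg (by positivity))
  have h5 : (10 * M * η + 344 * 2541600 / 10000 * (η / L)) / 2 * (3 * L) =
      15 * M * (η * L) + 344 * 2541600 / 10000 * 3 / 2 * η := by
    field_simp; ring
  have h6 : η ≤ M * (η * L) := by
    rw [← mul_assoc, mul_comm M, mul_assoc]
    exact le_mul_of_one_le_right hη.le (one_le_mul_of_one_le_of_one_le hM hL)
  have h7 : 1422 * ε = 142200 * (M * (η * L)) := by rw [hε]; ring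
  have h8 : 0 < M * (η * L) := by positivity
  rw [h7]
  linarith

theorem log_one_add_one_div_sq_le {η ε : ℝ} (hη : 0 < η) (hηe : η ≤ Real.exp (-1)) (hε : η ≤ ε) :
    Real.log (1 + 1 / ε ^ 2) ≤ 3 * |Real.log η| := by
  have h1 : Real.log η ≤ -1 := by
    rw [← Real.log_exp (-1)]
    exact Real.log_le_log hη hηe
  have hη1 : η ≤ 1 := hηe.trans (Real.exp_le_one_iff.2 (by norm_num))
  have h2 : 1 + 1 / ε ^ 2 ≤ 2 * (1 / η ^ 2) := by
    have h3 : 1 / ε ^ 2 ≤ 1 / η ^ 2 := by gcongr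
    have h4 : 1 ≤ 1 / η ^ 2 := by
      rw [le_div_iff₀ (by positivity)]
      nlinarith
    linarith
  refine (Real.log_le_log (by positivity) h2).trans ?_
  rw [Real.log_mul two_ne_zero (by positivity), one_div, Real.log_inv, Real.log_pow,
    abs_of_nonpos (by linarith)]
  push_cast
  linarith [Real.log_two_lt_d9]

/-- The bound for closed balls under the normalization `S ≥ 1`, by induction on the summands. -/
theorem abs_measureReal_sum_mem_closedBall_sub_le (H : IndepSummands ξ P) (hd : 0 < d) {M : ℝ}
    (hM : 1 ≤ M) (hT : ∀ b ℓ : ℝ, 0 < ℓ → Nonempty (SmoothStep b ℓ M))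
    {S : Matrix (Fin d) (Fin d) ℝ} (hS : S.PosSemidef) (hS1 : (S - 1).PosSemidef) (s : Finset ι) :
    ∀ η : ℝ, 0 < η → matHSNorm (S - sumCov P ξ s) + Real.sqrt (sumFourth P ξ s) ≤ η →
      ∀ (a : V) (r : ℝ), |(P.map fun ω => ∑ l ∈ s, ξ l ω).real (Metric.closedBall a r) -
        (multivariateGaussian 0 S).real (Metric.closedBall a r)| ≤ 300000 * M * psiLog η := by
  classical
  induction s using Finset.strongInduction with
  | H s ih =>
    intro η hη hδ a r
    have hM0 : 0 < M := by linarith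
    have hξ := H.measurable
    have hWm : ∀ s : Finset ι, Measurable fun ω => ∑ l ∈ s, ξ l ω := fun s =>
      Finset.measurable_fun_sum _ fun l _ => hξ l
    have hprob : ∀ s : Finset ι, IsProbabilityMeasure (P.map fun ω => ∑ l ∈ s, ξ l ω) := fun s =>
      Measure.isProbabilityMeasure_map (hWm s).aemeasurable
    have := hprob s
    have hψ := le_psiLog hη.le
    rcases lt_or_ge (Real.exp (-1)) η with hηe | hηe
    · -- for large `η` the bound exceeds one
      have h1 : (1 : ℝ) / 3 ≤ Real.exp (-1) := by
        rw [Real.exp_neg, one_div]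
        exact inv_anti₀ (Real.exp_pos 1) (Real.exp_one_lt_d9.le.trans (by norm_num))
      have h2 : (1 : ℝ) ≤ 300000 * M * psiLog η := by nlinarith
      refine le_trans (abs_le.2 ⟨?_, ?_⟩) h2 <;>
      linarith [measureReal_nonneg (μ := P.map fun ω => ∑ l ∈ s, ξ l ω)
          (s := Metric.closedBall a r),
        measureReal_nonneg (μ := multivariateGaussian (0 : V) S) (s := Metric.closedBall a r),
        measureReal_le_one (μ := P.map fun ω => ∑ l ∈ s, ξ l ω) (s := Metric.closedBall a r),
        measureReal_le_one (μ := multivariateGaussian (0 : V) S) (s := Metric.closedBall a r)]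
    set L := |Real.log η| with hL
    have hL1 : 1 ≤ L := by
      have h1 : Real.log η ≤ -1 := by
        rw [← Real.log_exp (-1)]
        exact Real.log_le_log hη hηe
      rw [hL, abs_of_nonpos (by linarith)]
      linarith
    have hψe : psiLog η = η * L := by rw [psiLog, max_eq_left hL1]
    set ε := 100 * M * (η * L) with hε
    have hηL : η ≤ η * L := le_mul_of_one_le_right hη.le hL1
    have hηε : η ≤ ε := by rw [hε]; nlinarith
    have hε0 : 0 < ε := hη.trans_le hηε
    set τ := 1416 * ε + 2 * (300000 * M * (4 * (η * L))) with hτ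
    have hτ0 : 0 ≤ τ := by positivity
    have hd1 : (1 : ℝ) ≤ Real.sqrt d := by
      rw [Real.one_le_sqrt]; exact_mod_cast hd
    have hδ0 := matHSNorm_nonneg (S - sumCov P ξ s)
    have hβ0 := sumFourth_nonneg (P := P) (ξ := ξ) s
    have hβ : sumFourth P ξ s ≤ η ^ 2 := by
      rw [← Real.sqrt_le_left hη.le]
      linarith
    set R := (10 * M * (matHSNorm (S - sumCov P ξ s) + Real.sqrt (sumFourth P ξ s)) +
        344 * M * τ / ε ^ 2 * sumFourth P ξ s) / 2 * Real.log (1 + 1 / ε ^ 2) with hR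
    have hlog0 : 0 ≤ Real.log (1 + 1 / ε ^ 2) := by
      refine Real.log_nonneg ?_
      have : 0 ≤ 1 / ε ^ 2 := by positivity
      linarith
    have hR0 : 0 ≤ R := by positivity
    rw [hψe]
    refine le_trans (abs_measureReal_closedBall_sub_le hd hS hS1 hε0 hR0 (fun ρ hρ => ?_) r)
      (smoothing_bound hM hη hL1 hε hτ hδ hβ hlog0 (log_one_add_one_div_sq_le hη hηe hηε))
    have hερ : ε ≤ ρ := (le_mul_of_one_le_right hε0.le hd1).trans hρ
    obtain ⟨T⟩ := hT (ρ ^ 2) ((ρ + ε) ^ 2 - ρ ^ 2) (by nlinarith)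
    have hmain := abs_integral_rad0_sub_le T H hd hM hε0 hρ hS hS1 (s := s) a hτ0
      fun k hk c hc hc1 v => by
        -- the leave-one-out sum satisfies the bound with `2 η`
        have hk' := ih (s.erase k) (Finset.erase_ssubset hk) (2 * η) (by positivity)
          ((H.error_erase_le S hk).trans (by linarith))
        have hψ2 := psiLog_two_mul_le hη
        rw [hψe] at hψ2
        have := hprob (s.erase k)
        have h := measureReal_smul_add_mem_shell_le hd hS hS1
          (κ := 300000 * M * (4 * (η * L)))
          (fun a r => (hk' a r).trans (by gcongr)) hε0 hερ hc hc1 v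
        have hms : MeasurableSet {x : V | c • x + v ∈ shell V ρ ε} :=
          (measurableSet_add_mem_shell v).preimage (measurable_const_smul c)
        rwa [map_measureReal_apply (hWm _) hms] at h
    rw [← integral_map (φ := fun ω => ∑ l ∈ s, ξ l ω) (f := fun x => rad0 T.g (x - a))
      (hWm s).aemeasurable ((continuous_rad0 T).comp (by fun_prop)).aestronglyMeasurable,
      abs_le] at hmain
    have hsand := fun (ν : Measure V) [IsProbabilityMeasure ν] =>
      measureReal_closedBall_sandwich T (hε0.le.trans hερ) hε0.le ν a
    have h1 := hsand (P.map fun ω => ∑ l ∈ s, ξ l ω)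
    have h2 := hsand (multivariateGaussian 0 S)
    exact ⟨by linarith [hmain.1, h1.1, h2.2], by linarith [hmain.2, h1.2, h2.1]⟩

end Induction

/-! ### Normalization of the covariance matrix -/

section Normalization

variable {d : ℕ}

local notation "V" => EuclideanSpace ℝ (Fin d)

theorem mulVec_dotProduct_le_matOpNorm (A : Matrix (Fin d) (Fin d) ℝ) (x : Fin d → ℝ) :
    (A.mulVec x) ⬝ᵥ x ≤ matOpNorm A * (x ⬝ᵥ x) := by
  have h1 := (Matrix.toEuclideanCLM (n := Fin d) (𝕜 := ℝ) A).le_opNorm (WithLp.toLp 2 x)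
  rw [← matOpNorm_eq_norm_toEuclideanCLM] at h1
  have h2 := real_inner_le_norm (Matrix.toEuclideanCLM (n := Fin d) (𝕜 := ℝ) A (WithLp.toLp 2 x))
    (WithLp.toLp 2 x)
  have h3 : ⟪Matrix.toEuclideanCLM (n := Fin d) (𝕜 := ℝ) A (WithLp.toLp 2 x), WithLp.toLp 2 x⟫ =
      (A.mulVec x) ⬝ᵥ x := by
    simp [PiLp.inner_apply, dotProduct, mul_comm]
  have h4 : x ⬝ᵥ x = ‖WithLp.toLp 2 x‖ ^ 2 := by
    rw [EuclideanSpace.real_norm_sq_eq]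
    simp [dotProduct, pow_two]
  rw [h3] at h2
  rw [h4]
  nlinarith [norm_nonneg (WithLp.toLp 2 x)]

theorem matOpNorm_inv_pos (hd : 0 < d) {S : Matrix (Fin d) (Fin d) ℝ} (hS : IsUnit S) :
    0 < matOpNorm S⁻¹ := by
  have : Nonempty (Fin d) := ⟨⟨0, hd⟩⟩
  have h0 : 0 ≤ matOpNorm S⁻¹ := by
    rw [matOpNorm_eq_norm_toEuclideanCLM]; positivity
  refine h0.lt_of_ne' fun h => ?_
  rw [matOpNorm_eq_norm_toEuclideanCLM, norm_eq_zero, map_eq_zero_iff _ (EquivLike.injective _)] at h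
  have h1 := Matrix.mul_nonsing_inv S ((Matrix.isUnit_iff_isUnit_det S).1 hS)
  rw [h, mul_zero] at h1
  exact zero_ne_one h1

/-- The matrix `S` dominates `‖S⁻¹‖⁻¹`: test the nonnegativity of `S` on `x - ‖S⁻¹‖⁻¹ S⁻¹ x`. -/
theorem posSemidef_smul_sub_one (hd : 0 < d) {S : Matrix (Fin d) (Fin d) ℝ} (hS : S.PosSemidef)
    (hSu : IsUnit S) : (matOpNorm S⁻¹ • S - 1).PosSemidef := by
  set l := matOpNorm S⁻¹ with hl
  have hl0 : 0 < l := matOpNorm_inv_pos hd hSu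
  refine .of_dotProduct_mulVec_nonneg
    ((hS.smul hl0.le).1.sub Matrix.isHermitian_one) fun x => ?_
  set y := S⁻¹.mulVec x with hy
  have hSy : S.mulVec y = x := by
    rw [hy, Matrix.mulVec_mulVec, Matrix.mul_nonsing_inv S ((Matrix.isUnit_iff_isUnit_det S).1 hSu),
      Matrix.one_mulVec]
  have hsym : y ⬝ᵥ S.mulVec x = x ⬝ᵥ x := by
    have hT : S.transpose = S := by simpa using hS.1.eq
    rw [Matrix.dotProduct_mulVec, ← Matrix.mulVec_transpose, hT, hSy]
  have h1 := hS.dotProduct_mulVec_nonneg (x - l⁻¹ • y)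
  have h2 : y ⬝ᵥ x ≤ l * (x ⬝ᵥ x) := mulVec_dotProduct_le_matOpNorm S⁻¹ x
  simp only [star_trivial, Matrix.mulVec_sub, Matrix.mulVec_smul, hSy, sub_dotProduct,
    dotProduct_sub, smul_dotProduct, dotProduct_smul, smul_eq_mul, hsym] at h1
  simp only [star_trivial, Matrix.sub_mulVec, Matrix.smul_mulVec, Matrix.one_mulVec,
    dotProduct_sub, dotProduct_smul, smul_eq_mul]
  have h3 : l⁻¹ * (l⁻¹ * (y ⬝ᵥ x)) ≤ l⁻¹ * (x ⬝ᵥ x) := by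
    refine mul_le_mul_of_nonneg_left ?_ (by positivity)
    rw [inv_mul_le_iff₀ hl0]
    exact h2
  have h4 : l⁻¹ * (x ⬝ᵥ x) ≤ x ⬝ᵥ S.mulVec x := by linarith
  rw [inv_mul_le_iff₀ hl0] at h4
  linarith

theorem map_smul_multivariateGaussian {S : Matrix (Fin d) (Fin d) ℝ} (hS : S.PosSemidef) {t l : ℝ}
    (ht : t ^ 2 = l) :
    (multivariateGaussian (0 : V) S).map (t • ·) = multivariateGaussian (0 : V) (l • S) := by
  have hl : 0 ≤ l := by rw [← ht]; positivity
  have := Measure.isProbabilityMeasure_map (μ := multivariateGaussian (0 : V) S)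
    (f := (t • ·)) (by fun_prop)
  apply Measure.ext_of_charFun
  ext x
  rw [charFun_map_smul, charFun_multivariateGaussian hS, charFun_multivariateGaussian (hS.smul hl)]
  congr 2
  · simp
  · simp only [WithLp.ofLp_smul, Matrix.mulVec_smul, Matrix.smul_mulVec,
      smul_dotProduct, dotProduct_smul, smul_eq_mul, ← ht]
    push_cast
    ring

variable {Ω ι : Type*} [MeasurableSpace Ω] {P : Measure Ω}
  {ξ : ι → Ω → EuclideanSpace ℝ (Fin d)}

theorem IndepSummands.smul (H : IndepSummands ξ P) (t : ℝ) :
    IndepSummands (fun k ω => t • ξ k ω) P where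
  measurable k := (H.measurable k).const_smul t
  indep := H.indep.comp (fun _ x => t • x) fun _ => measurable_const_smul t
  integrable_four k := by
    simp only [norm_smul, mul_pow]
    exact (H.integrable_four k).const_mul _
  integral_eq_zero k := by rw [integral_smul, H.integral_eq_zero k, smul_zero]

theorem sumFourth_smul (t : ℝ) (s : Finset ι) :
    sumFourth P (fun k ω => t • ξ k ω) s = (t ^ 2) ^ 2 * sumFourth P ξ s := by
  simp only [sumFourth, norm_smul, mul_pow, integral_const_mul, Real.norm_eq_abs, Finset.mul_sum]
  refine Finset.sum_congr rfl fun k _ => ?_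
  rw [show |t| ^ 4 = (|t| ^ 2) ^ 2 by ring, sq_abs]

theorem IndepSummands.sumCov_smul (H : IndepSummands ξ P) (t : ℝ) (s : Finset ι) :
    sumCov P (fun k ω => t • ξ k ω) s = t ^ 2 • sumCov P ξ s := by
  ext i j
  simp only [sumCov, Matrix.sum_apply, Matrix.smul_apply, smul_eq_mul, Finset.mul_sum]
  refine Finset.sum_congr rfl fun k _ => ?_
  rw [(H.smul t).secondMoment_apply, H.secondMoment_apply, ← integral_const_mul]
  congr 1; ext ω
  simp only [PiLp.smul_apply, smul_eq_mul]
  ring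

variable [IsProbabilityMeasure P]

theorem IndepSummands.memLp_apply (H : IndepSummands ξ P) (k : ι) (i : Fin d) :
    MemLp (fun ω => ξ k ω i) 2 P := by
  have := H.measurable k
  rw [memLp_two_iff_integrable_sq (by fun_prop)]
  simp_rw [pow_two]
  exact H.integrable_apply_mul_apply k i i

theorem IndepSummands.integral_apply_eq_zero (H : IndepSummands ξ P) (k : ι) (i : Fin d) :
    ∫ ω, ξ k ω i ∂P = 0 := by
  have hi : Integrable (ξ k) P := by
    have := H.integrable_norm_pow k (m := 1) (by norm_num)
    simp only [pow_one] at this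
    exact (integrable_norm_iff (H.measurable k).aestronglyMeasurable).1 this
  have h := (EuclideanSpace.proj i : V →L[ℝ] ℝ).integral_comp_comm hi
  rw [H.integral_eq_zero k, map_zero] at h
  exact h

/-- The covariance matrix of a sum of independent centered vectors. -/
theorem IndepSummands.varMatrix_sum (H : IndepSummands ξ P) (s : Finset ι) :
    varMatrix P (fun ω => ∑ k ∈ s, ξ k ω) = sumCov P ξ s := by
  classical
  ext i j
  simp only [varMatrix, sumCov, Matrix.of_apply, WithLp.ofLp_sum, Finset.sum_apply,
    Matrix.sum_apply]
  rw [covariance_fun_sum_fun_sum' (X := fun k ω => ξ k ω i) (Y := fun k ω => ξ k ω j)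
    (fun k _ => H.memLp_apply k i) fun k _ => H.memLp_apply k j]
  refine Finset.sum_congr rfl fun k hk => ?_
  rw [Finset.sum_eq_single k]
  · rw [covariance_eq_sub (H.memLp_apply k i) (H.memLp_apply k j), H.integral_apply_eq_zero k i,
      H.secondMoment_apply]
    simp
  · intro l _ hl
    exact ((H.indep.indepFun (Ne.symm hl)).comp (φ := fun x : V => x i) (ψ := fun x : V => x j)
      (by fun_prop) (by fun_prop)).covariance_eq_zero (H.memLp_apply k i) (H.memLp_apply l j)
  · exact fun h => absurd hk h

/-- The bound for closed balls, with the Gaussian law normalized by scaling. -/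
theorem IndepSummands.abs_measureReal_closedBall_sub_le {n : ℕ}
    {ξ : Fin n → Ω → EuclideanSpace ℝ (Fin d)} (H : IndepSummands ξ P) (hd : 0 < d) {M : ℝ}
    (hM : 1 ≤ M) (hT : ∀ b ℓ : ℝ, 0 < ℓ → Nonempty (SmoothStep b ℓ M))
    {S : Matrix (Fin d) (Fin d) ℝ} (hS : S.PosSemidef) (hSu : IsUnit S) {η : ℝ} (hη : 0 < η)
    (hδ : deltaBall P ξ S ≤ η) (a : V) (r : ℝ) :
    |(P.map fun ω => ∑ i, ξ i ω).real (Metric.closedBall a r) -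
      (multivariateGaussian 0 S).real (Metric.closedBall a r)| ≤ 300000 * M * psiLog η := by
  set l := matOpNorm S⁻¹ with hl
  have hl0 : 0 < l := matOpNorm_inv_pos hd hSu
  set t := Real.sqrt l with ht
  have ht0 : 0 < t := Real.sqrt_pos.2 hl0
  have ht2 : t ^ 2 = l := Real.sq_sqrt hl0.le
  have hW : Measurable fun ω => ∑ i, ξ i ω :=
    Finset.measurable_fun_sum _ fun i _ => H.measurable i
  have herr : matHSNorm (l • S - sumCov P (fun k ω => t • ξ k ω) Finset.univ) +
      Real.sqrt (sumFourth P (fun k ω => t • ξ k ω) Finset.univ) = deltaBall P ξ S := by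
    rw [H.sumCov_smul, sumFourth_smul, ht2, ← smul_sub, matHSNorm_smul, abs_of_pos hl0,
      Real.sqrt_mul (by positivity), Real.sqrt_sq hl0.le, deltaBall, H.varMatrix_sum, mul_add]
    rfl
  have h := abs_measureReal_sum_mem_closedBall_sub_le (H.smul t) hd hM hT (hS.smul hl0.le)
    (posSemidef_smul_sub_one hd hS hSu) Finset.univ η hη (herr.le.trans hδ) (t • a) (t * r)
  have hpre : (t • · : V → V) ⁻¹' Metric.closedBall (t • a) (t * r) = Metric.closedBall a r := by
    ext x
    simp only [Set.mem_preimage, mem_closedBall_iff_norm, ← smul_sub, norm_smul,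
      Real.norm_of_nonneg ht0.le, mul_le_mul_iff_right₀ ht0]
  have hmap : (P.map fun ω => ∑ i, t • ξ i ω) = (P.map fun ω => ∑ i, ξ i ω).map (t • ·) := by
    rw [Measure.map_map (by fun_prop) hW]
    congr 1; ext1 ω
    simp [Finset.smul_sum]
  rwa [hmap, ← map_smul_multivariateGaussian hS ht2,
    map_measureReal_apply (by fun_prop) measurableSet_closedBall,
    map_measureReal_apply (by fun_prop) measurableSet_closedBall, hpre] at h

end Normalization

/-! ### Passage to all balls -/

section Final

variable {d : ℕ}

local notation "V" => EuclideanSpace ℝ (Fin d)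

theorem psiLog_eq_max {x : ℝ} (hx : 0 ≤ x) : psiLog x = max |x * Real.log x| x := by
  rw [psiLog, mul_max_of_nonneg _ _ hx, abs_mul, abs_of_nonneg hx, mul_one]

/-- The function `psiLog` is right-continuous on the nonnegative half-line, so a bound for all `η > δ`
passes to `δ`. This covers `δ = 0`. -/
theorem le_psiLog_of_forall_lt {δ c K : ℝ} (hδ : 0 ≤ δ) (h : ∀ η, δ < η → c ≤ K * psiLog η) :
    c ≤ K * psiLog δ := by
  have hc : Continuous fun x : ℝ => K * max |x * Real.log x| x :=
    continuous_const.mul (Real.continuous_mul_log.abs.max continuous_id)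
  rw [psiLog_eq_max hδ]
  refine ge_of_tendsto ((hc.tendsto δ).mono_left
    (nhdsWithin_le_nhds : nhdsWithin δ (Set.Ioi δ) ≤ nhds δ)) ?_
  filter_upwards [self_mem_nhdsWithin] with η hη
  rw [← psiLog_eq_max (hδ.trans (le_of_lt hη))]
  exact h η hη

/-- An open ball is the increasing union of concentric closed balls. -/
theorem tendsto_measureReal_closedBall (ν : Measure V) [IsProbabilityMeasure ν] (a : V) (r : ℝ) :
    Filter.Tendsto (fun n : ℕ => ν.real (Metric.closedBall a (r - 1 / (n + 1)))) Filter.atTop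
      (nhds (ν.real (Metric.ball a r))) := by
  have hU : ⋃ n : ℕ, Metric.closedBall a (r - 1 / (n + 1)) = Metric.ball a r := by
    ext x
    simp only [Set.mem_iUnion, Metric.mem_closedBall, Metric.mem_ball]
    constructor
    · rintro ⟨n, hn⟩
      have : (0 : ℝ) < 1 / (n + 1) := by positivity
      linarith
    · intro h
      obtain ⟨n, hn⟩ := exists_nat_one_div_lt (sub_pos.2 h)
      exact ⟨n, by linarith⟩
  rw [← hU]
  refine (ENNReal.tendsto_toReal (measure_ne_top _ _)).comp (tendsto_measure_iUnion_atTop ?_)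
  intro m n hmn
  refine Metric.closedBall_subset_closedBall ?_
  have : (1 : ℝ) / (n + 1) ≤ 1 / (m + 1) := by gcongr
  linarith

theorem abs_measureReal_sub_le_of_mem_euclideanBalls {μ ν : Measure V} [IsProbabilityMeasure μ]
    [IsProbabilityMeasure ν] {c : ℝ}
    (h : ∀ a r, |μ.real (Metric.closedBall a r) - ν.real (Metric.closedBall a r)| ≤ c)
    {A : Set V} (hA : A ∈ euclideanBalls d) : |μ.real A - ν.real A| ≤ c := by
  obtain ⟨a, r, -, rfl | rfl⟩ := hA
  · exact le_of_tendsto ((tendsto_measureReal_closedBall μ a r).sub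
      (tendsto_measureReal_closedBall ν a r)).abs (.of_forall fun n => h a _)
  · exact h a r

theorem measurableSet_of_mem_euclideanBalls {A : Set V} (hA : A ∈ euclideanBalls d) :
    MeasurableSet A := by
  obtain ⟨a, r, -, rfl | rfl⟩ := hA
  · exact measurableSet_ball
  · exact measurableSet_closedBall

theorem deltaBall_nonneg {Ω : Type*} [MeasurableSpace Ω] (P : Measure Ω) {n : ℕ}
    (ξ : Fin n → Ω → EuclideanSpace ℝ (Fin d)) (S : Matrix (Fin d) (Fin d) ℝ) :
    0 ≤ deltaBall P ξ S := by
  have h0 : 0 ≤ matOpNorm S⁻¹ := by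
    rw [matOpNorm_eq_norm_toEuclideanCLM]; positivity
  exact mul_nonneg h0 (add_nonneg (matHSNorm_nonneg _) (Real.sqrt_nonneg _))

theorem deltaBall_congr {Ω : Type*} [MeasurableSpace Ω] {P : Measure Ω} {n : ℕ}
    {ξ ζ : Fin n → Ω → EuclideanSpace ℝ (Fin d)} (h : ∀ i, ξ i =ᵐ[P] ζ i)
    (S : Matrix (Fin d) (Fin d) ℝ) : deltaBall P ξ S = deltaBall P ζ S := by
  have hs : (fun ω => ∑ i, ξ i ω) =ᵐ[P] fun ω => ∑ i, ζ i ω := by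
    filter_upwards [ae_all_iff.2 h] with ω hω
    exact Finset.sum_congr rfl fun i _ => hω i
  have hv : varMatrix P (fun ω => ∑ i, ξ i ω) = varMatrix P fun ω => ∑ i, ζ i ω := by
    ext j k
    have e : ∀ j : Fin d, ∫ ω, (∑ i, ξ i ω) j ∂P = ∫ ω, (∑ i, ζ i ω) j ∂P := fun j =>
      integral_congr_ae (hs.mono fun ω hω => congrArg (fun x : V => x j) hω)
    simp only [varMatrix, Matrix.of_apply, covariance, e]
    refine integral_congr_ae (hs.mono fun ω hω => ?_)
    simp only at hω ⊢
    rw [hω]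
  have hf : ∀ i, ∫ ω, ‖ξ i ω‖ ^ 4 ∂P = ∫ ω, ‖ζ i ω‖ ^ 4 ∂P := fun i =>
    integral_congr_ae ((h i).mono fun ω hω => by simp only [hω])
  simp only [deltaBall, hv, hf]

end Final

theorem mainTheorem2 :
    ∃ C : ℝ, 0 < C ∧
      ∀ (n d : ℕ)
        (Ω : Type*) [MeasurableSpace Ω] (P : Measure Ω) [IsProbabilityMeasure P]
        (Ω' : Type*) [MeasurableSpace Ω'] (P' : Measure Ω') [IsProbabilityMeasure P']
        (ξ : Fin n → Ω → EuclideanSpace ℝ (Fin d))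
        (Z : Ω' → EuclideanSpace ℝ (Fin d))
        (S : Matrix (Fin d) (Fin d) ℝ),
        iIndepFun ξ P →
        (∀ i, MemLp (ξ i) 4 P) →
        (∀ i, ∫ ω, ξ i ω ∂P = 0) →
        S.PosSemidef →
        IsUnit S →
        HasLaw Z (multivariateGaussian 0 S) P' →
        ∀ A ∈ euclideanBalls d,
          |P.real {ω | (∑ i, ξ i ω) ∈ A} - P'.real {ω | Z ω ∈ A}| ≤
            C * psiLog (deltaBall P ξ S) := by
  obtain ⟨M, hM, hT⟩ := exists_smoothStep
  refine ⟨300000 * M, by positivity, ?_⟩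
  intro n d Ω _ P _ Ω' _ P' _ ξ Z S hind h4 h0 hS hSu hZ A hA
  have hδ0 := deltaBall_nonneg P ξ S
  rcases Nat.eq_zero_or_pos d with rfl | hd
  · -- in dimension zero a ball is empty or the whole space
    have hR : 0 ≤ 300000 * M * psiLog (deltaBall P ξ S) :=
      mul_nonneg (by positivity) (psiLog_nonneg hδ0)
    rcases Set.eq_empty_or_nonempty A with rfl | hne
    · simpa using hR
    · obtain rfl : A = Set.univ := Subsingleton.eq_univ_of_nonempty hne
      simpa using hR
  have hAm := measurableSet_of_mem_euclideanBalls hA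
  -- measurable versions of the summands
  have hm : ∀ i, AEMeasurable (ξ i) P := fun i => (h4 i).1.aemeasurable
  set ζ : Fin n → Ω → EuclideanSpace ℝ (Fin d) := fun i => (hm i).mk (ξ i) with hζ
  have hae : ∀ i, ξ i =ᵐ[P] ζ i := fun i => (hm i).ae_eq_mk
  have H : IndepSummands ζ P :=
    { measurable := fun i => (hm i).measurable_mk
      indep := hind.congr hae
      integrable_four := fun i => by
        have := ((h4 i).ae_eq (hae i)).integrable_norm_pow (p := 4) (by norm_num)
        exact this
      integral_eq_zero := fun i => by rw [← integral_congr_ae (hae i), h0 i] }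
  have hW : Measurable fun ω => ∑ i, ζ i ω :=
    Finset.measurable_fun_sum _ fun i _ => H.measurable i
  have := Measure.isProbabilityMeasure_map (μ := P) hW.aemeasurable
  have e1 : P.real {ω | (∑ i, ξ i ω) ∈ A} = (P.map fun ω => ∑ i, ζ i ω).real A := by
    rw [map_measureReal_apply hW hAm]
    refine measureReal_congr ?_
    filter_upwards [ae_all_iff.2 hae] with ω hω
    change ((∑ i, ξ i ω) ∈ A) = ((∑ i, ζ i ω) ∈ A)
    simp only [hω]
  have e2 : P'.real {ω | Z ω ∈ A} = (multivariateGaussian 0 S).real A := hZ.measureReal_eq hAm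
  rw [e1, e2]
  refine le_psiLog_of_forall_lt hδ0 fun η hη => ?_
  refine abs_measureReal_sub_le_of_mem_euclideanBalls (fun a r => ?_) hA
  refine H.abs_measureReal_closedBall_sub_le hd hM hT hS hSu (hδ0.trans_lt hη) ?_ a r
  rw [← deltaBall_congr hae]
  exact hη.le
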